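/- Let $n\ge 4$ and let $Z\in\mathbb{R}^{n\times 4}$ be totally positive, i.e. all its $4\times4$ minors are nonzero and have the same sign. Let $Z_1,\dots,Z_n\in\mathbb{P}^3$ be the points given by its rows, with indices read cyclically ($Z_{n+1}=Z_1$), and let $\langle ABij\rangle=\det(A,B,Z_i,Z_j)$. Assume (genericity) that there is no line $AB$ in $\mathbb{P}^3_{\mathbb{R}}$ for which more than four of the brackets $\langle AB\,i(i+1)\rangle$, $i=1,\dots,n$, vanish. The amplituhedron $\mathcal{A}_n\subset \mathrm{Gr}_{\mathbb{R}}(2,4)$ is the image of the totally nonnegative Grassmannian $\mathrm{Gr}(2,n)_{\ge0}$ (the planes in $\mathbb{R}^n$ all of whose nonzero Plücker coordinates have the same sign) under $X\mapsto X\cdot Z$. Its algebraic boundary $\partial_a\mathcal{A}_n$ is the Zariski closure in $\mathrm{Gr}_{\mathbb{C}}(2,4)$ of the Euclidean boundary $\mathcal{A}_n\setminus\mathrm{int}(\mathcal{A}_n)$. The strata of $\partial_a\mathcal{A}_n$ are its irreducible components and, recursively, all irreducible components of intersections of strata. The residual arrangement $\mathcal{R}(\mathcal{A}_n)\subset\mathrm{Gr}_{\mathbb{C}}(2,4)$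 is the union of all strata that do not intersect $\mathcal{A}_n$. Then the following hold. 1. $\mathcal{R}(\mathcal{A}_n)$ is the union of the residual lines of type $(1,\mathrm{III})$, i.e. the sets of complex lines in $\mathbb{P}^3$ that are contained in the plane $Z_{i-1}Z_iZ_{i+1}$ and meet the line $Z_jZ_{j+1}$, where $\{i-1,i,i+1\}\cap\{j,j+1\}=\emptyset$, and of the residual conics of type $(1,\mathrm{IV})$, i.e. the sets of complex lines in $\mathbb{P}^3$ that meet the three lines $Z_iZ_{i+1}$, $Z_jZ_{j+1}$, $Z_kZ_{k+1}$, where $\{i,i+1\}$, $\{j,j+1\}$, $\{k,k+1\}$ are pairwise disjoint. 2. Let $R=\mathbb{C}[p_{12},p_{13},p_{14},p_{23},p_{24},p_{34}]/\langle p_{12}p_{34}-p_{13}p_{24}+p_{14}p_{23}\rangle$ be the homogeneous coordinate ring of $\mathrm{Gr}_{\mathbb{C}}(2,4)$. There is a nonzero form $\alpha_{\mathcal{A}_n}\in R_{n-4}$ that vanishes at every point of $\mathcal{R}(\mathcal{A}_n)$, and every form in $R_{n-4}$ that vanishes at every point of $\mathcal{R}(\mathcal{A}_n)$ is a complex multiple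 of $\alpha_{\mathcal{A}_n}$. -/

import Mathlib

noncomputable section

namespace TreeAmplituhedron

/-! ### Grassmannians -/

/-- The Grassmannian of `k`-dimensional linear subspaces of `K ^ m`. -/
@[ext]
structure Gr (K : Type) [Field K] (k m : ℕ) where
  /-- the subspace -/
  space : Submodule K (Fin m → K)
  /-- its dimension is `k` -/
  finrank_space : Module.finrank K space = k

/-- The point of the Grassmannian represented by a `k × m` matrix of rank `k`: its row span. -/
def Gr.rowSpan {K : Type} [Field K] {k m : ℕ} (X : Matrix (Fin k) (Fin m) K)
    (hX : LinearIndependent K X.row) : Gr K k m where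
  space := Submodule.span K (Set.range X.row)
  finrank_space := by rw [finrank_span_eq_card hX, Fintype.card_fin]

/-- The Euclidean topology on a real Grassmannian: the quotient topology of the space of
`k × m` matrices of rank `k`. -/
instance euclideanTopology (k m : ℕ) : TopologicalSpace (Gr ℝ k m) :=
  TopologicalSpace.coinduced
    (fun X : {X : Matrix (Fin k) (Fin m) ℝ // LinearIndependent ℝ X.row} => Gr.rowSpan X.1 X.2)
    inferInstance

/-- The vector in `ℂ ^ m` with the same (real) coordinates. -/
def toComplex {m : ℕ} (v : Fin m → ℝ) : Fin m → ℂ := fun i => (v i : ℂ)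

theorem linearIndependent_toComplex {k m : ℕ} {v : Fin k → Fin m → ℝ}
    (hv : LinearIndependent ℝ v) : LinearIndependent ℂ fun i => toComplex (v i) := by
  rw [Fintype.linearIndependent_iff] at hv ⊢
  intro g hg i
  have hre := hv (fun i => (g i).re) (by
    funext a
    have := congrArg Complex.re (congrFun hg a)
    simpa [toComplex, Finset.sum_apply] using this) i
  have him := hv (fun i => (g i).im) (by
    funext a
    have := congrArg Complex.im (congrFun hg a)
    simpa [toComplex, Finset.sum_apply] using this) i
  exact Complex.ext hre him

/-- The inclusion of the real points `Gr_ℝ(k, m)` into `Gr_ℂ(k, m)`: the complex span. -/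
def Gr.complexify {k m : ℕ} (V : Gr ℝ k m) : Gr ℂ k m where
  space := Submodule.span ℂ (toComplex '' (V.space : Set (Fin m → ℝ)))
  finrank_space := by
    let b := Module.finBasisOfFinrankEq ℝ V.space V.finrank_space
    have hli : LinearIndependent ℂ fun i => toComplex (b i : Fin m → ℝ) :=
      linearIndependent_toComplex (b.linearIndependent.map' V.space.subtype (by simp))
    have hspan : Submodule.span ℂ (toComplex '' (V.space : Set (Fin m → ℝ))) =
        Submodule.span ℂ (Set.range fun i => toComplex (b i : Fin m → ℝ)) := by
      apply le_antisymm
      · rw [Submodule.span_le]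
        rintro _ ⟨v, hv, rfl⟩
        have h := b.sum_repr ⟨v, hv⟩
        have h' : toComplex v =
            ∑ i, ((b.repr ⟨v, hv⟩ i : ℝ) : ℂ) • toComplex (b i : Fin m → ℝ) := by
          funext a
          have := congrFun (congrArg Subtype.val h) a
          have h2 : v a = ∑ i, b.repr ⟨v, hv⟩ i * (b i : Fin m → ℝ) a := by
            refine this.symm.trans ?_
            simp only [Submodule.coe_sum, Submodule.coe_smul, Finset.sum_apply, Pi.smul_apply,
              smul_eq_mul]
          simp only [toComplex, Finset.sum_apply, Pi.smul_apply, smul_eq_mul]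
          rw [h2]
          push_cast
          rfl
        rw [h']
        exact Submodule.sum_mem _ fun i _ =>
          Submodule.smul_mem _ _ (Submodule.subset_span ⟨i, rfl⟩)
      · rw [Submodule.span_le]
        rintro _ ⟨i, rfl⟩
        exact Submodule.subset_span ⟨_, (b i).2, rfl⟩
    rw [hspan, finrank_span_eq_card hli, Fintype.card_fin]

/-! ### The homogeneous coordinate ring of `Gr_ℂ(2, 4)` and its Zariski topology -/

/-- The Plücker coordinates `(p₁₂, p₁₃, p₁₄, p₂₃, p₂₄, p₃₄)` of the line through `A` and `B`. -/
def plucker {K : Type} [Field K] (A B : Fin 4 → K) : Fin 6 → K :=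
  ![A 0 * B 1 - A 1 * B 0, A 0 * B 2 - A 2 * B 0, A 0 * B 3 - A 3 * B 0,
    A 1 * B 2 - A 2 * B 1, A 1 * B 3 - A 3 * B 1, A 2 * B 3 - A 3 * B 2]

/-- The ideal generated by the Plücker relation `p₁₂ p₃₄ - p₁₃ p₂₄ + p₁₄ p₂₃`. -/
def pluckerIdeal : Ideal (MvPolynomial (Fin 6) ℂ) :=
  Ideal.span {MvPolynomial.X 0 * MvPolynomial.X 5 - MvPolynomial.X 1 * MvPolynomial.X 4
    + MvPolynomial.X 2 * MvPolynomial.X 3}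

/-- The homogeneous coordinate ring `R` of `Gr_ℂ(2, 4)`. -/
abbrev CoordRing : Type := MvPolynomial (Fin 6) ℂ ⧸ pluckerIdeal

/-- The degree `d` part `R_d` of the coordinate ring. -/
def forms (d : ℕ) : Submodule ℂ CoordRing :=
  (MvPolynomial.homogeneousSubmodule (Fin 6) ℂ d).map
    (Ideal.Quotient.mkₐ ℂ pluckerIdeal).toLinearMap

/-- Evaluation of an element of the coordinate ring at the Plücker vector of `A`, `B`. -/
def evalAt (A B : Fin 4 → ℂ) : CoordRing →ₐ[ℂ] ℂ :=
  Ideal.Quotient.liftₐ pluckerIdeal (MvPolynomial.aeval (plucker A B)) (by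
    intro f hf
    have hle : pluckerIdeal ≤
        RingHom.ker (MvPolynomial.aeval (R := ℂ) (plucker A B)).toRingHom := by
      rw [pluckerIdeal, Ideal.span_le, Set.singleton_subset_iff, SetLike.mem_coe,
        RingHom.mem_ker]
      simp [plucker]
      ring
    exact hle hf)

/-- `f` vanishes at the point `V` of `Gr_ℂ(2, 4)`: it is zero at every vector of homogeneous
Plücker coordinates of `V`. -/
def VanishesAt (f : CoordRing) (V : Gr ℂ 2 4) : Prop :=
  ∀ A B : Fin 4 → ℂ, Submodule.span ℂ {A, B} = V.space → evalAt A B f = 0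

/-- The Zariski topology on `Gr_ℂ(2, 4)`: generated by the non-vanishing loci of forms. -/
instance zariskiTopology : TopologicalSpace (Gr ℂ 2 4) :=
  TopologicalSpace.generateFrom
    {U | ∃ d : ℕ, ∃ f ∈ forms d, U = {V : Gr ℂ 2 4 | ¬ VanishesAt f V}}

/-- `C` is an irreducible component of the subset `W`. -/
def IsComponentOf {T : Type} [TopologicalSpace T] (C W : Set T) : Prop :=
  Maximal (fun S : Set T => IsIrreducible S ∧ S ⊆ W) C

/-! ### The amplituhedron -/

/-- A real `n × 4` matrix is totally positive if its maximal minors are nonzero and have the same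
sign. -/
def IsTotallyPositive {n : ℕ} (Z : Matrix (Fin n) (Fin 4) ℝ) : Prop :=
  ∀ I J : Fin 4 ↪o Fin n, 0 < (Z.submatrix I id).det * (Z.submatrix J id).det

/-- A point of `Gr_ℝ(2, n)` is totally nonnegative if all its nonzero Plücker coordinates have the
same sign, i.e. it is the row span of a matrix with nonnegative `2 × 2` minors. -/
def IsTotallyNonneg {n : ℕ} (V : Gr ℝ 2 n) : Prop :=
  ∃ X : Matrix (Fin 2) (Fin n) ℝ, Submodule.span ℝ (Set.range X.row) = V.space ∧
    ∀ i j : Fin n, i < j → 0 ≤ X 0 i * X 1 j - X 0 j * X 1 i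

/-- The amplituhedron: the image of the totally nonnegative Grassmannian `Gr(2, n)_{≥ 0}` under
the map `Gr(2, n) ⇢ Gr(2, 4)`, `X ↦ X Z`. -/
def amplituhedron {n : ℕ} (Z : Matrix (Fin n) (Fin 4) ℝ) : Set (Gr ℝ 2 4) :=
  {Y | ∃ V : Gr ℝ 2 n, IsTotallyNonneg V ∧ Y.space = V.space.map Z.vecMulLinear}

/-- The algebraic boundary: the Zariski closure in `Gr_ℂ(2, 4)` of the Euclidean boundary. -/
def algBoundary {n : ℕ} (Z : Matrix (Fin n) (Fin 4) ℝ) : Set (Gr ℂ 2 4) :=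
  closure (Gr.complexify '' (amplituhedron Z \ interior (amplituhedron Z)))

/-- The closed strata of the algebraic boundary: its irreducible components and, recursively, the
irreducible components of intersections of strata. -/
inductive IsStratum {n : ℕ} (Z : Matrix (Fin n) (Fin 4) ℝ) : Set (Gr ℂ 2 4) → Prop
  | component (C : Set (Gr ℂ 2 4)) : IsComponentOf C (algBoundary Z) → IsStratum Z C
  | inter (S T C : Set (Gr ℂ 2 4)) :
      IsStratum Z S → IsStratum Z T → IsComponentOf C (S ∩ T) → IsStratum Z C

/-- The residual arrangement: the union of all strata in the algebraic boundary that do not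
intersect the amplituhedron. -/
def residualArrangement {n : ℕ} (Z : Matrix (Fin n) (Fin 4) ℝ) : Set (Gr ℂ 2 4) :=
  ⋃₀ {S | IsStratum Z S ∧ Disjoint S (Gr.complexify '' amplituhedron Z)}

/-! ### Genericity, residual lines and conics, adjoint polynomials -/

/-- The cyclic successor `i + 1`. -/
def cycSucc {n : ℕ} (i : Fin n) : Fin n := finRotate n i

/-- The cyclic predecessor `i - 1`. -/
def cycPred {n : ℕ} (i : Fin n) : Fin n := (finRotate n).symm i

/-- `⟨A B C D⟩`. -/
def bracket (A B C D : Fin 4 → ℝ) : ℝ := (Matrix.of ![A, B, C, D]).det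

/-- There is no line `AB` in `ℙ³` for which more than four of the brackets `⟨A B i (i+1)⟩`
vanish. -/
def IsGeneral {n : ℕ} (Z : Matrix (Fin n) (Fin 4) ℝ) : Prop :=
  ∀ A B : Fin 4 → ℝ, LinearIndependent ℝ ![A, B] →
    {i : Fin n | bracket A B (Z i) (Z (cycSucc i)) = 0}.ncard ≤ 4

/-- The Schubert condition `L_{i(i+1)}`: lines in `ℙ³_ℂ` meeting the line `Z_i Z_{i+1}`. -/
def lineCondition {n : ℕ} (Z : Matrix (Fin n) (Fin 4) ℝ) (i : Fin n) : Set (Gr ℂ 2 4) :=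
  {V | V.space ⊓ Submodule.span ℂ {toComplex (Z i), toComplex (Z (cycSucc i))} ≠ ⊥}

/-- The Schubert condition `P_{(i-1)i(i+1)}`: lines in `ℙ³_ℂ` contained in the plane
`Z_{i-1} Z_i Z_{i+1}`. -/
def planeCondition {n : ℕ} (Z : Matrix (Fin n) (Fin 4) ℝ) (i : Fin n) : Set (Gr ℂ 2 4) :=
  {V | V.space ≤
    Submodule.span ℂ {toComplex (Z (cycPred i)), toComplex (Z i), toComplex (Z (cycSucc i))}}

/-- The residual lines, type `(1, III)`: the sets `P_{(i-1)i(i+1)} L_{j(j+1)}` with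
`{i-1, i, i+1} ∩ {j, j+1} = ∅`. -/
def IsResidualLine {n : ℕ} (Z : Matrix (Fin n) (Fin 4) ℝ) (S : Set (Gr ℂ 2 4)) : Prop :=
  ∃ i j : Fin n, Disjoint ({cycPred i, i, cycSucc i} : Set (Fin n)) {j, cycSucc j} ∧
    S = planeCondition Z i ∩ lineCondition Z j

/-- The residual conics, type `(1, IV)`: the sets `L_{i(i+1)} L_{j(j+1)} L_{k(k+1)}` with
`{i, i+1}`, `{j, j+1}`, `{k, k+1}` pairwise disjoint. -/
def IsResidualConic {n : ℕ} (Z : Matrix (Fin n) (Fin 4) ℝ) (S : Set (Gr ℂ 2 4)) : Prop :=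
  ∃ i j k : Fin n, Disjoint ({i, cycSucc i} : Set (Fin n)) {j, cycSucc j} ∧
    Disjoint ({i, cycSucc i} : Set (Fin n)) {k, cycSucc k} ∧
    Disjoint ({j, cycSucc j} : Set (Fin n)) {k, cycSucc k} ∧
    S = lineCondition Z i ∩ lineCondition Z j ∩ lineCondition Z k

/-- An adjoint polynomial: a form of degree `n - 4` vanishing on the residual arrangement. -/
def IsAdjointPolynomial {n : ℕ} (Z : Matrix (Fin n) (Fin 4) ℝ) (f : CoordRing) : Prop :=
  f ∈ forms (n - 4) ∧ ∀ Y ∈ residualArrangement Z, VanishesAt f Y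

end TreeAmplituhedron

end

/-! Three facts carry the first claim. (a) The algebraic boundary is the union of the Schubert
divisors `lineCondition Z k` (`algBoundary_eq`). By Cauchy–Binet the brackets ⟨AB k(k+1)⟩ of a point
of the amplituhedron have, up to a twist at the closing edge, one common weak sign. If none of them
vanishes, the sequence ⟨AB 1 j⟩ must change sign, and these open sign conditions already force
membership in the amplituhedron. So a boundary point meets an edge. Conversely each divisor contains
a family of boundary points with positive real parameters, and such a family is Zariski dense in it.
(b) Every stratum either lies in a residual line or conic, or is an irreducible intersection of
vertex, edge and plane conditions containing a line through two vertices
(`IsStratum.residual_or_regular`). A line through two vertices belongs to the amplituhedron, so only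
strata of the first kind can be residual. (c) Residual lines and conics are irreducible, arise as
strata, and avoid the amplituhedron: meeting an edge kills all Plücker coordinates of the preimage
disjoint from that edge, and too few coordinates survive.

Uniqueness of the adjoint is a count of zeros. Fix two skew edges a, b and a general point P of a. A
form of degree n-4 vanishing on the residual set has n-4 zeros on b, seen from P, one for each edge
in `cutEdges a b`; genericity of Z makes them distinct. One further zero forces vanishing at all
lines from P to b, and then at all lines meeting a and b. This spreads to neighbouring pairs through
common vertices, then to the lines meeting one edge (at least n-3 skew edges), then to all lines (n
edges). Hence the value at a single test line determines the form, and the space of adjoints has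
dimension at most one.

Existence is by an explicit sum `adjVal` over pairs of planes of consecutive vertices of the open
polygon. On a residual line or conic nearly every summand contains a vanishing edge bracket or a
vanishing numerator; the few survivors combine, by linearity, to a multiple of a bracket with the
closing edge, which vanishes as well. At the line through the second and fourth vertices exactly one
summand survives, so the sum is nonzero. For n = 4 the residual set is empty and the adjoints are
the constants. -/

noncomputable section

namespace TreeAmplituhedron

/-! ### Brackets and lines in projective three-space -/

section Brackets

variable {K : Type} [Field K]

/-- The determinant of four vectors in `K ^ 4`. -/
def br (A B C D : Fin 4 → K) : K := (Matrix.of ![A, B, C, D]).det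

theorem br_eq (A B C D : Fin 4 → K) : br A B C D =
    (A 0 * B 1 - A 1 * B 0) * (C 2 * D 3 - C 3 * D 2) -
    (A 0 * B 2 - A 2 * B 0) * (C 1 * D 3 - C 3 * D 1) +
    (A 0 * B 3 - A 3 * B 0) * (C 1 * D 2 - C 2 * D 1) +
    (A 1 * B 2 - A 2 * B 1) * (C 0 * D 3 - C 3 * D 0) -
    (A 1 * B 3 - A 3 * B 1) * (C 0 * D 2 - C 2 * D 0) +
    (A 2 * B 3 - A 3 * B 2) * (C 0 * D 1 - C 1 * D 0) := by
  simp [br, Matrix.det_succ_row_zero, Fin.sum_univ_succ, Fin.succAbove]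
  ring

theorem br_toComplex (A B C D : Fin 4 → ℝ) :
    br (toComplex A) (toComplex B) (toComplex C) (toComplex D) = ((br A B C D : ℝ) : ℂ) := by
  simp only [br_eq, toComplex]
  push_cast
  ring

theorem br_add₁ (A A' B C D : Fin 4 → K) : br (A + A') B C D = br A B C D + br A' B C D := by
  simp only [br_eq, Pi.add_apply]; ring
theorem br_add₂ (A B B' C D : Fin 4 → K) : br A (B + B') C D = br A B C D + br A B' C D := by
  simp only [br_eq, Pi.add_apply]; ring
theorem br_add₃ (A B C C' D : Fin 4 → K) : br A B (C + C') D = br A B C D + br A B C' D := by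
  simp only [br_eq, Pi.add_apply]; ring
theorem br_add₄ (A B C D D' : Fin 4 → K) : br A B C (D + D') = br A B C D + br A B C D' := by
  simp only [br_eq, Pi.add_apply]; ring
theorem br_smul₁ (t : K) (A B C D : Fin 4 → K) : br (t • A) B C D = t * br A B C D := by
  simp only [br_eq, Pi.smul_apply, smul_eq_mul]; ring
theorem br_smul₂ (t : K) (A B C D : Fin 4 → K) : br A (t • B) C D = t * br A B C D := by
  simp only [br_eq, Pi.smul_apply, smul_eq_mul]; ring
theorem br_smul₃ (t : K) (A B C D : Fin 4 → K) : br A B (t • C) D = t * br A B C D := by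
  simp only [br_eq, Pi.smul_apply, smul_eq_mul]; ring
theorem br_smul₄ (t : K) (A B C D : Fin 4 → K) : br A B C (t • D) = t * br A B C D := by
  simp only [br_eq, Pi.smul_apply, smul_eq_mul]; ring
theorem br_swap₁₂ (A B C D : Fin 4 → K) : br B A C D = -br A B C D := by
  simp only [br_eq]; ring
theorem br_swap₂₃ (A B C D : Fin 4 → K) : br A C B D = -br A B C D := by
  simp only [br_eq]; ring
theorem br_swap₃₄ (A B C D : Fin 4 → K) : br A B D C = -br A B C D := by
  simp only [br_eq]; ring
theorem br_pairs (A B C D : Fin 4 → K) : br C D A B = br A B C D := by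
  simp only [br_eq]; ring
@[simp] theorem br_same₁₂ (A C D : Fin 4 → K) : br A A C D = 0 := by
  simp only [br_eq]; ring
@[simp] theorem br_same₁₃ (A B D : Fin 4 → K) : br A B A D = 0 := by
  simp only [br_eq]; ring
@[simp] theorem br_same₁₄ (A B C : Fin 4 → K) : br A B C A = 0 := by
  simp only [br_eq]; ring
@[simp] theorem br_same₂₃ (A B D : Fin 4 → K) : br A B B D = 0 := by
  simp only [br_eq]; ring
@[simp] theorem br_same₂₄ (A B C : Fin 4 → K) : br A B C B = 0 := by
  simp only [br_eq]; ring
@[simp] theorem br_same₃₄ (A B C : Fin 4 → K) : br A B C C = 0 := by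
  simp only [br_eq]; ring
@[simp] theorem br_zero₁ (B C D : Fin 4 → K) : br 0 B C D = 0 := by
  simp [br_eq]

theorem br_ne_zero_iff (A B C D : Fin 4 → K) :
    br A B C D ≠ 0 ↔ LinearIndependent K ![A, B, C, D] := by
  have := Matrix.linearIndependent_rows_iff_isUnit (A := Matrix.of ![A, B, C, D])
  rw [Matrix.isUnit_iff_isUnit_det, isUnit_iff_ne_zero] at this
  exact this.symm

theorem br_ne_zero_iff_forall (A B C D : Fin 4 → K) :
    br A B C D ≠ 0 ↔ ∀ a b c d : K, a • A + b • B + c • C + d • D = 0 →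
      a = 0 ∧ b = 0 ∧ c = 0 ∧ d = 0 := by
  rw [br_ne_zero_iff, Fintype.linearIndependent_iff]
  constructor
  · intro h a b c d e
    have := h ![a, b, c, d] (by simpa [Fin.sum_univ_four] using e)
    exact ⟨this 0, this 1, this 2, this 3⟩
  · intro h g hg i
    have := h (g 0) (g 1) (g 2) (g 3) (by simpa [Fin.sum_univ_four] using hg)
    fin_cases i <;> simp [this]

theorem br_eq_zero_iff (A B C D : Fin 4 → K) :
    br A B C D = 0 ↔ ∃ a b c d : K, a • A + b • B + c • C + d • D = 0 ∧
      ¬ (a = 0 ∧ b = 0 ∧ c = 0 ∧ d = 0) := by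
  rw [← not_iff_not, ← ne_eq, br_ne_zero_iff_forall]
  push Not
  rfl

/-- Cramer's rule for five vectors in `K ^ 4`. -/
theorem cramer (A B C D E : Fin 4 → K) :
    br A B C D • E = br E B C D • A + br A E C D • B + br A B E D • C + br A B C E • D := by
  funext i
  fin_cases i <;> simp [br_eq] <;> ring

theorem pair_indep_iff (A B : Fin 4 → K) :
    LinearIndependent K ![A, B] ↔ ∀ a b : K, a • A + b • B = 0 → a = 0 ∧ b = 0 :=
  LinearIndependent.pair_iff

theorem indep_of_br_ne_zero {A B C D : Fin 4 → K} (h : br A B C D ≠ 0) :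
    LinearIndependent K ![A, B] := by
  rw [pair_indep_iff]
  intro a b e
  have := (br_ne_zero_iff_forall A B C D).1 h a b 0 0 (by simpa using e)
  exact ⟨this.1, this.2.1⟩

theorem plucker_eq_zero_iff (A B : Fin 4 → K) :
    plucker A B = 0 ↔ ¬ LinearIndependent K ![A, B] := by
  constructor
  · intro h hl
    rw [pair_indep_iff] at hl
    have hk : ∀ i j, A i * B j = A j * B i := by
      have h' := fun k => congrFun h k
      have h0 := h' 0
      have h1 := h' 1
      have h2 := h' 2
      have h3 := h' 3
      have h4 := h' 4
      have h5 := h' 5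
      simp [plucker, sub_eq_zero] at h0 h1 h2 h3 h4 h5
      intro i j
      fin_cases i <;> fin_cases j <;> simp <;> simp [h0, h1, h2, h3, h4, h5]
    have hA : ∀ i, A i = 0 := fun i => by
      have := hl (B i) (-A i) (by funext j; simp; linear_combination hk j i)
      simpa using this.2
    have := hl 1 0 (by funext j; simp [hA j])
    simp at this
  · intro h
    rw [pair_indep_iff] at h
    push Not at h
    obtain ⟨a, b, e, hab⟩ := h
    have e' := fun k => congrFun e k
    simp at e'
    have key : ∀ i j, A i * B j - A j * B i = 0 := by
      intro i j
      by_cases ha : a = 0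
      · have hb := hab ha
        have : ∀ i, B i = 0 := fun i => by simpa [ha, hb] using e' i
        simp [this]
      · apply mul_left_cancel₀ ha
        linear_combination B j * e' i - B i * e' j
    funext k
    fin_cases k <;> simp [plucker, key]

theorem plucker_comb (A B : Fin 4 → K) (a b c d : K) :
    plucker (a • A + b • B) (c • A + d • B) = (a * d - b * c) • plucker A B := by
  funext k
  fin_cases k <;> simp [plucker] <;> ring

theorem br_comb (A B C D : Fin 4 → K) (a b c d : K) :
    br (a • A + b • B) (c • A + d • B) C D = (a * d - b * c) * br A B C D := by
  simp [br_eq]; ring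

/-- A linear form in the Plücker coordinates. -/
def pairing (p q : Fin 6 → K) : K := ∑ i, p i * q i

/-- The coefficients of the linear form `⟨· · C D⟩` in Plücker coordinates. -/
def dualPlucker (C D : Fin 4 → K) : Fin 6 → K :=
  ![C 2 * D 3 - C 3 * D 2, -(C 1 * D 3 - C 3 * D 1), C 1 * D 2 - C 2 * D 1,
    C 0 * D 3 - C 3 * D 0, -(C 0 * D 2 - C 2 * D 0), C 0 * D 1 - C 1 * D 0]

theorem br_eq_pairing (A B C D : Fin 4 → K) :
    br A B C D = pairing (plucker A B) (dualPlucker C D) := by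
  simp [br_eq, pairing, plucker, dualPlucker, Fin.sum_univ_six]; ring

theorem range_pair {E : Type*} (A B : E) : Set.range ![A, B] = {A, B} := by
  ext x
  simp [eq_comm, or_comm]

/-- The line through two independent vectors. -/
def mkGr (A B : Fin 4 → K) (h : LinearIndependent K ![A, B]) : Gr K 2 4 where
  space := Submodule.span K {A, B}
  finrank_space := by
    rw [← range_pair, finrank_span_eq_card h, Fintype.card_fin]

theorem Gr.exists_basis (V : Gr K 2 4) :
    ∃ A B : Fin 4 → K, LinearIndependent K ![A, B] ∧ V.space = Submodule.span K {A, B} := by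
  let b := Module.finBasisOfFinrankEq K V.space V.finrank_space
  refine ⟨b 0, b 1, ?_, ?_⟩
  · have := b.linearIndependent.map' V.space.subtype (by simp)
    have e : ![(b 0 : Fin 4 → K), b 1] = V.space.subtype ∘ b := by
      funext i; fin_cases i <;> rfl
    rw [e]
    exact this
  · have h := congrArg (Submodule.map V.space.subtype) b.span_eq
    rw [Submodule.map_span, Submodule.map_top, Submodule.range_subtype, ← Set.range_comp] at h
    refine h.symm.trans ?_
    rw [← range_pair]
    congr 2
    funext i; fin_cases i <;> rfl

theorem Gr.indep_of_span (V : Gr K 2 4) {A B : Fin 4 → K}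
    (h : V.space = Submodule.span K {A, B}) : LinearIndependent K ![A, B] := by
  rw [linearIndependent_iff_card_eq_finrank_span, Set.finrank, range_pair, ← h,
    V.finrank_space, Fintype.card_fin]

theorem Gr.eq_of_le (V W : Gr K 2 4) (h : V.space ≤ W.space) : V = W := by
  ext1
  exact Submodule.eq_of_le_of_finrank_eq h (by rw [V.finrank_space, W.finrank_space])

theorem Gr.eq_span_of_mem (V : Gr K 2 4) {A B : Fin 4 → K} (hA : A ∈ V.space) (hB : B ∈ V.space)
    (h : LinearIndependent K ![A, B]) : V.space = Submodule.span K {A, B} := by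
  have := Gr.eq_of_le (mkGr A B h) V (by
    rw [mkGr, Submodule.span_le]
    rintro x (rfl | rfl) <;> assumption)
  rw [← this]; rfl

theorem Gr.exists_span_of_mem (V : Gr K 2 4) {A : Fin 4 → K} (hA : A ∈ V.space) (h0 : A ≠ 0) :
    ∃ B, V.space = Submodule.span K {A, B} := by
  obtain ⟨C, D, hl, hV⟩ := V.exists_basis
  by_contra! hc
  have h1 : ∀ E ∈ V.space, ∃ t : K, E = t • A := by
    intro E hE
    by_contra! h
    apply hc E
    apply V.eq_span_of_mem hA hE
    rw [pair_indep_iff]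
    intro a b e
    have hb : b = 0 := by
      by_contra hb
      apply h (-(a / b))
      have : b • E = (-a) • A := by
        rw [neg_smul]; exact eq_neg_of_add_eq_zero_right e
      rw [← inv_smul_smul₀ hb E, this, smul_smul]
      congr 1; field_simp
    subst hb
    simpa [h0] using e
  obtain ⟨c, hC⟩ := h1 C (by rw [hV]; exact Submodule.subset_span (by simp))
  obtain ⟨d, hD⟩ := h1 D (by rw [hV]; exact Submodule.subset_span (by simp))
  have hl' := (pair_indep_iff C D).1 hl
  have := hl' d (-c) (by rw [hC, hD, smul_smul, smul_smul, ← add_smul]; simp [mul_comm])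
  have hC0 : C = 0 := by rw [hC]; simp [neg_eq_zero.1 this.2]
  have := hl' 1 0 (by simp [hC0])
  simp at this

/-- A linear relation among A, B, C, D, with two terms moved across, exhibits a common vector of the
two planes; it is nonzero because each pair is independent. -/
theorem meets_iff (V : Gr K 2 4) {A B C D : Fin 4 → K} (hV : V.space = Submodule.span K {A, B})
    (hCD : LinearIndependent K ![C, D]) :
    V.space ⊓ Submodule.span K {C, D} ≠ ⊥ ↔ br A B C D = 0 := by
  have hAB := V.indep_of_span hV
  rw [pair_indep_iff] at hAB hCD
  rw [Submodule.ne_bot_iff, br_eq_zero_iff]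
  constructor
  · rintro ⟨P, hP, h0⟩
    rw [Submodule.mem_inf, hV, Submodule.mem_span_pair, Submodule.mem_span_pair] at hP
    obtain ⟨⟨a, b, rfl⟩, c, d, e⟩ := hP
    refine ⟨a, b, -c, -d, ?_, ?_⟩
    · rw [← e]; module
    · rintro ⟨rfl, rfl, -, -⟩
      simp at h0
  · rintro ⟨a, b, c, d, e, h⟩
    have e' : a • A + b • B = (-c) • C + (-d) • D := by
      rw [← sub_eq_zero, ← e]; module
    refine ⟨a • A + b • B, ?_, ?_⟩
    · rw [Submodule.mem_inf, hV]
      exact ⟨Submodule.mem_span_pair.2 ⟨a, b, rfl⟩, Submodule.mem_span_pair.2 ⟨-c, -d, e'.symm⟩⟩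
    · intro h0
      rw [h0] at e'
      have h1 := hAB a b h0
      have h2 := hCD _ _ e'.symm
      exact h ⟨h1.1, h1.2, by simpa using h2.1, by simpa using h2.2⟩

theorem Gr.exists_comb (V : Gr K 2 4) {A B A' B' : Fin 4 → K}
    (h : V.space = Submodule.span K {A, B}) (h' : V.space = Submodule.span K {A', B'}) :
    ∃ a b c d : K, a * d - b * c ≠ 0 ∧ A' = a • A + b • B ∧ B' = c • A + d • B := by
  have hA : A' ∈ Submodule.span K {A, B} := by
    rw [← h, h']; exact Submodule.subset_span (by simp)
  have hB : B' ∈ Submodule.span K {A, B} := by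
    rw [← h, h']; exact Submodule.subset_span (by simp)
  obtain ⟨a, b, rfl⟩ := Submodule.mem_span_pair.1 hA
  obtain ⟨c, d, rfl⟩ := Submodule.mem_span_pair.1 hB
  refine ⟨a, b, c, d, ?_, rfl, rfl⟩
  intro h0
  have := plucker_comb A B a b c d
  rw [h0, zero_smul, plucker_eq_zero_iff] at this
  exact this (V.indep_of_span h')

end Brackets

/-! ### Polynomial functions of one variable -/

/-- `q` is a polynomial function. -/
def PolyFun (q : ℂ → ℂ) : Prop := ∃ p : Polynomial ℂ, ∀ t, q t = p.eval t

/-- All coordinates of `a` are polynomial functions. -/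
def PolyVec {ι : Type} (a : ℂ → ι → ℂ) : Prop := ∀ i, PolyFun fun t => a t i

namespace PolyFun

theorem const (c : ℂ) : PolyFun fun _ => c := ⟨Polynomial.C c, fun t => by simp⟩
theorem id : PolyFun fun t => t := ⟨Polynomial.X, fun t => by simp⟩

variable {q r : ℂ → ℂ}

theorem add (hq : PolyFun q) (hr : PolyFun r) : PolyFun fun t => q t + r t := by
  obtain ⟨p, hp⟩ := hq
  obtain ⟨p', hp'⟩ := hr
  exact ⟨p + p', fun t => by simp [hp, hp']⟩

theorem mul (hq : PolyFun q) (hr : PolyFun r) : PolyFun fun t => q t * r t := by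
  obtain ⟨p, hp⟩ := hq
  obtain ⟨p', hp'⟩ := hr
  exact ⟨p * p', fun t => by simp [hp, hp']⟩

theorem neg (hq : PolyFun q) : PolyFun fun t => -q t := by
  simpa using (const (-1)).mul hq

theorem sub (hq : PolyFun q) (hr : PolyFun r) : PolyFun fun t => q t - r t := by
  simpa [sub_eq_add_neg] using hq.add hr.neg

theorem mvEval {σ : Type} (F : MvPolynomial σ ℂ) {a : ℂ → σ → ℂ} (ha : PolyVec a) :
    PolyFun fun t => MvPolynomial.eval (a t) F := by
  induction F using MvPolynomial.induction_on with
  | C c => simpa using const c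
  | add p q hp hq => simpa using hp.add hq
  | mul_X p i hp => simpa using hp.mul (ha i)

/-- All genericity arguments run through the cofinite filter: a polynomial condition that holds once
fails only finitely often, so finitely many such conditions hold simultaneously at some parameter.
-/
theorem eventually_ne (hq : PolyFun q) {t₀ : ℂ} (h : q t₀ ≠ 0) :
    ∀ᶠ t in Filter.cofinite, q t ≠ 0 := by
  obtain ⟨p, hp⟩ := hq
  have hp0 : p ≠ 0 := by
    rintro rfl
    simp [hp] at h
  rw [Filter.eventually_cofinite]
  refine (Polynomial.finite_setOfPred_isRoot hp0).subset ?_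
  intro t ht
  simpa [hp] using ht

theorem eq_zero_of_eventually (hq : PolyFun q) (h : ∀ᶠ t in Filter.cofinite, q t = 0) (t : ℂ) :
    q t = 0 := by
  by_contra h0
  obtain ⟨s, hs⟩ := (h.and (hq.eventually_ne h0)).exists
  exact hs.2 hs.1

end PolyFun

namespace PolyVec

theorem const {ι : Type} (A : ι → ℂ) : PolyVec fun _ => A := fun i => PolyFun.const (A i)

theorem add {ι : Type} {a b : ℂ → ι → ℂ} (ha : PolyVec a) (hb : PolyVec b) :
    PolyVec fun t => a t + b t := fun i => (ha i).add (hb i)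

theorem sub {ι : Type} {a b : ℂ → ι → ℂ} (ha : PolyVec a) (hb : PolyVec b) :
    PolyVec fun t => a t - b t := fun i => (ha i).sub (hb i)

theorem smul {ι : Type} {q : ℂ → ℂ} {a : ℂ → ι → ℂ} (hq : PolyFun q) (ha : PolyVec a) :
    PolyVec fun t => q t • a t := fun i => hq.mul (ha i)

theorem plucker {a b : ℂ → Fin 4 → ℂ} (ha : PolyVec a) (hb : PolyVec b) :
    PolyVec fun t => plucker (a t) (b t) := by
  intro i
  have h : ∀ k l, PolyFun fun t => a t k * b t l - a t l * b t k := fun k l =>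
    ((ha k).mul (hb l)).sub ((ha l).mul (hb k))
  fin_cases i
  · exact h 0 1
  · exact h 0 2
  · exact h 0 3
  · exact h 1 2
  · exact h 1 3
  · exact h 2 3

theorem br {a b c d : ℂ → Fin 4 → ℂ} (ha : PolyVec a) (hb : PolyVec b) (hc : PolyVec c)
    (hd : PolyVec d) : PolyFun fun t => br (a t) (b t) (c t) (d t) := by
  simp only [br_eq]
  have h : ∀ k l, PolyFun fun t => a t k * b t l - a t l * b t k := fun k l =>
    ((ha k).mul (hb l)).sub ((ha l).mul (hb k))
  have h' : ∀ k l, PolyFun fun t => c t k * d t l - c t l * d t k := fun k l =>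
    ((hc k).mul (hd l)).sub ((hc l).mul (hd k))
  exact ((((((h 0 1).mul (h' 2 3)).sub ((h 0 2).mul (h' 1 3))).add ((h 0 3).mul (h' 1 2))).add
    ((h 1 2).mul (h' 0 3))).sub ((h 1 3).mul (h' 0 2))).add ((h 2 3).mul (h' 0 1))

/-- The affine line from `A` to `B`. -/
theorem segment {ι : Type} (A B : ι → ℂ) : PolyVec fun t => (1 - t) • A + t • B :=
  (smul ((PolyFun.const 1).sub PolyFun.id) (const A)).add (smul PolyFun.id (const B))

end PolyVec

/-! ### The Zariski topology -/

theorem evalAt_mk (A B : Fin 4 → ℂ) (F : MvPolynomial (Fin 6) ℂ) :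
    evalAt A B (Ideal.Quotient.mk pluckerIdeal F) = MvPolynomial.eval (plucker A B) F := by
  change MvPolynomial.aeval (plucker A B) F = _
  rw [MvPolynomial.aeval_eq_eval]

theorem mem_forms {d : ℕ} {f : CoordRing} : f ∈ forms d ↔
    ∃ F : MvPolynomial (Fin 6) ℂ, F.IsHomogeneous d ∧ Ideal.Quotient.mk pluckerIdeal F = f := by
  simp [forms, Submodule.mem_map]

theorem one_mem_forms : (1 : CoordRing) ∈ forms 0 :=
  mem_forms.2 ⟨1, MvPolynomial.isHomogeneous_one _ _, map_one _⟩

theorem mul_mem_forms {d e : ℕ} {f g : CoordRing} (hf : f ∈ forms d) (hg : g ∈ forms e) :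
    f * g ∈ forms (d + e) := by
  rw [mem_forms] at *
  obtain ⟨F, hF, rfl⟩ := hf
  obtain ⟨G, hG, rfl⟩ := hg
  exact ⟨F * G, hF.mul hG, map_mul _ _ _⟩

theorem eval_smul_of_isHomogeneous {d : ℕ} {F : MvPolynomial (Fin 6) ℂ} (hF : F.IsHomogeneous d)
    (c : ℂ) (p : Fin 6 → ℂ) :
    MvPolynomial.eval (c • p) F = c ^ d * MvPolynomial.eval p F := by
  rw [MvPolynomial.eval_eq', MvPolynomial.eval_eq', Finset.mul_sum]
  refine Finset.sum_congr rfl fun m hm => ?_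
  have hdeg : ∑ i, m i = d := by
    have := hF (MvPolynomial.mem_support_iff.1 hm)
    have h := congrFun (congrArg DFunLike.coe (Finsupp.degree_eq_weight_one (R := ℕ) (σ := Fin 6))) m
    rw [← this, ← Finsupp.degree_eq_sum]
    exact h
  simp only [Pi.smul_apply, smul_eq_mul, mul_pow, Finset.prod_mul_distrib]
  rw [Finset.prod_pow_eq_pow_sum, hdeg]
  ring

theorem evalAt_comb {d : ℕ} {f : CoordRing} (hf : f ∈ forms d) (A B : Fin 4 → ℂ) (a b c e : ℂ) :
    evalAt (a • A + b • B) (c • A + e • B) f = (a * e - b * c) ^ d * evalAt A B f := by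
  obtain ⟨F, hF, rfl⟩ := mem_forms.1 hf
  rw [evalAt_mk, evalAt_mk, plucker_comb, eval_smul_of_isHomogeneous hF]

/-- A change of basis multiplies the Plücker vector by a determinant and the value of the form by
its d-th power, so one basis suffices. -/
theorem vanishesAt_iff {d : ℕ} {f : CoordRing} (hf : f ∈ forms d) (V : Gr ℂ 2 4)
    {A B : Fin 4 → ℂ} (hV : V.space = Submodule.span ℂ {A, B}) :
    VanishesAt f V ↔ evalAt A B f = 0 := by
  constructor
  · intro h
    exact h A B hV.symm
  · intro h A' B' h'
    obtain ⟨a, b, c, e, -, rfl, rfl⟩ := V.exists_comb hV h'.symm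
    rw [evalAt_comb hf, h, mul_zero]

theorem polyFun_evalAt (f : CoordRing) {a b : ℂ → Fin 4 → ℂ} (ha : PolyVec a) (hb : PolyVec b) :
    PolyFun fun t => evalAt (a t) (b t) f := by
  obtain ⟨F, rfl⟩ := Ideal.Quotient.mk_surjective f
  simp only [evalAt_mk]
  exact PolyFun.mvEval F (ha.plucker hb)

theorem isClosed_vanishing {d : ℕ} {f : CoordRing} (hf : f ∈ forms d) :
    IsClosed {V : Gr ℂ 2 4 | VanishesAt f V} := by
  rw [← isOpen_compl_iff]
  exact TopologicalSpace.isOpen_generateFrom_of_mem ⟨d, f, hf, rfl⟩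

/-- The nonvanishing loci of forms are only a subbasis by definition. They form a basis, since
products of forms turn intersections into nonvanishing loci. -/
theorem exists_form_of_isOpen {U : Set (Gr ℂ 2 4)} (hU : IsOpen U) : ∀ V ∈ U,
    ∃ d : ℕ, ∃ f ∈ forms d, ¬ VanishesAt f V ∧ ∀ W, ¬ VanishesAt f W → W ∈ U := by
  induction hU with
  | basic U h =>
    obtain ⟨d, f, hf, rfl⟩ := h
    exact fun V hV => ⟨d, f, hf, hV, fun W hW => hW⟩
  | univ =>
    intro V _
    refine ⟨0, 1, one_mem_forms, ?_, fun W _ => trivial⟩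
    obtain ⟨A, B, -, hV⟩ := V.exists_basis
    simp [vanishesAt_iff one_mem_forms V hV]
  | inter U₁ U₂ _ _ h₁ h₂ =>
    rintro V ⟨hV₁, hV₂⟩
    obtain ⟨d, f, hf, hfV, hfW⟩ := h₁ V hV₁
    obtain ⟨e, g, hg, hgV, hgW⟩ := h₂ V hV₂
    have key : ∀ W, ¬ VanishesAt (f * g) W ↔ ¬ VanishesAt f W ∧ ¬ VanishesAt g W := by
      intro W
      obtain ⟨A, B, -, hW⟩ := W.exists_basis
      rw [vanishesAt_iff (mul_mem_forms hf hg) W hW, vanishesAt_iff hf W hW,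
        vanishesAt_iff hg W hW, map_mul, mul_eq_zero, not_or]
    refine ⟨d + e, f * g, mul_mem_forms hf hg, (key V).2 ⟨hfV, hgV⟩, fun W hW => ?_⟩
    exact ⟨hfW W ((key W).1 hW).1, hgW W ((key W).1 hW).2⟩
  | sUnion S _ h =>
    rintro V ⟨U, hU, hV⟩
    obtain ⟨d, f, hf, h1, h2⟩ := h U hU V hV
    exact ⟨d, f, hf, h1, fun W hW => ⟨U, hU, h2 W hW⟩⟩

theorem PolyVec.eventually_indep {a b : ℂ → Fin 4 → ℂ} (ha : PolyVec a) (hb : PolyVec b) {t₀ : ℂ}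
    (h : LinearIndependent ℂ ![a t₀, b t₀]) :
    ∀ᶠ t in Filter.cofinite, LinearIndependent ℂ ![a t, b t] := by
  have h0 : TreeAmplituhedron.plucker (a t₀) (b t₀) ≠ 0 := by
    rw [Ne, plucker_eq_zero_iff, not_not]; exact h
  obtain ⟨k, hk⟩ := Function.ne_iff.1 h0
  filter_upwards [((ha.plucker hb) k).eventually_ne hk] with t ht
  by_contra h1
  rw [← plucker_eq_zero_iff] at h1
  exact ht (congrFun h1 k)

/-- A set of lines is irreducible if any two of its points are joined by a polynomial path. -/
theorem isIrreducible_of_paths {S : Set (Gr ℂ 2 4)} (hS : S.Nonempty)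
    (h : ∀ V₁ ∈ S, ∀ V₂ ∈ S, ∃ a b : ℂ → Fin 4 → ℂ, PolyVec a ∧ PolyVec b ∧
      V₁.space = Submodule.span ℂ {a 0, b 0} ∧ V₂.space = Submodule.span ℂ {a 1, b 1} ∧
      ∀ t (ht : LinearIndependent ℂ ![a t, b t]), mkGr (a t) (b t) ht ∈ S) :
    IsIrreducible S := by
  refine ⟨hS, ?_⟩
  rintro U₁ U₂ hU₁ hU₂ ⟨V₁, hV₁, hVU₁⟩ ⟨V₂, hV₂, hVU₂⟩
  obtain ⟨d, f, hf, hfV, hfW⟩ := exists_form_of_isOpen hU₁ V₁ hVU₁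
  obtain ⟨e, g, hg, hgV, hgW⟩ := exists_form_of_isOpen hU₂ V₂ hVU₂
  obtain ⟨a, b, ha, hb, h1, h2, h3⟩ := h V₁ hV₁ V₂ hV₂
  rw [vanishesAt_iff hf V₁ h1] at hfV
  rw [vanishesAt_iff hg V₂ h2] at hgV
  -- Along the path, independence and the nonvanishing of `f` and `g` each hold at some parameter,
  -- so all three hold at a common one.
  have e1 := ha.eventually_indep hb (V₁.indep_of_span h1)
  have e2 := (polyFun_evalAt f ha hb).eventually_ne hfV
  have e3 := (polyFun_evalAt g ha hb).eventually_ne hgV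
  obtain ⟨t, ht1, ht2, ht3⟩ := (e1.and (e2.and e3)).exists
  refine ⟨mkGr (a t) (b t) ht1, h3 t ht1, hfW _ ?_, hgW _ ?_⟩
  · rwa [vanishesAt_iff hf _ rfl]
  · rwa [vanishesAt_iff hg _ rfl]

/-- The lines spanned by a vector of `W₁` and a vector of `W₂`. -/
def joinSet (W₁ W₂ : Submodule ℂ (Fin 4 → ℂ)) : Set (Gr ℂ 2 4) :=
  {V | ∃ A ∈ W₁, ∃ B ∈ W₂, V.space = Submodule.span ℂ {A, B}}

/-- Both spanning vectors can be moved along straight segments inside their subspaces. -/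
theorem isIrreducible_joinSet {W₁ W₂ : Submodule ℂ (Fin 4 → ℂ)} (h : (joinSet W₁ W₂).Nonempty) :
    IsIrreducible (joinSet W₁ W₂) := by
  refine isIrreducible_of_paths h ?_
  rintro V₁ ⟨A₁, hA₁, B₁, hB₁, h₁⟩ V₂ ⟨A₂, hA₂, B₂, hB₂, h₂⟩
  refine ⟨_, _, PolyVec.segment A₁ A₂, PolyVec.segment B₁ B₂, by simpa using h₁,
    by simpa using h₂, fun t ht => ⟨_, ?_, _, ?_, rfl⟩⟩
  · exact W₁.add_mem (W₁.smul_mem _ hA₁) (W₁.smul_mem _ hA₂)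
  · exact W₂.add_mem (W₂.smul_mem _ hB₁) (W₂.smul_mem _ hB₂)

/-- The linear form with given coefficients. -/
def linForm (q : Fin 6 → ℂ) : MvPolynomial (Fin 6) ℂ := ∑ i, MvPolynomial.C (q i) * MvPolynomial.X i

theorem linForm_isHomogeneous (q : Fin 6 → ℂ) : (linForm q).IsHomogeneous 1 :=
  MvPolynomial.IsHomogeneous.sum _ _ _ fun _ _ => MvPolynomial.isHomogeneous_C_mul_X _ _

theorem eval_linForm (p q : Fin 6 → ℂ) : MvPolynomial.eval p (linForm q) = pairing p q := by
  simp [linForm, pairing, mul_comm]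

theorem mk_linForm_mem (q : Fin 6 → ℂ) : Ideal.Quotient.mk pluckerIdeal (linForm q) ∈ forms 1 :=
  mem_forms.2 ⟨_, linForm_isHomogeneous q, rfl⟩

/-- A linear section of the Grassmannian is closed. -/
theorem isClosed_of_pairing (Q : Set (Fin 6 → ℂ)) {S : Set (Gr ℂ 2 4)}
    (h : ∀ (V : Gr ℂ 2 4) (A B : Fin 4 → ℂ), V.space = Submodule.span ℂ {A, B} →
      (V ∈ S ↔ ∀ q ∈ Q, pairing (plucker A B) q = 0)) : IsClosed S := by
  have : S = ⋂ q ∈ Q, {V | VanishesAt (Ideal.Quotient.mk pluckerIdeal (linForm q)) V} := by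
    ext V
    obtain ⟨A, B, -, hV⟩ := V.exists_basis
    simp only [Set.mem_iInter, Set.mem_ofPred_eq, h V A B hV, vanishesAt_iff (mk_linForm_mem _) V hV,
      evalAt_mk, eval_linForm]
  rw [this]
  exact isClosed_biInter fun q _ => isClosed_vanishing (mk_linForm_mem q)

/-! ### Cyclic indices -/

section Cyclic

variable {n : ℕ}

theorem cycSucc_val (i : Fin n) : (cycSucc i : ℕ) = if (i : ℕ) + 1 = n then 0 else (i : ℕ) + 1 := by
  obtain _ | n := n
  · exact i.elim0
  · rw [cycSucc]
    split_ifs with h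
    · have : i = Fin.last n := by ext; simp; omega
      rw [this, finRotate_last]; simp
    · exact coe_finRotate_of_ne_last (by intro h'; apply h; simp [h'])

@[simp] theorem cycSucc_cycPred (i : Fin n) : cycSucc (cycPred i) = i :=
  Equiv.apply_symm_apply _ _

@[simp] theorem cycPred_cycSucc (i : Fin n) : cycPred (cycSucc i) = i :=
  Equiv.symm_apply_apply _ _

theorem cycSucc_inj {i j : Fin n} : cycSucc i = cycSucc j ↔ i = j := (finRotate n).injective.eq_iff

theorem eq_cycPred_iff {i j : Fin n} : i = cycPred j ↔ cycSucc i = j :=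
  (Equiv.eq_symm_apply _)

theorem cycSucc_ne (hn : 4 ≤ n) (i : Fin n) : cycSucc i ≠ i := by
  intro h
  have := congrArg Fin.val h
  rw [cycSucc_val] at this
  split_ifs at this <;> omega

theorem cycSucc₂_ne (hn : 4 ≤ n) (i : Fin n) : cycSucc (cycSucc i) ≠ i := by
  intro h
  have := congrArg Fin.val h
  rw [cycSucc_val, cycSucc_val] at this
  split_ifs at this <;> omega

theorem cycSucc₃_ne (hn : 4 ≤ n) (i : Fin n) : cycSucc (cycSucc (cycSucc i)) ≠ i := by
  intro h
  have := congrArg Fin.val h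
  rw [cycSucc_val, cycSucc_val, cycSucc_val] at this
  split_ifs at this <;> omega

theorem disjoint_pair_pair {a b c d : Fin n} : Disjoint ({a, b} : Set (Fin n)) {c, d} ↔
    a ≠ c ∧ a ≠ d ∧ b ≠ c ∧ b ≠ d := by
  simp [Set.disjoint_left, and_assoc]

theorem disjoint_triple_pair {a b c d e : Fin n} : Disjoint ({a, b, c} : Set (Fin n)) {d, e} ↔
    a ≠ d ∧ a ≠ e ∧ b ≠ d ∧ b ≠ e ∧ c ≠ d ∧ c ≠ e := by
  simp [Set.disjoint_left, and_assoc]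

theorem exists_two_others (hn : 4 ≤ n) (i j : Fin n) :
    ∃ k l : Fin n, k ≠ l ∧ i ≠ k ∧ i ≠ l ∧ j ≠ k ∧ j ≠ l := by
  have h : 1 < ({i, j}ᶜ : Finset (Fin n)).card := by
    rw [Finset.card_compl, Fintype.card_fin]
    have := Finset.card_le_two (a := i) (b := j)
    omega
  obtain ⟨k, hk, l, hl, hkl⟩ := Finset.one_lt_card.1 h
  simp at hk hl
  exact ⟨k, l, hkl, Ne.symm hk.1, Ne.symm hl.1, Ne.symm hk.2, Ne.symm hl.2⟩

theorem exists_other (hn : 4 ≤ n) (i j k : Fin n) : ∃ l : Fin n, i ≠ l ∧ j ≠ l ∧ k ≠ l := by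
  have h : 0 < ({i, j, k}ᶜ : Finset (Fin n)).card := by
    rw [Finset.card_compl, Fintype.card_fin]
    have := Finset.card_le_three (a := i) (b := j) (c := k)
    omega
  obtain ⟨l, hl⟩ := Finset.card_pos.1 h
  simp at hl
  exact ⟨l, Ne.symm hl.1, Ne.symm hl.2.1, Ne.symm hl.2.2⟩

end Cyclic

/-! ### Incidences between lines and vertices, edges and planes -/

section Incidence

variable {K : Type} [Field K]

/-- Two faces of a tetrahedron meet in the edge x y: comparing the two expressions for A gives a
relation among four independent vectors. -/
theorem span_mem_of_planes {x y p q A : Fin 4 → K} (h : br p x y q ≠ 0)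
    (h₁ : A ∈ Submodule.span K {p, x, y}) (h₂ : A ∈ Submodule.span K {x, y, q}) :
    A ∈ Submodule.span K {x, y} := by
  rw [Submodule.mem_span_triple] at h₁ h₂
  obtain ⟨a, b, c, rfl⟩ := h₁
  obtain ⟨d, e, f, h₂⟩ := h₂
  have := (br_ne_zero_iff_forall _ _ _ _).1 h a (b - d) (c - e) (-f) (by
    rw [← sub_eq_zero] at h₂
    rw [← neg_eq_zero, ← h₂]; module)
  rw [this.1]
  exact Submodule.mem_span_pair.2 ⟨b, c, by module⟩

theorem eq_smul_of_plane_of_line {x y w u P : Fin 4 → K} (h : br x y w u ≠ 0)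
    (h₁ : P ∈ Submodule.span K {x, y, w}) (h₂ : P ∈ Submodule.span K {x, u}) :
    ∃ s : K, P = s • x := by
  rw [Submodule.mem_span_triple] at h₁
  rw [Submodule.mem_span_pair] at h₂
  obtain ⟨a, b, c, rfl⟩ := h₁
  obtain ⟨d, e, h₂⟩ := h₂
  have := (br_ne_zero_iff_forall _ _ _ _).1 h (a - d) b c (-e) (by
    rw [← sub_eq_zero] at h₂
    rw [← neg_eq_zero, ← h₂]; module)
  exact ⟨a, by rw [this.2.1, this.2.2.1]; module⟩

theorem indep_of_lines {a b c d P Q : Fin 4 → K} (h : br a b c d ≠ 0)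
    (hP : P ∈ Submodule.span K {a, b}) (hQ : Q ∈ Submodule.span K {c, d}) (hP0 : P ≠ 0)
    (hQ0 : Q ≠ 0) : LinearIndependent K ![P, Q] := by
  rw [Submodule.mem_span_pair] at hP hQ
  obtain ⟨s, t, rfl⟩ := hP
  obtain ⟨u, v, rfl⟩ := hQ
  rw [pair_indep_iff]
  intro x y e
  obtain ⟨h1, h2, h3, h4⟩ := (br_ne_zero_iff_forall _ _ _ _).1 h (x * s) (x * t) (y * u) (y * v) (by
    rw [← e]; module)
  constructor
  · by_contra hx
    apply hP0
    rw [(mul_eq_zero.1 h1).resolve_left hx, (mul_eq_zero.1 h2).resolve_left hx]; simp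
  · by_contra hx
    apply hQ0
    rw [(mul_eq_zero.1 h3).resolve_left hx, (mul_eq_zero.1 h4).resolve_left hx]; simp

variable {n : ℕ} {Z : Matrix (Fin n) (Fin 4) ℝ}

/-- The vertices of the configuration as complex vectors. -/
def zc (Z : Matrix (Fin n) (Fin 4) ℝ) (i : Fin n) : Fin 4 → ℂ := toComplex (Z i)

/-- All maximal minors are nonzero. -/
def Uniform (Z : Matrix (Fin n) (Fin 4) ℝ) : Prop :=
  ∀ i j k l : Fin n, i ≠ j → i ≠ k → i ≠ l → j ≠ k → j ≠ l → k ≠ l →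
    br (Z i) (Z j) (Z k) (Z l) ≠ 0

theorem Uniform.br_ne (hu : Uniform Z) {i j k l : Fin n} (h₁ : i ≠ j) (h₂ : i ≠ k) (h₃ : i ≠ l)
    (h₄ : j ≠ k) (h₅ : j ≠ l) (h₆ : k ≠ l) : br (zc Z i) (zc Z j) (zc Z k) (zc Z l) ≠ 0 := by
  rw [zc, zc, zc, zc, br_toComplex]
  exact_mod_cast hu i j k l h₁ h₂ h₃ h₄ h₅ h₆

theorem Uniform.indep (hu : Uniform Z) (hn : 4 ≤ n) {i j : Fin n} (h : i ≠ j) :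
    LinearIndependent ℂ ![zc Z i, zc Z j] := by
  obtain ⟨k, l, h1, h2, h3, h4, h5⟩ := exists_two_others hn i j
  exact indep_of_br_ne_zero (hu.br_ne h h2 h3 h4 h5 h1)

theorem Uniform.zc_ne_zero (hu : Uniform Z) (hn : 4 ≤ n) (i : Fin n) : zc Z i ≠ 0 :=
  (hu.indep hn (cycSucc_ne hn i).symm).ne_zero 0

/-- The lines through the vertex `i`. -/
def vertexCondition (Z : Matrix (Fin n) (Fin 4) ℝ) (i : Fin n) : Set (Gr ℂ 2 4) :=
  {V | zc Z i ∈ V.space}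

theorem mem_lineCondition {V : Gr ℂ 2 4} {k : Fin n} : V ∈ lineCondition Z k ↔
    ∃ P ∈ V.space, P ∈ Submodule.span ℂ {zc Z k, zc Z (cycSucc k)} ∧ P ≠ 0 := by
  change V.space ⊓ _ ≠ ⊥ ↔ _
  rw [Submodule.ne_bot_iff]
  simp only [Submodule.mem_inf, and_assoc]
  rfl

theorem mem_lineCondition_iff_br (hu : Uniform Z) (hn : 4 ≤ n) {V : Gr ℂ 2 4} {A B : Fin 4 → ℂ}
    (hV : V.space = Submodule.span ℂ {A, B}) (k : Fin n) :
    V ∈ lineCondition Z k ↔ br A B (zc Z k) (zc Z (cycSucc k)) = 0 :=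
  meets_iff V hV (hu.indep hn (cycSucc_ne hn k).symm)

theorem mem_planeCondition {V : Gr ℂ 2 4} {k : Fin n} : V ∈ planeCondition Z k ↔
    V.space ≤ Submodule.span ℂ {zc Z (cycPred k), zc Z k, zc Z (cycSucc k)} := Iff.rfl

theorem mem_planeCondition_succ {V : Gr ℂ 2 4} {k : Fin n} : V ∈ planeCondition Z (cycSucc k) ↔
    V.space ≤ Submodule.span ℂ {zc Z k, zc Z (cycSucc k), zc Z (cycSucc (cycSucc k))} := by
  rw [mem_planeCondition, cycPred_cycSucc]

theorem vertex_subset_line (hu : Uniform Z) (hn : 4 ≤ n) (i : Fin n) :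
    vertexCondition Z i ⊆ lineCondition Z i := fun V hV =>
  mem_lineCondition.2 ⟨_, hV, Submodule.subset_span (by simp), hu.zc_ne_zero hn i⟩

theorem vertex_succ_subset_line (hu : Uniform Z) (hn : 4 ≤ n) (i : Fin n) :
    vertexCondition Z (cycSucc i) ⊆ lineCondition Z i := fun V hV =>
  mem_lineCondition.2 ⟨_, hV, Submodule.subset_span (by simp), hu.zc_ne_zero hn _⟩

theorem mem_line_of_le_plane {x y w : Fin 4 → ℂ} {V : Gr ℂ 2 4} (hxy : LinearIndependent ℂ ![x, y])
    (hV : V.space ≤ Submodule.span ℂ {w, x, y}) : V.space ⊓ Submodule.span ℂ {x, y} ≠ ⊥ := by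
  obtain ⟨A, B, -, hAB⟩ := V.exists_basis
  rw [meets_iff V hAB hxy]
  have hA := hV (by rw [hAB]; exact Submodule.subset_span (by simp) : A ∈ V.space)
  have hB := hV (by rw [hAB]; exact Submodule.subset_span (by simp) : B ∈ V.space)
  rw [Submodule.mem_span_triple] at hA hB
  obtain ⟨a, b, c, rfl⟩ := hA
  obtain ⟨d, e, f, rfl⟩ := hB
  simp [br_add₁, br_add₂, br_smul₁, br_smul₂]

theorem plane_succ_subset_line (hu : Uniform Z) (hn : 4 ≤ n) (i : Fin n) :
    planeCondition Z (cycSucc i) ⊆ lineCondition Z i := by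
  intro V hV
  rw [mem_planeCondition_succ] at hV
  refine mem_line_of_le_plane (hu.indep hn (cycSucc_ne hn i).symm)
    (w := zc Z (cycSucc (cycSucc i))) (hV.trans (le_of_eq ?_))
  congr 1; ext; simp; tauto

theorem plane_subset_line (hu : Uniform Z) (hn : 4 ≤ n) (i : Fin n) :
    planeCondition Z i ⊆ lineCondition Z i := fun _ hV =>
  mem_line_of_le_plane (hu.indep hn (cycSucc_ne hn i).symm) hV

/-- A line through a vertex and meeting an edge lies in the plane they span. -/
theorem exists_of_vertex_of_line (hu : Uniform Z) (hn : 4 ≤ n) {V : Gr ℂ 2 4} {i k : Fin n}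
    (hi : V ∈ vertexCondition Z i) (hk : V ∈ lineCondition Z k) (h₁ : i ≠ k)
    (h₂ : i ≠ cycSucc k) : ∃ P ∈ Submodule.span ℂ {zc Z k, zc Z (cycSucc k)}, P ≠ 0 ∧
      V.space = Submodule.span ℂ {zc Z i, P} := by
  obtain ⟨P, hP, hP', h0⟩ := mem_lineCondition.1 hk
  refine ⟨P, hP', h0, V.eq_span_of_mem hi hP ?_⟩
  obtain ⟨l, hl⟩ := exists_other hn i k (cycSucc k)
  exact indep_of_lines (hu.br_ne (i := i) (j := l) (k := k) (l := cycSucc k) hl.1 h₁ h₂ hl.2.1.symm hl.2.2.symm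
    (cycSucc_ne hn k).symm) (Submodule.subset_span (by simp)) hP' (hu.zc_ne_zero hn i) h0

theorem le_of_vertex_of_line (hu : Uniform Z) (hn : 4 ≤ n) {V : Gr ℂ 2 4} {i k : Fin n}
    (hi : V ∈ vertexCondition Z i) (hk : V ∈ lineCondition Z k) (h₁ : i ≠ k)
    (h₂ : i ≠ cycSucc k) :
    V.space ≤ Submodule.span ℂ {zc Z i, zc Z k, zc Z (cycSucc k)} := by
  obtain ⟨P, hP, -, h⟩ := exists_of_vertex_of_line hu hn hi hk h₁ h₂
  rw [h, Submodule.span_le]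
  rintro x (rfl | rfl)
  · exact Submodule.subset_span (by simp)
  · exact Submodule.span_mono (by simp) hP

theorem plane_succ_of_vertex_of_line (hu : Uniform Z) (hn : 4 ≤ n) {V : Gr ℂ 2 4} {i : Fin n}
    (hi : V ∈ vertexCondition Z i) (hk : V ∈ lineCondition Z (cycSucc i)) :
    V ∈ planeCondition Z (cycSucc i) := by
  rw [mem_planeCondition_succ]
  exact le_of_vertex_of_line hu hn hi hk (cycSucc_ne hn i).symm (cycSucc₂_ne hn i).symm

/-- This splits the intersection of two adjacent edge conditions. The meeting points P and Q with
the two edges either are independent and span the line, which then lies in the plane of the edges,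
or coincide in the common vertex. -/
theorem vertex_or_plane (hu : Uniform Z) (hn : 4 ≤ n) {V : Gr ℂ 2 4} {k : Fin n}
    (h₁ : V ∈ lineCondition Z k) (h₂ : V ∈ lineCondition Z (cycSucc k)) :
    V ∈ vertexCondition Z (cycSucc k) ∨ V ∈ planeCondition Z (cycSucc k) := by
  obtain ⟨P, hP, hP', hP0⟩ := mem_lineCondition.1 h₁
  obtain ⟨Q, hQ, hQ', hQ0⟩ := mem_lineCondition.1 h₂
  by_cases hl : LinearIndependent ℂ ![P, Q]
  · right
    rw [mem_planeCondition_succ, V.eq_span_of_mem hP hQ hl, Submodule.span_le]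
    rintro x (rfl | rfl)
    · exact Submodule.span_mono (by simp [Set.insert_subset_iff]) hP'
    · exact Submodule.span_mono (by simp) hQ'
  · left
    obtain ⟨l, hl1, hl2, hl3⟩ := exists_other hn k (cycSucc k) (cycSucc (cycSucc k))
    have hPQ : P ∈ Submodule.span ℂ {zc Z (cycSucc k), zc Z (cycSucc (cycSucc k))} := by
      rw [pair_indep_iff] at hl
      push Not at hl
      obtain ⟨a, b, e, hab⟩ := hl
      have ha : a ≠ 0 := by
        rintro rfl
        simp [hab rfl, hQ0] at e
      have : P = (-(b / a)) • Q := by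
        have : a • P = (-b) • Q := by rw [neg_smul]; exact eq_neg_of_add_eq_zero_left e
        rw [← inv_smul_smul₀ ha P, this, smul_smul]
        congr 1; field_simp
      rw [this]
      exact Submodule.smul_mem _ _ hQ'
    have hne := hu.br_ne (i := cycSucc k) (j := k) (k := l) (l := cycSucc (cycSucc k)) (cycSucc_ne hn k)
      hl2 (cycSucc_ne hn _).symm hl1 (cycSucc₂_ne hn k).symm hl3.symm
    obtain ⟨s, rfl⟩ := eq_smul_of_plane_of_line hne (P := P) (Submodule.span_mono (by
      simp [Set.insert_subset_iff]) hP') hPQ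
    have hs : s ≠ 0 := by rintro rfl; simp at hP0
    exact (Submodule.smul_mem_iff _ hs).1 hP

/-- The next edge leaves the plane at its first endpoint and meets it nowhere else. -/
theorem vertex_of_plane_of_line_succ (hu : Uniform Z) (hn : 4 ≤ n) {V : Gr ℂ 2 4} {k : Fin n}
    (h₁ : V ∈ planeCondition Z (cycSucc k)) (h₂ : V ∈ lineCondition Z (cycSucc (cycSucc k))) :
    V ∈ vertexCondition Z (cycSucc (cycSucc k)) := by
  rw [mem_planeCondition_succ] at h₁
  obtain ⟨Q, hQ, hQ', hQ0⟩ := mem_lineCondition.1 h₂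
  have hne := hu.br_ne (i := cycSucc (cycSucc k)) (j := k) (k := cycSucc k)
    (l := cycSucc (cycSucc (cycSucc k))) (cycSucc₂_ne hn k) (cycSucc_ne hn _)
    (cycSucc_ne hn _).symm (cycSucc_ne hn k).symm (cycSucc₃_ne hn k).symm (cycSucc₂_ne hn _).symm
  obtain ⟨s, rfl⟩ := eq_smul_of_plane_of_line hne (P := Q) (by
    refine Submodule.span_mono ?_ (h₁ hQ)
    simp [Set.insert_subset_iff]) hQ'
  have hs : s ≠ 0 := by rintro rfl; simp at hQ0
  exact (Submodule.smul_mem_iff _ hs).1 hQ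

theorem vertex_of_plane_of_line_pred (hu : Uniform Z) (hn : 4 ≤ n) {V : Gr ℂ 2 4} {k : Fin n}
    (h₁ : V ∈ planeCondition Z (cycSucc (cycSucc k))) (h₂ : V ∈ lineCondition Z k) :
    V ∈ vertexCondition Z (cycSucc k) := by
  rw [mem_planeCondition_succ] at h₁
  obtain ⟨Q, hQ, hQ', hQ0⟩ := mem_lineCondition.1 h₂
  have hne := hu.br_ne (i := cycSucc k) (j := cycSucc (cycSucc k))
    (k := cycSucc (cycSucc (cycSucc k))) (l := k) (cycSucc_ne hn _).symm (cycSucc₂_ne hn _).symm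
    (cycSucc_ne hn _) (cycSucc_ne hn _).symm (cycSucc₂_ne hn k) (cycSucc₃_ne hn _)
  obtain ⟨s, rfl⟩ := eq_smul_of_plane_of_line hne (P := Q) (h₁ hQ) (by
    rwa [Set.pair_comm])
  have hs : s ≠ 0 := by rintro rfl; simp at hQ0
  exact (Submodule.smul_mem_iff _ hs).1 hQ

theorem eq_span_of_planes {x y p q : Fin 4 → ℂ} (h : br p x y q ≠ 0) {V : Gr ℂ 2 4}
    (h₁ : V.space ≤ Submodule.span ℂ {p, x, y}) (h₂ : V.space ≤ Submodule.span ℂ {x, y, q}) :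
    x ∈ V.space ∧ y ∈ V.space := by
  have hle : V.space ≤ Submodule.span ℂ {x, y} := fun A hA => span_mem_of_planes h (h₁ hA) (h₂ hA)
  have hxy : LinearIndependent ℂ ![x, y] := by
    apply indep_of_br_ne_zero (C := p) (D := q)
    rw [br_swap₂₃, br_swap₁₂]
    simpa using h
  have := Gr.eq_of_le V (mkGr x y hxy) hle
  rw [this]
  exact ⟨Submodule.subset_span (by simp), Submodule.subset_span (by simp)⟩

theorem vertices_of_planes_succ (hu : Uniform Z) (hn : 4 ≤ n) {V : Gr ℂ 2 4} {k : Fin n}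
    (h₁ : V ∈ planeCondition Z (cycSucc k)) (h₂ : V ∈ planeCondition Z (cycSucc (cycSucc k))) :
    V ∈ vertexCondition Z (cycSucc k) ∧ V ∈ vertexCondition Z (cycSucc (cycSucc k)) := by
  rw [mem_planeCondition_succ] at h₁ h₂
  exact eq_span_of_planes (hu.br_ne (cycSucc_ne hn k).symm (cycSucc₂_ne hn k).symm
    (cycSucc₃_ne hn k).symm (cycSucc_ne hn _).symm (cycSucc₂_ne hn _).symm
    (cycSucc_ne hn _).symm) h₁ h₂

/-- The hypothesis `hk` means n = 4; then two opposite planes share the diagonal through their outer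
vertices. -/
theorem vertices_of_planes_opposite (hu : Uniform Z) (hn : 4 ≤ n) {V : Gr ℂ 2 4} {k : Fin n}
    (hk : cycSucc (cycSucc (cycSucc (cycSucc k))) = k)
    (h₁ : V ∈ planeCondition Z (cycSucc k))
    (h₂ : V ∈ planeCondition Z (cycSucc (cycSucc (cycSucc k)))) :
    V ∈ vertexCondition Z k ∧ V ∈ vertexCondition Z (cycSucc (cycSucc k)) := by
  rw [mem_planeCondition_succ] at h₁ h₂
  rw [hk] at h₂
  refine eq_span_of_planes (p := zc Z (cycSucc k)) (q := zc Z (cycSucc (cycSucc (cycSucc k))))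
    (hu.br_ne (cycSucc_ne hn k) (cycSucc_ne hn _).symm
    (cycSucc₂_ne hn _).symm (cycSucc₂_ne hn _).symm (cycSucc₃_ne hn _).symm
    (cycSucc_ne hn _).symm) (h₁.trans (le_of_eq ?_)) (h₂.trans (le_of_eq ?_))
  · congr 1; ext; simp; tauto
  · congr 1; ext; simp; tauto

theorem mem_triple_of_vertex_of_plane (hu : Uniform Z) (hn : 4 ≤ n) {V : Gr ℂ 2 4} {i j : Fin n}
    (h₁ : V ∈ vertexCondition Z i) (h₂ : V ∈ planeCondition Z (cycSucc j)) :
    i = j ∨ i = cycSucc j ∨ i = cycSucc (cycSucc j) := by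
  by_contra! h
  rw [mem_planeCondition_succ] at h₂
  have := h₂ h₁
  rw [Submodule.mem_span_triple] at this
  obtain ⟨a, b, c, e⟩ := this
  apply hu.br_ne h.1 h.2.1 h.2.2 (cycSucc_ne hn j).symm (cycSucc₂_ne hn j).symm
    (cycSucc_ne hn _).symm
  rw [← e]
  simp [br_add₁, br_smul₁]

theorem Uniform.space_eq (hu : Uniform Z) (hn : 4 ≤ n) {V : Gr ℂ 2 4} {i j : Fin n} (hij : i ≠ j)
    (h₁ : V ∈ vertexCondition Z i) (h₂ : V ∈ vertexCondition Z j) :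
    V.space = Submodule.span ℂ {zc Z i, zc Z j} :=
  V.eq_span_of_mem h₁ h₂ (hu.indep hn hij)

end Incidence

section Strata

variable {n : ℕ} {Z : Matrix (Fin n) (Fin 4) ℝ}

/-! ### Closedness and irreducibility of the incidence conditions -/

theorem exists_br_ne_zero {K : Type} [Field K] {A B : Fin 4 → K}
    (h : LinearIndependent K ![A, B]) : ∃ C D, br A B C D ≠ 0 := by
  by_contra! hc
  apply (plucker_eq_zero_iff A B).1 _ h
  have := fun k l => hc (Pi.single k 1) (Pi.single l 1)
  funext i
  fin_cases i
  · simpa [br_eq, plucker, sub_eq_zero, eq_comm] using this 2 3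
  · simpa [br_eq, plucker, sub_eq_zero, eq_comm] using this 3 1
  · simpa [br_eq, plucker, sub_eq_zero, eq_comm] using this 1 2
  · simpa [br_eq, plucker, sub_eq_zero, eq_comm] using this 0 3
  · simpa [br_eq, plucker, sub_eq_zero, eq_comm] using this 2 0
  · simpa [br_eq, plucker, sub_eq_zero, eq_comm] using this 0 1

theorem mem_span_pair_of_br {K : Type} [Field K] {A B x : Fin 4 → K}
    (h : LinearIndependent K ![A, B]) (hx : ∀ D, br A B x D = 0) :
    x ∈ Submodule.span K {A, B} := by
  obtain ⟨C, D, hne⟩ := exists_br_ne_zero h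
  have := cramer A B C D x
  rw [hx D, br_swap₃₄ A B x C, hx C] at this
  rw [← Submodule.smul_mem_iff _ hne, this, Submodule.mem_span_pair]
  exact ⟨_, _, by module⟩

theorem mem_span_triple_of_br {K : Type} [Field K] {x y w A e : Fin 4 → K}
    (h : br x y w e ≠ 0) (hA : br A x y w = 0) : A ∈ Submodule.span K {x, y, w} := by
  have := cramer x y w e A
  have h' : br x y w A = 0 := by
    rw [br_swap₃₄, br_swap₂₃, br_swap₁₂, hA]; simp
  rw [h'] at this
  rw [← Submodule.smul_mem_iff _ h, this, Submodule.mem_span_triple]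
  exact ⟨_, _, _, by module⟩

/-- Containment in a plane becomes a set of linear equations in Plücker coordinates, hence a closed
condition. If A were off the plane, Cramer's rule and the three equations would make B a multiple of
A. -/
theorem le_span_triple_iff {x y w e : Fin 4 → ℂ} (h : br x y w e ≠ 0) {V : Gr ℂ 2 4}
    {A B : Fin 4 → ℂ} (hV : V.space = Submodule.span ℂ {A, B}) :
    V.space ≤ Submodule.span ℂ {x, y, w} ↔ br A B x y = 0 ∧ br A B x w = 0 ∧ br A B y w = 0 := by
  have hAB := V.indep_of_span hV
  constructor
  · intro hle
    have hA := hle (by rw [hV]; exact Submodule.subset_span (by simp) : A ∈ V.space)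
    have hB := hle (by rw [hV]; exact Submodule.subset_span (by simp) : B ∈ V.space)
    rw [Submodule.mem_span_triple] at hA hB
    obtain ⟨a, b, c, rfl⟩ := hA
    obtain ⟨d, e, f, rfl⟩ := hB
    simp [br_add₁, br_add₂, br_smul₁, br_smul₂]
  · rintro ⟨h1, h2, h3⟩
    have key : ∀ A B : Fin 4 → ℂ, LinearIndependent ℂ ![A, B] → br A B x y = 0 →
        br A B x w = 0 → br A B y w = 0 → A ∈ Submodule.span ℂ {x, y, w} := by
      intro A B hAB h1 h2 h3
      apply mem_span_triple_of_br h
      by_contra hne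
      have := cramer A x y w B
      have e1 : br A x B w = 0 := by rw [br_swap₂₃, h2, neg_zero]
      have e2 : br A x y B = 0 := by rw [br_swap₃₄, br_swap₂₃, h1]; simp
      rw [h3, e1, e2] at this
      have h' := (pair_indep_iff A B).1 hAB (br B x y w) (-br A x y w) (by
        rw [neg_smul, this]; module)
      exact hne (neg_eq_zero.1 h'.2)
    rw [hV, Submodule.span_le]
    rintro v (rfl | rfl)
    · exact key _ _ hAB h1 h2 h3
    · refine key _ A ?_ ?_ ?_ ?_
      · rwa [LinearIndependent.pair_symm_iff] at hAB
      all_goals rw [br_swap₁₂]; simpa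

theorem isClosed_lineCondition (hu : Uniform Z) (hn : 4 ≤ n) (k : Fin n) :
    IsClosed (lineCondition Z k) := by
  refine isClosed_of_pairing {dualPlucker (zc Z k) (zc Z (cycSucc k))} fun V A B hV => ?_
  rw [mem_lineCondition_iff_br hu hn hV, br_eq_pairing]
  simp

theorem isClosed_vertexCondition (i : Fin n) : IsClosed (vertexCondition Z i) := by
  refine isClosed_of_pairing (Set.range fun D => dualPlucker (zc Z i) D) fun V A B hV => ?_
  simp only [Set.forall_mem_range, ← br_eq_pairing]
  constructor
  · intro h D
    have h' : zc Z i ∈ Submodule.span ℂ {A, B} := hV ▸ h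
    obtain ⟨a, b, e⟩ := Submodule.mem_span_pair.1 h'
    rw [← e]
    simp [br_add₃, br_smul₃]
  · intro h
    change zc Z i ∈ V.space
    rw [hV]
    exact mem_span_pair_of_br (V.indep_of_span hV) h

theorem isClosed_planeCondition (hu : Uniform Z) (hn : 4 ≤ n) (k : Fin n) :
    IsClosed (planeCondition Z (cycSucc k)) := by
  obtain ⟨l, hl1, hl2, hl3⟩ := exists_other hn k (cycSucc k) (cycSucc (cycSucc k))
  refine isClosed_of_pairing {dualPlucker (zc Z k) (zc Z (cycSucc k)),
    dualPlucker (zc Z k) (zc Z (cycSucc (cycSucc k))),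
    dualPlucker (zc Z (cycSucc k)) (zc Z (cycSucc (cycSucc k)))} fun V A B hV => ?_
  rw [mem_planeCondition_succ, le_span_triple_iff (hu.br_ne (cycSucc_ne hn k).symm
    (cycSucc₂_ne hn k).symm hl1 (cycSucc_ne hn _).symm hl2 hl3) hV]
  simp [br_eq_pairing]

theorem lineCondition_eq (k : Fin n) : lineCondition Z k =
    joinSet (Submodule.span ℂ {zc Z k, zc Z (cycSucc k)}) ⊤ := by
  ext V
  rw [mem_lineCondition]
  constructor
  · rintro ⟨P, hP, hP', h0⟩
    obtain ⟨B, hB⟩ := V.exists_span_of_mem hP h0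
    exact ⟨P, hP', B, trivial, hB⟩
  · rintro ⟨P, hP, B, -, h⟩
    exact ⟨P, by rw [h]; exact Submodule.subset_span (by simp), hP,
      (V.indep_of_span h).ne_zero 0⟩

theorem vertexCondition_eq (i : Fin n) (hu : Uniform Z) (hn : 4 ≤ n) : vertexCondition Z i =
    joinSet (Submodule.span ℂ {zc Z i}) ⊤ := by
  ext V
  constructor
  · intro h
    obtain ⟨B, hB⟩ := V.exists_span_of_mem h (hu.zc_ne_zero hn i)
    exact ⟨_, Submodule.subset_span rfl, B, trivial, hB⟩
  · rintro ⟨P, hP, B, -, h⟩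
    obtain ⟨c, rfl⟩ := Submodule.mem_span_singleton.1 hP
    have hne : c • zc Z i ≠ 0 := (V.indep_of_span h).ne_zero 0
    have hc : c ≠ 0 := by rintro rfl; simp at hne
    have : c • zc Z i ∈ V.space := by rw [h]; exact Submodule.subset_span (by simp)
    exact (Submodule.smul_mem_iff _ hc).1 this

theorem planeCondition_eq (k : Fin n) : planeCondition Z k =
    joinSet (Submodule.span ℂ {zc Z (cycPred k), zc Z k, zc Z (cycSucc k)})
      (Submodule.span ℂ {zc Z (cycPred k), zc Z k, zc Z (cycSucc k)}) := by
  ext V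
  rw [mem_planeCondition]
  constructor
  · intro h
    obtain ⟨A, B, -, hAB⟩ := V.exists_basis
    exact ⟨A, h (by rw [hAB]; exact Submodule.subset_span (by simp)), B,
      h (by rw [hAB]; exact Submodule.subset_span (by simp)), hAB⟩
  · rintro ⟨A, hA, B, hB, h⟩
    rw [h, Submodule.span_le]
    rintro x (rfl | rfl) <;> assumption

theorem line_inter_line_eq (hu : Uniform Z) (hn : 4 ≤ n) {a b : Fin n} (h₁ : a ≠ b)
    (h₂ : cycSucc a ≠ b) (h₃ : cycSucc b ≠ a) : lineCondition Z a ∩ lineCondition Z b =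
    joinSet (Submodule.span ℂ {zc Z a, zc Z (cycSucc a)})
      (Submodule.span ℂ {zc Z b, zc Z (cycSucc b)}) := by
  ext V
  rw [Set.mem_inter_iff, mem_lineCondition, mem_lineCondition]
  constructor
  · rintro ⟨⟨P, hP, hP', hP0⟩, Q, hQ, hQ', hQ0⟩
    refine ⟨P, hP', Q, hQ', V.eq_span_of_mem hP hQ (indep_of_lines (hu.br_ne
      (cycSucc_ne hn a).symm h₁ h₃.symm h₂ ?_ (cycSucc_ne hn b).symm) hP' hQ' hP0 hQ0)⟩
    rwa [Ne, cycSucc_inj]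
  · rintro ⟨P, hP, Q, hQ, h⟩
    have hl := V.indep_of_span h
    exact ⟨⟨P, by rw [h]; exact Submodule.subset_span (by simp), hP, hl.ne_zero 0⟩,
      Q, by rw [h]; exact Submodule.subset_span (by simp), hQ, hl.ne_zero 1⟩

theorem vertex_inter_line_eq (hu : Uniform Z) (hn : 4 ≤ n) {i k : Fin n} (h₁ : i ≠ k)
    (h₂ : i ≠ cycSucc k) : vertexCondition Z i ∩ lineCondition Z k =
    joinSet (Submodule.span ℂ {zc Z i}) (Submodule.span ℂ {zc Z k, zc Z (cycSucc k)}) := by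
  ext V
  constructor
  · rintro ⟨hi, hk⟩
    obtain ⟨P, hP, -, h⟩ := exists_of_vertex_of_line hu hn hi hk h₁ h₂
    exact ⟨_, Submodule.subset_span rfl, P, hP, h⟩
  · rintro ⟨P, hP, Q, hQ, h⟩
    refine ⟨?_, ?_⟩
    · rw [vertexCondition_eq i hu hn]
      exact ⟨P, hP, Q, trivial, h⟩
    · rw [lineCondition_eq k]
      exact ⟨Q, hQ, P, trivial, by rw [h, Set.pair_comm]⟩

theorem vertex_inter_plane_eq (hu : Uniform Z) (hn : 4 ≤ n) {i k : Fin n}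
    (h : zc Z i ∈ Submodule.span ℂ {zc Z (cycPred k), zc Z k, zc Z (cycSucc k)}) :
    vertexCondition Z i ∩ planeCondition Z k = joinSet (Submodule.span ℂ {zc Z i})
      (Submodule.span ℂ {zc Z (cycPred k), zc Z k, zc Z (cycSucc k)}) := by
  ext V
  constructor
  · rintro ⟨hi, hk⟩
    obtain ⟨B, hB⟩ := V.exists_span_of_mem hi (hu.zc_ne_zero hn i)
    exact ⟨_, Submodule.subset_span rfl, B, hk (by
      rw [hB]; exact Submodule.subset_span (by simp)), hB⟩
  · rintro ⟨P, hP, Q, hQ, h'⟩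
    refine ⟨?_, ?_⟩
    · rw [vertexCondition_eq i hu hn]
      exact ⟨P, hP, Q, trivial, h'⟩
    · rw [planeCondition_eq]
      refine ⟨P, ?_, Q, hQ, h'⟩
      obtain ⟨c, rfl⟩ := Submodule.mem_span_singleton.1 hP
      exact Submodule.smul_mem _ _ h

/-! ### The residual arrangement absorbs small intersections -/

/-- The union of the residual lines and conics. -/
def residualSet (Z : Matrix (Fin n) (Fin 4) ℝ) : Set (Gr ℂ 2 4) :=
  ⋃₀ {S | IsResidualLine Z S ∨ IsResidualConic Z S}

theorem mem_residualSet_of_plane {V : Gr ℂ 2 4} {j k : Fin n}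
    (h₁ : V ∈ planeCondition Z (cycSucc j)) (h₂ : V ∈ lineCondition Z k) (e₁ : j ≠ k)
    (e₂ : cycSucc k ≠ j) (e₃ : cycSucc j ≠ k) (e₄ : cycSucc (cycSucc j) ≠ k) :
    V ∈ residualSet Z := by
  refine ⟨_, Or.inl ⟨cycSucc j, k, ?_, rfl⟩, h₁, h₂⟩
  rw [cycPred_cycSucc, disjoint_triple_pair]
  exact ⟨e₁, e₂.symm, e₃, by rwa [Ne, cycSucc_inj], e₄, by rwa [Ne, cycSucc_inj]⟩

theorem mem_residualSet_of_lines {V : Gr ℂ 2 4} {i j k : Fin n}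
    (h₁ : V ∈ lineCondition Z i) (h₂ : V ∈ lineCondition Z j) (h₃ : V ∈ lineCondition Z k)
    (e₁ : i ≠ j) (e₂ : cycSucc i ≠ j) (e₃ : cycSucc j ≠ i)
    (f₁ : i ≠ k) (f₂ : cycSucc i ≠ k) (f₃ : cycSucc k ≠ i)
    (g₁ : j ≠ k) (g₂ : cycSucc j ≠ k) (g₃ : cycSucc k ≠ j) : V ∈ residualSet Z := by
  refine ⟨_, Or.inr ⟨i, j, k, ?_, ?_, ?_, rfl⟩, ⟨h₁, h₂⟩, h₃⟩ <;> rw [disjoint_pair_pair]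
  · exact ⟨e₁, e₃.symm, e₂, by rwa [Ne, cycSucc_inj]⟩
  · exact ⟨f₁, f₃.symm, f₂, by rwa [Ne, cycSucc_inj]⟩
  · exact ⟨g₁, g₃.symm, g₂, by rwa [Ne, cycSucc_inj]⟩

/-- If `k` or `l` is the edge after the edge `i`, the line lies in a plane of three consecutive
vertices and is on a residual line; otherwise the edges `i`, `k`, `l` are pairwise disjoint and give
a residual conic. -/
theorem mem_residualSet_of_vertex (hu : Uniform Z) (hn : 4 ≤ n) {V : Gr ℂ 2 4} {i k l : Fin n}
    (h₁ : V ∈ vertexCondition Z i) (h₂ : V ∈ lineCondition Z k) (h₃ : V ∈ lineCondition Z l)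
    (e₁ : i ≠ k) (e₂ : cycSucc k ≠ i) (f₁ : i ≠ l) (f₂ : cycSucc l ≠ i)
    (g₁ : k ≠ l) (g₂ : cycSucc k ≠ l) (g₃ : cycSucc l ≠ k) : V ∈ residualSet Z := by
  by_cases hk : cycSucc i = k
  · subst hk
    exact mem_residualSet_of_plane (plane_succ_of_vertex_of_line hu hn h₁ h₂) h₃ f₁ f₂ g₁ g₂
  by_cases hl : cycSucc i = l
  · subst hl
    exact mem_residualSet_of_plane (plane_succ_of_vertex_of_line hu hn h₁ h₃) h₂ e₁ e₂ g₁.symm g₃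
  exact mem_residualSet_of_lines (vertex_subset_line hu hn i h₁) h₂ h₃ e₁ hk e₂ f₁ hl f₂ g₁ g₂ g₃

/-- A line in two planes meets both edges of each. For an edge of the second plane disjoint from the
first plane this is a residual line. Such an edge is missing only if the planes are neighbours, or
opposite with n = 4; then they share a line through two vertices. -/
theorem planes_inter (hu : Uniform Z) (hn : 4 ≤ n) {j k : Fin n} (h : j ≠ k) :
    planeCondition Z (cycSucc j) ∩ planeCondition Z (cycSucc k) ⊆ residualSet Z ∨
    ∃ x y : Fin n, x ≠ y ∧ planeCondition Z (cycSucc j) ∩ planeCondition Z (cycSucc k) ⊆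
      vertexCondition Z x ∩ vertexCondition Z y := by
  by_cases h₁ : cycSucc j = k
  · subst h₁
    exact Or.inr ⟨_, _, (cycSucc_ne hn _).symm, fun V hV =>
      vertices_of_planes_succ hu hn hV.1 hV.2⟩
  by_cases h₂ : cycSucc k = j
  · subst h₂
    exact Or.inr ⟨_, _, (cycSucc_ne hn _).symm, fun V hV =>
      vertices_of_planes_succ hu hn hV.2 hV.1⟩
  by_cases h₃ : cycSucc (cycSucc j) = k
  · by_cases h₄ : cycSucc (cycSucc k) = j
    · subst h₃
      exact Or.inr ⟨_, _, (cycSucc₂_ne hn j).symm, fun V hV =>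
        vertices_of_planes_opposite hu hn h₄ hV.1 hV.2⟩
    · refine Or.inl fun V hV => mem_residualSet_of_plane hV.1
        (plane_subset_line hu hn _ hV.2) (Ne.symm h₂) h₄ ?_ ?_
      · rwa [Ne, cycSucc_inj]
      · rwa [Ne, cycSucc_inj]
  · exact Or.inl fun V hV => mem_residualSet_of_plane hV.1
      (plane_succ_subset_line hu hn _ hV.2) h h₂ h₁ h₃

/-! ### Classification of strata -/

/-- The basic incidence conditions with vertices, edges and planes. -/
inductive IsBasic (Z : Matrix (Fin n) (Fin 4) ℝ) : Set (Gr ℂ 2 4) → Prop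
  | line (k : Fin n) : IsBasic Z (lineCondition Z k)
  | vertex (k : Fin n) : IsBasic Z (vertexCondition Z k)
  -- Planes are indexed by the first of their three vertices.
  | plane (k : Fin n) : IsBasic Z (planeCondition Z (cycSucc k))

/-- An irreducible intersection of basic conditions that contains a line through two vertices. -/
structure IsRegular (Z : Matrix (Fin n) (Fin 4) ℝ) (M : Set (Gr ℂ 2 4)) : Prop where
  irreducible : IsIrreducible M
  basic : ∃ F : Set (Set (Gr ℂ 2 4)), (∀ S ∈ F, IsBasic Z S) ∧ M = ⋂₀ F
  subset_line : ∃ k, M ⊆ lineCondition Z k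
  vertexLine : ∃ x y : Fin n, x ≠ y ∧ ∃ V ∈ M, V ∈ vertexCondition Z x ∧ V ∈ vertexCondition Z y

theorem exists_vertexLine (hu : Uniform Z) (hn : 4 ≤ n) {x y : Fin n} (h : x ≠ y) :
    ∃ V : Gr ℂ 2 4, V.space = Submodule.span ℂ {zc Z x, zc Z y} ∧
      V ∈ vertexCondition Z x ∧ V ∈ vertexCondition Z y :=
  ⟨mkGr _ _ (hu.indep hn h), rfl, Submodule.subset_span (by simp), Submodule.subset_span (by simp)⟩

theorem isRegular_line (hu : Uniform Z) (hn : 4 ≤ n) (k : Fin n) :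
    IsRegular Z (lineCondition Z k) := by
  obtain ⟨V, -, hx, hy⟩ := exists_vertexLine hu hn (cycSucc_ne hn k).symm
  have hV := vertex_subset_line hu hn k hx
  refine ⟨?_, ⟨{_}, fun S hS => hS ▸ IsBasic.line k, by simp⟩, ⟨k, subset_rfl⟩,
    ⟨_, _, (cycSucc_ne hn k).symm, V, hV, hx, hy⟩⟩
  rw [lineCondition_eq k] at hV ⊢
  exact isIrreducible_joinSet ⟨V, hV⟩

theorem isRegular_vertex (hu : Uniform Z) (hn : 4 ≤ n) (k : Fin n) :
    IsRegular Z (vertexCondition Z k) := by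
  obtain ⟨V, -, hx, hy⟩ := exists_vertexLine hu hn (cycSucc_ne hn k).symm
  have hV := hx
  refine ⟨?_, ⟨{_}, fun S hS => hS ▸ IsBasic.vertex k, by simp⟩,
    ⟨k, vertex_subset_line hu hn k⟩, ⟨_, _, (cycSucc_ne hn k).symm, V, hV, hx, hy⟩⟩
  rw [vertexCondition_eq k hu hn] at hV ⊢
  exact isIrreducible_joinSet ⟨V, hV⟩

theorem mem_plane_of_vertices (hu : Uniform Z) (hn : 4 ≤ n) {V : Gr ℂ 2 4} {x y k : Fin n}
    (h : x ≠ y) (hx : V ∈ vertexCondition Z x) (hy : V ∈ vertexCondition Z y)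
    (hx' : x = k ∨ x = cycSucc k ∨ x = cycSucc (cycSucc k))
    (hy' : y = k ∨ y = cycSucc k ∨ y = cycSucc (cycSucc k)) :
    V ∈ planeCondition Z (cycSucc k) := by
  rw [mem_planeCondition_succ, hu.space_eq hn h hx hy]
  apply Submodule.span_mono
  rintro _ (rfl | rfl)
  · rcases hx' with rfl | rfl | rfl <;> simp
  · rcases hy' with rfl | rfl | rfl <;> simp

theorem isRegular_plane (hu : Uniform Z) (hn : 4 ≤ n) (k : Fin n) :
    IsRegular Z (planeCondition Z (cycSucc k)) := by
  obtain ⟨V, -, hx, hy⟩ := exists_vertexLine hu hn (cycSucc_ne hn k).symm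
  have hV := mem_plane_of_vertices hu hn (cycSucc_ne hn k).symm hx hy (Or.inl rfl)
    (Or.inr (Or.inl rfl))
  refine ⟨?_, ⟨{_}, fun S hS => hS ▸ IsBasic.plane k, by simp⟩,
    ⟨k, plane_succ_subset_line hu hn k⟩, ⟨_, _, (cycSucc_ne hn k).symm, V, hV, hx, hy⟩⟩
  rw [planeCondition_eq] at hV ⊢
  exact isIrreducible_joinSet ⟨V, hV⟩

theorem isRegular_vertex_plane (hu : Uniform Z) (hn : 4 ≤ n) {i k : Fin n}
    (hi : i = k ∨ i = cycSucc k ∨ i = cycSucc (cycSucc k)) :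
    IsRegular Z (vertexCondition Z i ∩ planeCondition Z (cycSucc k)) := by
  obtain ⟨y, hy, hiy⟩ : ∃ y, (y = k ∨ y = cycSucc k ∨ y = cycSucc (cycSucc k)) ∧ i ≠ y := by
    by_cases h : i = k
    · exact ⟨cycSucc k, by simp, h ▸ (cycSucc_ne hn k).symm⟩
    · exact ⟨k, by simp, h⟩
  obtain ⟨V, -, hVx, hVy⟩ := exists_vertexLine hu hn hiy
  have hV : V ∈ vertexCondition Z i ∩ planeCondition Z (cycSucc k) :=
    ⟨hVx, mem_plane_of_vertices hu hn hiy hVx hVy hi hy⟩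
  refine ⟨?_, ⟨{vertexCondition Z i, planeCondition Z (cycSucc k)}, ?_, by simp⟩,
    ⟨i, fun V hV => vertex_subset_line hu hn i hV.1⟩, ⟨_, _, hiy, V, hV, hVx, hVy⟩⟩
  · have hmem : zc Z i ∈ Submodule.span ℂ
        {zc Z (cycPred (cycSucc k)), zc Z (cycSucc k), zc Z (cycSucc (cycSucc k))} := by
      rw [cycPred_cycSucc]
      apply Submodule.subset_span
      rcases hi with rfl | rfl | rfl <;> simp
    rw [vertex_inter_plane_eq hu hn hmem] at hV ⊢
    exact isIrreducible_joinSet ⟨V, hV⟩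
  · rintro S (rfl | rfl)
    · exact IsBasic.vertex i
    · exact IsBasic.plane k

theorem isRegular_vertex_line (hu : Uniform Z) (hn : 4 ≤ n) {i k : Fin n} (h₁ : i ≠ k)
    (h₂ : i ≠ cycSucc k) : IsRegular Z (vertexCondition Z i ∩ lineCondition Z k) := by
  obtain ⟨V, -, hVx, hVy⟩ := exists_vertexLine hu hn h₁
  have hV : V ∈ vertexCondition Z i ∩ lineCondition Z k := ⟨hVx, vertex_subset_line hu hn k hVy⟩
  refine ⟨?_, ⟨{vertexCondition Z i, lineCondition Z k}, ?_, by simp⟩,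
    ⟨i, fun V hV => vertex_subset_line hu hn i hV.1⟩, ⟨_, _, h₁, V, hV, hVx, hVy⟩⟩
  · rw [vertex_inter_line_eq hu hn h₁ h₂] at hV ⊢
    exact isIrreducible_joinSet ⟨V, hV⟩
  · rintro S (rfl | rfl)
    · exact IsBasic.vertex i
    · exact IsBasic.line k

theorem isRegular_line_line (hu : Uniform Z) (hn : 4 ≤ n) {a b : Fin n} (h₁ : a ≠ b)
    (h₂ : cycSucc a ≠ b) (h₃ : cycSucc b ≠ a) :
    IsRegular Z (lineCondition Z a ∩ lineCondition Z b) := by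
  obtain ⟨V, -, hVx, hVy⟩ := exists_vertexLine hu hn h₁
  have hV : V ∈ lineCondition Z a ∩ lineCondition Z b :=
    ⟨vertex_subset_line hu hn a hVx, vertex_subset_line hu hn b hVy⟩
  refine ⟨?_, ⟨{lineCondition Z a, lineCondition Z b}, ?_, by simp⟩,
    ⟨a, fun V hV => hV.1⟩, ⟨_, _, h₁, V, hV, hVx, hVy⟩⟩
  · rw [line_inter_line_eq hu hn h₁ h₂ h₃] at hV ⊢
    exact isIrreducible_joinSet ⟨V, hV⟩
  · rintro S (rfl | rfl)
    · exact IsBasic.line a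
    · exact IsBasic.line b

theorem isRegular_vertex_vertex (hu : Uniform Z) (hn : 4 ≤ n) {x y : Fin n} (h : x ≠ y) :
    IsRegular Z (vertexCondition Z x ∩ vertexCondition Z y) := by
  obtain ⟨V, hVs, hVx, hVy⟩ := exists_vertexLine hu hn h
  refine ⟨?_, ⟨{vertexCondition Z x, vertexCondition Z y}, ?_, by simp⟩,
    ⟨x, fun V hV => vertex_subset_line hu hn x hV.1⟩, ⟨_, _, h, V, ⟨hVx, hVy⟩, hVx, hVy⟩⟩
  · have : vertexCondition Z x ∩ vertexCondition Z y = {V} := by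
      ext W
      constructor
      · rintro ⟨h1, h2⟩
        exact Gr.ext (by rw [hu.space_eq hn h h1 h2, hVs])
      · rintro rfl
        exact ⟨hVx, hVy⟩
    rw [this]
    exact isIrreducible_singleton
  · rintro S (rfl | rfl)
    · exact IsBasic.vertex x
    · exact IsBasic.vertex y

theorem IsIrreducible.subset_or {X : Type} [TopologicalSpace X] {C S T : Set X}
    (hC : IsIrreducible C) (hS : IsClosed S) (hT : IsClosed T) (h : C ⊆ S ∪ T) :
    C ⊆ S ∨ C ⊆ T :=
  (isPreirreducible_iff_isClosed_union_isClosed.1 hC.isPreirreducible) S T hS hT h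

theorem subset_vertex_or_plane (hu : Uniform Z) (hn : 4 ≤ n) {C : Set (Gr ℂ 2 4)}
    (hC : IsIrreducible C) {k : Fin n} (h₁ : C ⊆ lineCondition Z k)
    (h₂ : C ⊆ lineCondition Z (cycSucc k)) :
    C ⊆ vertexCondition Z (cycSucc k) ∨ C ⊆ planeCondition Z (cycSucc k) :=
  IsIrreducible.subset_or hC (isClosed_vertexCondition _) (isClosed_planeCondition hu hn k)
    fun _ hV => vertex_or_plane hu hn (h₁ hV) (h₂ hV)

/-- An irreducible set of lines meeting an edge either is residual or has a regular hull. -/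
theorem residual_or_regular (hu : Uniform Z) (hn : 4 ≤ n) {C : Set (Gr ℂ 2 4)}
    (hC : IsIrreducible C) {a : Fin n} (ha : C ⊆ lineCondition Z a) :
    C ⊆ residualSet Z ∨ ∃ M, IsRegular Z M ∧ C ⊆ M ∧ ∀ S, IsBasic Z S → C ⊆ S → M ⊆ S := by
  by_cases hres : C ⊆ residualSet Z
  · exact Or.inl hres
  right
  -- If `C` lies in two vertex conditions, it is a single point of the Grassmannian and is its own
  -- hull.
  by_cases hVV : ∃ x y, x ≠ y ∧ C ⊆ vertexCondition Z x ∧ C ⊆ vertexCondition Z y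
  · obtain ⟨x, y, hxy, hx, hy⟩ := hVV
    refine ⟨_, isRegular_vertex_vertex hu hn hxy, fun V hV => ⟨hx hV, hy hV⟩, fun S _ hS W hW => ?_⟩
    obtain ⟨V, hV⟩ := hC.nonempty
    have : W = V := Gr.ext (by
      rw [hu.space_eq hn hxy hW.1 hW.2, hu.space_eq hn hxy (hx hV) (hy hV)])
    exact this ▸ hS hV
  -- From here on `C` satisfies at most one vertex condition and, by `planes_inter`, at most one
  -- plane condition.
  have hVu : ∀ x y, C ⊆ vertexCondition Z x → C ⊆ vertexCondition Z y → x = y := by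
    intro x y hx hy
    by_contra h
    exact hVV ⟨x, y, h, hx, hy⟩
  have hPu : ∀ j k, C ⊆ planeCondition Z (cycSucc j) → C ⊆ planeCondition Z (cycSucc k) →
      j = k := by
    intro j k hj hk
    by_contra h
    rcases planes_inter (Z := Z) hu hn h with h' | ⟨x, y, hxy, h'⟩
    · exact hres fun V hV => h' ⟨hj hV, hk hV⟩
    · exact hxy (hVu x y (fun V hV => (h' ⟨hj hV, hk hV⟩).1) (fun V hV => (h' ⟨hj hV, hk hV⟩).2))
  have hLL := fun k => subset_vertex_or_plane (k := k) hu hn hC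
  by_cases hP : ∃ j, C ⊆ planeCondition Z (cycSucc j)
  · obtain ⟨j, hj⟩ := hP
    -- An edge condition on lines in a plane either is automatic, or belongs to an edge touching the
    -- plane at an end vertex and forces that vertex, or makes `C` residual.
    have hL : ∀ k, C ⊆ lineCondition Z k → planeCondition Z (cycSucc j) ⊆ lineCondition Z k ∨
        ∃ x, C ⊆ vertexCondition Z x ∧ vertexCondition Z x ⊆ lineCondition Z k := by
      intro k hk
      by_cases h1 : j = k
      · subst h1; exact Or.inl (plane_succ_subset_line hu hn j)
      by_cases h2 : cycSucc j = k
      · subst h2; exact Or.inl (plane_subset_line hu hn _)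
      by_cases h3 : cycSucc (cycSucc j) = k
      · subst h3
        exact Or.inr ⟨_, fun V hV => vertex_of_plane_of_line_succ hu hn (hj hV) (hk hV),
          vertex_subset_line hu hn _⟩
      by_cases h4 : cycSucc k = j
      · subst h4
        exact Or.inr ⟨_, fun V hV => vertex_of_plane_of_line_pred hu hn (hj hV) (hk hV),
          vertex_succ_subset_line hu hn _⟩
      exact absurd (fun V hV => mem_residualSet_of_plane (hj hV) (hk hV) h1 h4 h2 h3) hres
    by_cases hV : ∃ i, C ⊆ vertexCondition Z i
    · obtain ⟨i, hi⟩ := hV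
      obtain ⟨V, hVC⟩ := hC.nonempty
      refine ⟨_, isRegular_vertex_plane hu hn
        (mem_triple_of_vertex_of_plane hu hn (hi hVC) (hj hVC)), fun V hV => ⟨hi hV, hj hV⟩, ?_⟩
      rintro _ (k | k | k) hS
      · rcases hL k hS with h | ⟨x, hx, h⟩
        · exact fun V hV => h hV.2
        · obtain rfl := hVu x i hx hi
          exact fun V hV => h hV.1
      · obtain rfl := hVu k i hS hi
        exact fun V hV => hV.1
      · obtain rfl := hPu k j hS hj
        exact fun V hV => hV.2
    · refine ⟨_, isRegular_plane hu hn j, hj, ?_⟩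
      rintro _ (k | k | k) hS
      · rcases hL k hS with h | ⟨x, hx, h⟩
        · exact h
        · exact absurd ⟨x, hx⟩ hV
      · exact absurd ⟨k, hS⟩ hV
      · obtain rfl := hPu k j hS hj
        exact subset_rfl
  -- Without a plane condition, two adjacent edge conditions force the common vertex.
  · have hLV : ∀ k, C ⊆ lineCondition Z k → C ⊆ lineCondition Z (cycSucc k) →
        C ⊆ vertexCondition Z (cycSucc k) := fun k h1 h2 =>
      (hLL k h1 h2).resolve_right fun h => hP ⟨k, h⟩
    by_cases hV : ∃ i, C ⊆ vertexCondition Z i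
    · obtain ⟨i, hi⟩ := hV
      have hline : ∀ k, (i = k ∨ i = cycSucc k) → vertexCondition Z i ⊆ lineCondition Z k := by
        rintro k (rfl | rfl)
        · exact vertex_subset_line hu hn _
        · exact vertex_succ_subset_line hu hn _
      by_cases hk : ∃ k, C ⊆ lineCondition Z k ∧ i ≠ k ∧ i ≠ cycSucc k
      · obtain ⟨k, hk, h1, h2⟩ := hk
        refine ⟨_, isRegular_vertex_line hu hn h1 h2, fun V hV => ⟨hi hV, hk hV⟩, ?_⟩
        rintro _ (l | l | l) hS
        · by_cases h3 : i = l ∨ i = cycSucc l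
          · exact fun V hV => hline l h3 hV.1
          push Not at h3
          by_cases h4 : k = l
          · subst h4; exact fun V hV => hV.2
          have h5 : cycSucc k ≠ l := by
            rintro rfl
            exact h2 (hVu _ _ hi (hLV k hk hS))
          have h6 : cycSucc l ≠ k := by
            rintro rfl
            exact h3.2 (hVu _ _ hi (hLV l hS hk))
          exact absurd (fun V hV => mem_residualSet_of_vertex hu hn (hi hV) (hk hV) (hS hV) h1
            h2.symm h3.1 h3.2.symm h4 h5 h6) hres
        · obtain rfl := hVu l i hS hi
          exact fun V hV => hV.1
        · exact absurd ⟨l, hS⟩ hP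
      · push Not at hk
        refine ⟨_, isRegular_vertex hu hn i, hi, ?_⟩
        rintro _ (l | l | l) hS
        · by_cases h : i = l
          · exact hline l (Or.inl h)
          · exact hline l (Or.inr (hk l hS h))
        · obtain rfl := hVu l i hS hi
          exact subset_rfl
        · exact absurd ⟨l, hS⟩ hP
    -- With neither vertex nor plane, the edges met by `C` are pairwise skew. A third one would
    -- place `C` in a residual conic, so there are at most two.
    · have hadj : ∀ k l, C ⊆ lineCondition Z k → C ⊆ lineCondition Z l → cycSucc k ≠ l := by
        rintro k _ hk hl rfl
        exact hV ⟨_, hLV k hk hl⟩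
      by_cases hb : ∃ b, a ≠ b ∧ C ⊆ lineCondition Z b
      · obtain ⟨b, hab, hb⟩ := hb
        refine ⟨_, isRegular_line_line hu hn hab (hadj a b ha hb) (hadj b a hb ha),
          fun V hV => ⟨ha hV, hb hV⟩, ?_⟩
        rintro _ (l | l | l) hS
        · by_cases h1 : a = l
          · subst h1; exact fun V hV => hV.1
          by_cases h2 : b = l
          · subst h2; exact fun V hV => hV.2
          exact absurd (fun V hV => mem_residualSet_of_lines (ha hV) (hb hV) (hS hV) hab
            (hadj a b ha hb) (hadj b a hb ha) h1 (hadj a l ha hS) (hadj l a hS ha)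
            h2 (hadj b l hb hS) (hadj l b hS hb)) hres
        · exact absurd ⟨l, hS⟩ hV
        · exact absurd ⟨l, hS⟩ hP
      · push Not at hb
        refine ⟨_, isRegular_line hu hn a, ha, ?_⟩
        rintro _ (l | l | l) hS
        · by_cases h1 : a = l
          · subst h1; exact subset_rfl
          · exact absurd hS (hb l h1)
        · exact absurd ⟨l, hS⟩ hV
        · exact absurd ⟨l, hS⟩ hP

theorem subset_line_of_subset_iUnion (hu : Uniform Z) (hn : 4 ≤ n) {C : Set (Gr ℂ 2 4)}
    (hC : IsIrreducible C) (h : C ⊆ ⋃ k, lineCondition Z k) : ∃ k, C ⊆ lineCondition Z k := by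
  have := (isIrreducible_iff_sUnion_isClosed.1 hC) (Finset.univ.image fun k => lineCondition Z k)
    (by simp only [Finset.mem_image]; rintro _ ⟨k, -, rfl⟩; exact isClosed_lineCondition hu hn k)
    (by simpa using h)
  simpa using this

/-- For a component C of S ∩ T with S and T regular, the hull of C satisfies every basic condition
cutting out S or T, because C does. So the hull is an irreducible subset of S ∩ T containing C, and
maximality makes them equal. -/
theorem IsStratum.residual_or_regular (hu : Uniform Z) (hn : 4 ≤ n)
    (hb : algBoundary Z = ⋃ k, lineCondition Z k) {C : Set (Gr ℂ 2 4)} (hC : IsStratum Z C) :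
    C ⊆ residualSet Z ∨ IsRegular Z C := by
  induction hC with
  | component C hC =>
    right
    obtain ⟨k, hk⟩ := subset_line_of_subset_iUnion hu hn hC.prop.1 (hb ▸ hC.prop.2)
    have hr := isRegular_line hu hn (Z := Z) k
    have := hC.eq_of_subset ⟨hr.irreducible, hb ▸ Set.subset_iUnion _ k⟩ hk
    rwa [this]
  | inter S T C _ _ hC hS hT =>
    rcases hS with hS | hS
    · exact Or.inl (hC.prop.2.trans (Set.inter_subset_left.trans hS))
    rcases hT with hT | hT
    · exact Or.inl (hC.prop.2.trans (Set.inter_subset_right.trans hT))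
    obtain ⟨k, hk⟩ := hS.subset_line
    rcases TreeAmplituhedron.residual_or_regular hu hn hC.prop.1
      (hC.prop.2.trans (Set.inter_subset_left.trans hk)) with h | ⟨M, hM, hCM, hMS⟩
    · exact Or.inl h
    right
    obtain ⟨F, hF, rfl⟩ := hS.basic
    obtain ⟨G, hG, rfl⟩ := hT.basic
    have hsub : M ⊆ ⋂₀ F ∩ ⋂₀ G := by
      apply Set.subset_inter <;> apply Set.subset_sInter
      · exact fun A hA => hMS A (hF A hA)
          (hC.prop.2.trans (Set.inter_subset_left.trans (Set.sInter_subset_of_mem hA)))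
      · exact fun A hA => hMS A (hG A hA)
          (hC.prop.2.trans (Set.inter_subset_right.trans (Set.sInter_subset_of_mem hA)))
    rw [hC.eq_of_subset ⟨hM.irreducible, hsub⟩ hCM]
    exact hM

/-! ### Residual lines and conics are strata -/

theorem exists_mem_line_not_mem (hu : Uniform Z) (hn : 4 ≤ n) {a b : Fin n} (h : a ≠ b) :
    ∃ V ∈ lineCondition Z a, V ∉ lineCondition Z b := by
  obtain ⟨x, hx, h1, h2⟩ : ∃ x, (x = a ∨ x = cycSucc a) ∧ x ≠ b ∧ x ≠ cycSucc b := by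
    by_cases h' : a = cycSucc b
    · subst h'
      exact ⟨_, Or.inr rfl, cycSucc₂_ne hn b, cycSucc_ne hn _⟩
    · exact ⟨a, Or.inl rfl, h, h'⟩
  obtain ⟨y, hy1, hy2, hy3⟩ := exists_other hn x b (cycSucc b)
  obtain ⟨V, hV, hVx, hVy⟩ := exists_vertexLine hu hn hy1
  refine ⟨V, ?_, ?_⟩
  · rcases hx with rfl | rfl
    · exact vertex_subset_line hu hn _ hVx
    · exact vertex_succ_subset_line hu hn _ hVx
  · rw [mem_lineCondition_iff_br hu hn hV]
    exact hu.br_ne hy1 h1 h2 hy2.symm hy3.symm (cycSucc_ne hn b).symm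

/-- Maximality holds because no edge condition is contained in a different one, and an irreducible
subset of the boundary lies in a single edge condition. -/
theorem isStratum_line (hu : Uniform Z) (hn : 4 ≤ n)
    (hb : algBoundary Z = ⋃ k, lineCondition Z k) (a : Fin n) :
    IsStratum Z (lineCondition Z a) := by
  apply IsStratum.component
  refine ⟨⟨(isRegular_line hu hn a).irreducible, hb ▸ Set.subset_iUnion _ a⟩, ?_⟩
  rintro S ⟨hS, hS'⟩ hle
  obtain ⟨b, hSb⟩ := subset_line_of_subset_iUnion hu hn hS (hb ▸ hS')
  by_cases hab : a = b
  · subst hab; exact hSb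
  · obtain ⟨V, hV, hV'⟩ := exists_mem_line_not_mem (Z := Z) hu hn hab
    exact absurd (hSb (hle hV)) hV'

theorem isStratum_inter {S T : Set (Gr ℂ 2 4)} (hS : IsStratum Z S) (hT : IsStratum Z T)
    (h : IsIrreducible (S ∩ T)) : IsStratum Z (S ∩ T) :=
  IsStratum.inter S T _ hS hT ⟨⟨h, subset_rfl⟩, fun _ hU _ => hU.2⟩

theorem isStratum_plane (hu : Uniform Z) (hn : 4 ≤ n)
    (hb : algBoundary Z = ⋃ k, lineCondition Z k) (a : Fin n) :
    IsStratum Z (planeCondition Z (cycSucc a)) := by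
  refine IsStratum.inter _ _ _ (isStratum_line hu hn hb a) (isStratum_line hu hn hb (cycSucc a))
    ⟨⟨(isRegular_plane hu hn a).irreducible, fun V hV => ⟨plane_succ_subset_line hu hn a hV,
      plane_subset_line hu hn _ hV⟩⟩, ?_⟩
  rintro S ⟨hS, hS'⟩ hle
  rcases subset_vertex_or_plane hu hn hS (fun V hV => (hS' hV).1) (fun V hV => (hS' hV).2)
    with h | h
  · exfalso
    -- The line through the two outer vertices lies in the plane but misses the middle vertex, so a
    -- larger irreducible set cannot lie in the vertex component.
    obtain ⟨V, hV, hVx, hVy⟩ := exists_vertexLine (Z := Z) hu hn (cycSucc₂_ne hn a).symm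
    have h1 := h (hle (mem_plane_of_vertices hu hn (cycSucc₂_ne hn a).symm hVx hVy (by simp)
      (by simp)))
    change zc Z (cycSucc a) ∈ V.space at h1
    rw [hV, Submodule.mem_span_pair] at h1
    obtain ⟨s, t, e⟩ := h1
    obtain ⟨l, hl1, hl2, hl3⟩ := exists_other hn a (cycSucc a) (cycSucc (cycSucc a))
    have := hu.br_ne (cycSucc_ne hn a).symm (cycSucc₂_ne hn a).symm hl1 (cycSucc_ne hn _).symm
      hl2 hl3
    rw [← e] at this
    simp [br_add₂, br_smul₂] at this
  · exact h

/-- The edge `k` meets the plane in one point `q`, so the set is the pencil of lines through `q` in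
the plane. -/
theorem isIrreducible_residualLine (hu : Uniform Z) (hn : 4 ≤ n) {j k : Fin n} (e₁ : j ≠ k)
    (e₂ : cycSucc k ≠ j) (e₃ : cycSucc j ≠ k) (e₄ : cycSucc (cycSucc j) ≠ k) :
    IsIrreducible (planeCondition Z (cycSucc j) ∩ lineCondition Z k) := by
  set W := Submodule.span ℂ {zc Z j, zc Z (cycSucc j), zc Z (cycSucc (cycSucc j))} with hW
  set x := zc Z j with hx
  set y := zc Z (cycSucc j) with hy
  set w := zc Z (cycSucc (cycSucc j)) with hw
  have hk : br x y w (zc Z k) ≠ 0 := hu.br_ne (cycSucc_ne hn j).symm (cycSucc₂_ne hn j).symm e₁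
    (cycSucc_ne hn _).symm e₃ e₄
  have hk' : br x y w (zc Z (cycSucc k)) ≠ 0 := hu.br_ne (cycSucc_ne hn j).symm
    (cycSucc₂_ne hn j).symm e₂.symm (cycSucc_ne hn _).symm (by rwa [Ne, cycSucc_inj])
    (by rwa [Ne, cycSucc_inj])
  -- The combination of the two endpoints on which the equation ⟨x y w ·⟩ of the plane vanishes.
  set q := br x y w (zc Z (cycSucc k)) • zc Z k - br x y w (zc Z k) • zc Z (cycSucc k) with hq
  have hqk : q ∈ Submodule.span ℂ {zc Z k, zc Z (cycSucc k)} :=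
    Submodule.mem_span_pair.2 ⟨br x y w (zc Z (cycSucc k)), -br x y w (zc Z k), by
      rw [hq]; module⟩
  have hq0 : q ≠ 0 := by
    intro h0
    have := (pair_indep_iff _ _).1 (hu.indep hn (cycSucc_ne hn k).symm)
      (br x y w (zc Z (cycSucc k))) (-br x y w (zc Z k)) (by rw [← h0, hq]; module)
    exact hk' this.1
  have hqW : q ∈ W := by
    apply mem_span_triple_of_br hk
    rw [hq]
    simp only [br_eq, Pi.sub_apply, Pi.smul_apply, smul_eq_mul]
    ring
  have hset : planeCondition Z (cycSucc j) ∩ lineCondition Z k =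
      joinSet (Submodule.span ℂ {q}) W := by
    ext V
    constructor
    · rintro ⟨h1, h2⟩
      rw [mem_planeCondition_succ] at h1
      obtain ⟨Q, hQ, hQ', hQ0⟩ := mem_lineCondition.1 h2
      have hQW := h1 hQ
      have hQu : br x y w Q = 0 := by
        rw [Submodule.mem_span_triple] at hQW
        obtain ⟨a, b, c, rfl⟩ := hQW
        simp [br_add₄, br_smul₄, ← hx, ← hy, ← hw]
      obtain ⟨s, t, rfl⟩ := Submodule.mem_span_pair.1 hQ'
      rw [br_add₄, br_smul₄, br_smul₄] at hQu
      have hQq : br x y w (zc Z (cycSucc k)) • (s • zc Z k + t • zc Z (cycSucc k)) = s • q := by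
        rw [hq]
        have : (br x y w (zc Z (cycSucc k)) * t) = -(s * br x y w (zc Z k)) := by
          linear_combination hQu
        rw [smul_add, smul_smul, smul_smul, this]
        module
      have hs : s ≠ 0 := by
        rintro rfl
        rw [zero_smul ℂ q, smul_eq_zero] at hQq
        exact hQ0 (hQq.resolve_left hk')
      have hqV : q ∈ V.space := by
        rw [← Submodule.smul_mem_iff _ hs, ← hQq]
        exact Submodule.smul_mem _ _ hQ
      obtain ⟨B, hB⟩ := V.exists_span_of_mem hqV hq0
      exact ⟨q, Submodule.subset_span rfl, B,
        h1 (by rw [hB]; exact Submodule.subset_span (by simp)), hB⟩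
    · rintro ⟨P, hP, B, hB, h⟩
      obtain ⟨c, rfl⟩ := Submodule.mem_span_singleton.1 hP
      have hne : c • q ≠ 0 := (V.indep_of_span h).ne_zero 0
      refine ⟨?_, mem_lineCondition.2 ⟨c • q, ?_, Submodule.smul_mem _ _ hqk, hne⟩⟩
      · rw [mem_planeCondition_succ, h, Submodule.span_le]
        rintro v (rfl | rfl)
        · exact Submodule.smul_mem _ _ hqW
        · exact hB
      · rw [h]; exact Submodule.subset_span (by simp)
  rw [hset]
  apply isIrreducible_joinSet
  obtain ⟨u, hu1, hu2⟩ : ∃ u ∈ W, LinearIndependent ℂ ![q, u] := by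
    refine ⟨x, Submodule.subset_span (Or.inl rfl), ?_⟩
    obtain ⟨l, hl1, hl2, hl3⟩ := exists_other hn j k (cycSucc k)
    exact indep_of_lines (c := x) (d := zc Z l) (hu.br_ne (cycSucc_ne hn k).symm e₁.symm hl2 e₂
      hl3 hl1) hqk (Submodule.subset_span (by simp)) hq0 (hu.zc_ne_zero hn _)
  exact ⟨mkGr q u hu2, q, Submodule.subset_span rfl, u, hu1, rfl⟩

/-- The point of the edge `j` in the plane spanned by `P` and the edge `k`. -/
def transversalPoint (Z : Matrix (Fin n) (Fin 4) ℝ) (j k : Fin n) (P : Fin 4 → ℂ) : Fin 4 → ℂ :=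
  br P (zc Z (cycSucc j)) (zc Z k) (zc Z (cycSucc k)) • zc Z j -
    br P (zc Z j) (zc Z k) (zc Z (cycSucc k)) • zc Z (cycSucc j)

theorem br_transversalPoint (j k : Fin n) (P : Fin 4 → ℂ) :
    br P (transversalPoint Z j k P) (zc Z k) (zc Z (cycSucc k)) = 0 := by
  simp only [transversalPoint, br_eq, Pi.sub_apply, Pi.smul_apply, smul_eq_mul]
  ring

theorem transversalPoint_mem (j k : Fin n) (P : Fin 4 → ℂ) :
    transversalPoint Z j k P ∈ Submodule.span ℂ {zc Z j, zc Z (cycSucc j)} :=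
  Submodule.sub_mem _ (Submodule.smul_mem _ _ (Submodule.subset_span (by simp)))
    (Submodule.smul_mem _ _ (Submodule.subset_span (by simp)))

/-- A transversal of three pairwise skew edges is determined by its point P on the edge `i`. Its
point on the edge `j` is `transversalPoint`, which is linear in P, so a segment on the edge `i`
gives a polynomial path of transversals. -/
theorem isIrreducible_residualConic (hu : Uniform Z) (hn : 4 ≤ n) {i j k : Fin n}
    (e₁ : i ≠ j) (e₂ : cycSucc i ≠ j) (e₃ : cycSucc j ≠ i)
    (f₁ : i ≠ k) (f₂ : cycSucc i ≠ k) (f₃ : cycSucc k ≠ i)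
    (g₁ : j ≠ k) (g₂ : cycSucc j ≠ k) (g₃ : cycSucc k ≠ j) :
    IsIrreducible (lineCondition Z i ∩ lineCondition Z j ∩ lineCondition Z k) := by
  have hjk : br (zc Z j) (zc Z (cycSucc j)) (zc Z k) (zc Z (cycSucc k)) ≠ 0 :=
    hu.br_ne (cycSucc_ne hn j).symm g₁ g₃.symm g₂ (by rwa [Ne, cycSucc_inj])
      (cycSucc_ne hn k).symm
  have hik : br (zc Z i) (zc Z (cycSucc i)) (zc Z k) (zc Z (cycSucc k)) ≠ 0 :=
    hu.br_ne (cycSucc_ne hn i).symm f₁ f₃.symm f₂ (by rwa [Ne, cycSucc_inj])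
      (cycSucc_ne hn k).symm
  have hij : br (zc Z i) (zc Z (cycSucc i)) (zc Z j) (zc Z (cycSucc j)) ≠ 0 :=
    hu.br_ne (cycSucc_ne hn i).symm e₁ e₃.symm e₂ (by rwa [Ne, cycSucc_inj])
      (cycSucc_ne hn j).symm
  have hne : ∀ P ∈ Submodule.span ℂ {zc Z i, zc Z (cycSucc i)}, P ≠ 0 →
      ¬ (br P (zc Z j) (zc Z k) (zc Z (cycSucc k)) = 0 ∧
        br P (zc Z (cycSucc j)) (zc Z k) (zc Z (cycSucc k)) = 0) := by
    rintro P hP h0 ⟨h1, h2⟩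
    have := cramer (zc Z j) (zc Z (cycSucc j)) (zc Z k) (zc Z (cycSucc k)) P
    rw [br_swap₁₂ P, h1, h2] at this
    have hPk : P ∈ Submodule.span ℂ {zc Z k, zc Z (cycSucc k)} := by
      rw [← Submodule.smul_mem_iff _ hjk, this, Submodule.mem_span_pair]
      exact ⟨_, _, by module⟩
    have := (pair_indep_iff P P).1 (indep_of_lines hik hP hPk h0 h0) 1 (-1) (by module)
    simp at this
  have hspan : ∀ V ∈ lineCondition Z i ∩ lineCondition Z j ∩ lineCondition Z k,
      ∃ P ∈ Submodule.span ℂ {zc Z i, zc Z (cycSucc i)},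
        V.space = Submodule.span ℂ {P, transversalPoint Z j k P} := by
    rintro V ⟨⟨h1, h2⟩, h3⟩
    obtain ⟨P, hP, hP', hP0⟩ := mem_lineCondition.1 h1
    obtain ⟨Q, hQ, hQ', hQ0⟩ := mem_lineCondition.1 h2
    have hPQ := V.eq_span_of_mem hP hQ (indep_of_lines hij hP' hQ' hP0 hQ0)
    rw [mem_lineCondition_iff_br hu hn hPQ] at h3
    obtain ⟨s, t, rfl⟩ := Submodule.mem_span_pair.1 hQ'
    rw [br_add₂, br_smul₂, br_smul₂] at h3
    have hn' := hne P hP' hP0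
    set α := br P (zc Z j) (zc Z k) (zc Z (cycSucc k)) with hα
    set β := br P (zc Z (cycSucc j)) (zc Z k) (zc Z (cycSucc k)) with hβ
    have hT : transversalPoint Z j k P = β • zc Z j - α • zc Z (cycSucc j) := rfl
    -- The transversal point and Q are both zeros on the edge `j` of the same nonzero linear form ⟨P
    -- · k(k+1)⟩, hence proportional.
    obtain ⟨c, hc⟩ : ∃ c : ℂ, transversalPoint Z j k P = c • (s • zc Z j + t • zc Z (cycSucc j)) := by
      by_cases hs : s = 0
      · have ht : t ≠ 0 := by rintro rfl; simp [hs] at hQ0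
        have hβ0 : β = 0 := by simpa [hs, ht] using h3
        refine ⟨-α / t, ?_⟩
        rw [hT, hβ0, hs, smul_add, smul_smul, smul_smul, div_mul_cancel₀ _ ht]
        module
      · refine ⟨β / s, ?_⟩
        have : α = -(β / s * t) := by field_simp; linear_combination h3
        rw [hT, this, smul_add, smul_smul, smul_smul, div_mul_cancel₀ _ hs]
        module
    have hT0 : transversalPoint Z j k P ≠ 0 := by
      intro h0
      rw [hT] at h0
      have := (pair_indep_iff _ _).1 (hu.indep hn (cycSucc_ne hn j).symm) β (-α) (by
        rw [← h0]; module)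
      exact hn' ⟨neg_eq_zero.1 this.2, this.1⟩
    refine ⟨P, hP', V.eq_span_of_mem hP ?_ (indep_of_lines hij hP' (transversalPoint_mem j k P)
      hP0 hT0)⟩
    rw [hc]
    exact Submodule.smul_mem _ _ hQ
  have hmem : ∀ P ∈ Submodule.span ℂ {zc Z i, zc Z (cycSucc i)},
      ∀ h : LinearIndependent ℂ ![P, transversalPoint Z j k P],
      mkGr P (transversalPoint Z j k P) h ∈
        lineCondition Z i ∩ lineCondition Z j ∩ lineCondition Z k := by
    intro P hP h
    refine ⟨⟨mem_lineCondition.2 ⟨P, Submodule.subset_span (by simp), hP, h.ne_zero 0⟩,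
      mem_lineCondition.2 ⟨_, Submodule.subset_span (by simp), transversalPoint_mem j k P,
      h.ne_zero 1⟩⟩, ?_⟩
    rw [mem_lineCondition_iff_br hu hn rfl]
    exact br_transversalPoint j k P
  apply isIrreducible_of_paths
  · refine ⟨mkGr (zc Z i) (transversalPoint Z j k (zc Z i)) ?_,
      hmem _ (Submodule.subset_span (by simp)) _⟩
    refine indep_of_lines hij (Submodule.subset_span (by simp)) (transversalPoint_mem j k _)
      (hu.zc_ne_zero hn _) ?_
    intro h0
    have := (pair_indep_iff _ _).1 (hu.indep hn (cycSucc_ne hn j).symm)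
      (br (zc Z i) (zc Z (cycSucc j)) (zc Z k) (zc Z (cycSucc k)))
      (-br (zc Z i) (zc Z j) (zc Z k) (zc Z (cycSucc k))) (by
        rw [← h0, transversalPoint]; module)
    exact hne _ (Submodule.subset_span (by simp)) (hu.zc_ne_zero hn _)
      ⟨neg_eq_zero.1 this.2, this.1⟩
  · intro V₁ h₁ V₂ h₂
    obtain ⟨P₁, hP₁, h₁⟩ := hspan V₁ h₁
    obtain ⟨P₂, hP₂, h₂⟩ := hspan V₂ h₂
    have hseg := PolyVec.segment P₁ P₂
    refine ⟨_, fun t => transversalPoint Z j k ((1 - t) • P₁ + t • P₂), hseg, ?_,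
      by simpa using h₁, by simpa using h₂, fun t ht => hmem _ (Submodule.add_mem _
        (Submodule.smul_mem _ _ hP₁) (Submodule.smul_mem _ _ hP₂)) ht⟩
    exact (PolyVec.smul (hseg.br (PolyVec.const _) (PolyVec.const _) (PolyVec.const _))
      (PolyVec.const _)).sub (PolyVec.smul (hseg.br (PolyVec.const _) (PolyVec.const _)
      (PolyVec.const _)) (PolyVec.const _))

theorem isStratum_residualLine (hu : Uniform Z) (hn : 4 ≤ n)
    (hb : algBoundary Z = ⋃ k, lineCondition Z k) {S : Set (Gr ℂ 2 4)}
    (hS : IsResidualLine Z S) : IsStratum Z S := by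
  obtain ⟨i, k, h, rfl⟩ := hS
  obtain ⟨j, rfl⟩ : ∃ j, i = cycSucc j := ⟨cycPred i, by simp⟩
  rw [cycPred_cycSucc, disjoint_triple_pair] at h
  exact isStratum_inter (isStratum_plane hu hn hb j) (isStratum_line hu hn hb k)
    (isIrreducible_residualLine hu hn h.1 h.2.1.symm h.2.2.1 h.2.2.2.2.1)

theorem isStratum_residualConic (hu : Uniform Z) (hn : 4 ≤ n)
    (hb : algBoundary Z = ⋃ k, lineCondition Z k) {S : Set (Gr ℂ 2 4)}
    (hS : IsResidualConic Z S) : IsStratum Z S := by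
  obtain ⟨i, j, k, h₁, h₂, h₃, rfl⟩ := hS
  rw [disjoint_pair_pair] at h₁ h₂ h₃
  refine isStratum_inter (isStratum_inter (isStratum_line hu hn hb i) (isStratum_line hu hn hb j)
    (isRegular_line_line hu hn h₁.1 h₁.2.2.1 h₁.2.1.symm).irreducible)
    (isStratum_line hu hn hb k) (isIrreducible_residualConic hu hn h₁.1 h₁.2.2.1 h₁.2.1.symm
      h₂.1 h₂.2.2.1 h₂.2.1.symm h₃.1 h₃.2.2.1 h₃.2.1.symm)

end Strata

section Real

variable {n : ℕ} {Z : Matrix (Fin n) (Fin 4) ℝ}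

/-! ### Signs of brackets -/

/-- All ordered maximal minors have the sign of `ε`. -/
def OrderedSign (Z : Matrix (Fin n) (Fin 4) ℝ) (ε : ℝ) : Prop :=
  ∀ i j k l : Fin n, i < j → j < k → k < l → 0 < ε * br (Z i) (Z j) (Z k) (Z l)

/-- One fixed minor serves as `ε`; only its sign matters later. -/
theorem IsTotallyPositive.exists_orderedSign (hZ : IsTotallyPositive Z) (hn : 4 ≤ n) :
    ∃ ε : ℝ, OrderedSign Z ε := by
  refine ⟨(Z.submatrix (Fin.castLEOrderEmb hn) id).det, fun i j k l hij hjk hkl => ?_⟩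
  have hm : StrictMono ![i, j, k, l] := by
    rw [Fin.strictMono_iff_lt_succ]
    intro a
    fin_cases a <;> simpa
  have := hZ (Fin.castLEOrderEmb hn) (OrderEmbedding.ofStrictMono _ hm)
  have e : Z.submatrix ![i, j, k, l] id = Matrix.of ![Z i, Z j, Z k, Z l] := by
    ext a b
    fin_cases a <;> rfl
  rw [br, ← e]
  exact this

theorem IsTotallyPositive.uniform (hZ : IsTotallyPositive Z) : Uniform Z := by
  intro i j k l h₁ h₂ h₃ h₄ h₅ h₆
  rw [br_ne_zero_iff]
  have hcard : ({i, j, k, l} : Finset (Fin n)).card = 4 := by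
    simp [Finset.card_insert_of_notMem, h₁, h₂, h₃, h₄, h₅, h₆]
  set I := ({i, j, k, l} : Finset (Fin n)).orderEmbOfFin hcard with hI
  have hdet : (Z.submatrix I id).det ≠ 0 := by
    intro h
    have := hZ I I
    simp [h] at this
  have hli : LinearIndependent ℝ (Z.submatrix I id) := by
    have := Matrix.linearIndependent_rows_iff_isUnit (A := Z.submatrix I id)
    rw [Matrix.isUnit_iff_isUnit_det, isUnit_iff_ne_zero] at this
    exact this.2 hdet
  have hr : ∀ a, ∃ b, I b = ![i, j, k, l] a := by
    intro a
    have : ![i, j, k, l] a ∈ Set.range I := by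
      rw [hI, Finset.range_orderEmbOfFin]
      fin_cases a <;> simp
    exact this
  choose τ hτ using hr
  have hinj : Function.Injective τ := by
    intro a b hab
    have : ![i, j, k, l] a = ![i, j, k, l] b := by rw [← hτ, ← hτ, hab]
    revert this
    fin_cases a <;> fin_cases b <;> simp [h₁, h₂, h₃, h₄, h₅, h₆, h₁.symm, h₂.symm, h₃.symm,
      h₄.symm, h₅.symm, h₆.symm]
  have := hli.comp τ hinj
  have e : ![Z i, Z j, Z k, Z l] = Z.submatrix I id ∘ τ := by
    funext a
    have h' : (Z.submatrix I id ∘ τ) a = Z (![i, j, k, l] a) := by rw [← hτ]; rfl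
    rw [h']
    fin_cases a <;> rfl
  rw [e]
  exact this

/-- The sign of an edge: the closing edge of the cycle is twisted. -/
def edgeSign (k : Fin n) : ℝ := if (k : ℕ) + 1 = n then -1 else 1

theorem edgeSign_mul_self (k : Fin n) : edgeSign k * edgeSign k = 1 := by
  unfold edgeSign; split_ifs <;> norm_num

theorem edgeSign_ne_zero (k : Fin n) : edgeSign k ≠ 0 := by
  unfold edgeSign; split_ifs <;> norm_num

/-- Moving the adjacent pair k, k+1 past another index is an even permutation. For the closing edge
the first vertex must be carried past three others, which is the sign recorded in `edgeSign`. -/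
theorem OrderedSign.edge_pos {ε : ℝ} (hε : OrderedSign Z ε) {i j k : Fin n} (hij : i < j)
    (h₁ : i ≠ k) (h₂ : i ≠ cycSucc k) (h₃ : j ≠ k) (h₄ : j ≠ cycSucc k) :
    0 < ε * edgeSign k * br (Z i) (Z j) (Z k) (Z (cycSucc k)) := by
  have hv := cycSucc_val k
  rw [Fin.lt_def] at hij
  rw [Ne, Fin.ext_iff] at h₁ h₂ h₃ h₄
  have hi := i.isLt
  have hj := j.isLt
  have hk := k.isLt
  unfold edgeSign
  split_ifs at hv ⊢ with hlast
  · have := hε (cycSucc k) i j k (by rw [Fin.lt_def]; omega) (by rw [Fin.lt_def]; omega)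
      (by rw [Fin.lt_def]; omega)
    rw [br_swap₁₂, br_swap₂₃, br_swap₃₄] at this
    linarith
  · rcases lt_or_ge (j : ℕ) k with hjk | hjk
    · have := hε i j k (cycSucc k) (by rw [Fin.lt_def]; omega) (by rw [Fin.lt_def]; omega)
        (by rw [Fin.lt_def]; omega)
      linarith
    rcases lt_or_ge (i : ℕ) k with hik | hik
    · have := hε i k (cycSucc k) j (by rw [Fin.lt_def]; omega) (by rw [Fin.lt_def]; omega)
        (by rw [Fin.lt_def]; omega)
      have e : br (Z i) (Z j) (Z k) (Z (cycSucc k)) = br (Z i) (Z k) (Z (cycSucc k)) (Z j) := by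
        simp only [br_eq]; ring
      rw [e]
      linarith
    · have := hε k (cycSucc k) i j (by rw [Fin.lt_def]; omega) (by rw [Fin.lt_def]; omega)
        (by rw [Fin.lt_def]; omega)
      rw [br_pairs] at this
      linarith

theorem OrderedSign.adjacent_pos_of_lt {ε : ℝ} (hε : OrderedSign Z ε) {u v w k : Fin n}
    (huv : u < v) (hvw : v < w)
    (h₁ : u ≠ k) (h₂ : u ≠ cycSucc k) (h₃ : v ≠ k) (h₄ : v ≠ cycSucc k) (h₅ : w ≠ k)
    (h₆ : w ≠ cycSucc k) :
    0 < ε ^ 2 * (edgeSign k * br (Z u) (Z v) (Z w) (Z k) *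
      br (Z u) (Z v) (Z w) (Z (cycSucc k))) := by
  have hv := cycSucc_val k
  rw [Fin.lt_def] at huv hvw
  rw [Ne, Fin.ext_iff] at h₁ h₂ h₃ h₄ h₅ h₆
  have hi := u.isLt
  have hj := w.isLt
  have hk := k.isLt
  unfold edgeSign
  split_ifs at hv ⊢ with hlast
  · have e1 := hε (cycSucc k) u v w (by rw [Fin.lt_def]; omega) (by rw [Fin.lt_def]; omega)
      (by rw [Fin.lt_def]; omega)
    have e2 := hε u v w k (by rw [Fin.lt_def]; omega) (by rw [Fin.lt_def]; omega)
      (by rw [Fin.lt_def]; omega)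
    rw [br_swap₁₂, br_swap₂₃, br_swap₃₄] at e1
    nlinarith [mul_pos e1 e2]
  · rcases lt_or_ge (w : ℕ) k with hwk | hwk
    · have e1 := hε u v w k (by rw [Fin.lt_def]; omega) (by rw [Fin.lt_def]; omega)
        (by rw [Fin.lt_def]; omega)
      have e2 := hε u v w (cycSucc k) (by rw [Fin.lt_def]; omega) (by rw [Fin.lt_def]; omega)
        (by rw [Fin.lt_def]; omega)
      nlinarith [mul_pos e1 e2]
    rcases lt_or_ge (v : ℕ) k with hvk | hvk
    · have e1 := hε u v k w (by rw [Fin.lt_def]; omega) (by rw [Fin.lt_def]; omega)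
        (by rw [Fin.lt_def]; omega)
      have e2 := hε u v (cycSucc k) w (by rw [Fin.lt_def]; omega) (by rw [Fin.lt_def]; omega)
        (by rw [Fin.lt_def]; omega)
      rw [br_swap₃₄] at e1 e2
      nlinarith [mul_pos e1 e2]
    rcases lt_or_ge (u : ℕ) k with huk | huk
    · have e1 := hε u k v w (by rw [Fin.lt_def]; omega) (by rw [Fin.lt_def]; omega)
        (by rw [Fin.lt_def]; omega)
      have e2 := hε u (cycSucc k) v w (by rw [Fin.lt_def]; omega) (by rw [Fin.lt_def]; omega)
        (by rw [Fin.lt_def]; omega)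
      rw [br_swap₂₃, br_swap₃₄] at e1 e2
      nlinarith [mul_pos e1 e2]
    · have e1 := hε k u v w (by rw [Fin.lt_def]; omega) (by rw [Fin.lt_def]; omega)
        (by rw [Fin.lt_def]; omega)
      have e2 := hε (cycSucc k) u v w (by rw [Fin.lt_def]; omega) (by rw [Fin.lt_def]; omega)
        (by rw [Fin.lt_def]; omega)
      rw [br_swap₁₂, br_swap₂₃, br_swap₃₄] at e1 e2
      nlinarith [mul_pos e1 e2]

/-- Replacing the last index k by k+1 crosses none of u, v, w unless the edge wraps around. Sorting
u, v, w changes both factors by the same sign, so the ordered case is enough. -/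
theorem OrderedSign.adjacent_pos {ε : ℝ} (hε : OrderedSign Z ε) {u v w k : Fin n}
    (huv : u ≠ v) (huw : u ≠ w) (hvw : v ≠ w)
    (h₁ : u ≠ k) (h₂ : u ≠ cycSucc k) (h₃ : v ≠ k) (h₄ : v ≠ cycSucc k) (h₅ : w ≠ k)
    (h₆ : w ≠ cycSucc k) :
    0 < edgeSign k * br (Z u) (Z v) (Z w) (Z k) * br (Z u) (Z v) (Z w) (Z (cycSucc k)) := by
  suffices h : 0 < ε ^ 2 * (edgeSign k * br (Z u) (Z v) (Z w) (Z k) *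
      br (Z u) (Z v) (Z w) (Z (cycSucc k))) from pos_of_mul_pos_right h (sq_nonneg ε)
  have s₁ : ∀ x, br (Z v) (Z u) (Z w) x = -br (Z u) (Z v) (Z w) x := fun x => br_swap₁₂ _ _ _ _
  have s₂ : ∀ x, br (Z u) (Z w) (Z v) x = -br (Z u) (Z v) (Z w) x := fun x => br_swap₂₃ _ _ _ _
  have s₃ : ∀ x, br (Z v) (Z w) (Z u) x = br (Z u) (Z v) (Z w) x := fun x => by
    rw [br_swap₂₃, br_swap₁₂, neg_neg]
  have s₄ : ∀ x, br (Z w) (Z u) (Z v) x = br (Z u) (Z v) (Z w) x := fun x => by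
    rw [br_swap₁₂, br_swap₂₃, neg_neg]
  have s₅ : ∀ x, br (Z w) (Z v) (Z u) x = -br (Z u) (Z v) (Z w) x := fun x => by
    rw [br_swap₁₂, br_swap₂₃, br_swap₁₂, neg_neg]
  rcases lt_or_gt_of_ne huv with a | a <;> rcases lt_or_gt_of_ne huw with b | b <;>
    rcases lt_or_gt_of_ne hvw with c | c
  · exact hε.adjacent_pos_of_lt a c h₁ h₂ h₃ h₄ h₅ h₆
  · have := hε.adjacent_pos_of_lt b c h₁ h₂ h₅ h₆ h₃ h₄
    simpa [s₂] using this
  · exact absurd (a.trans c) b.not_gt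
  · have := hε.adjacent_pos_of_lt b a h₅ h₆ h₁ h₂ h₃ h₄
    simpa [s₄] using this
  · have := hε.adjacent_pos_of_lt a b h₃ h₄ h₁ h₂ h₅ h₆
    simpa [s₁] using this
  · exact absurd (b.trans c) a.not_gt
  · have := hε.adjacent_pos_of_lt c b h₃ h₄ h₅ h₆ h₁ h₂
    simpa [s₃] using this
  · have := hε.adjacent_pos_of_lt c a h₅ h₆ h₃ h₄ h₁ h₂
    simpa [s₅] using this

/-! ### Points of the amplituhedron -/

/-- The combination of the vertices with the given coefficients. -/
def comb (Z : Matrix (Fin n) (Fin 4) ℝ) (x : Fin n → ℝ) : Fin 4 → ℝ := ∑ i, x i • Z i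

theorem vecMulLinear_eq_comb (x : Fin n → ℝ) : Z.vecMulLinear x = comb Z x := by
  rw [Matrix.vecMulLinear_apply, Matrix.vecMul_eq_sum, comb]

/-- The pair of rows has nonnegative minors. -/
def NonnegMinors (x y : Fin n → ℝ) : Prop := ∀ i j, i < j → 0 ≤ x i * y j - x j * y i

theorem mem_amplituhedron {Y : Gr ℝ 2 4} : Y ∈ amplituhedron Z ↔
    ∃ x y : Fin n → ℝ, NonnegMinors x y ∧ Y.space = Submodule.span ℝ {comb Z x, comb Z y} := by
  constructor
  · rintro ⟨V, ⟨X, hX, hpos⟩, hY⟩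
    refine ⟨X 0, X 1, hpos, ?_⟩
    rw [hY, ← hX, Submodule.map_span]
    congr 1
    rw [← Set.range_comp, ← range_pair]
    congr 1
    funext i
    fin_cases i <;> exact vecMulLinear_eq_comb _
  · rintro ⟨x, y, hpos, hY⟩
    have hli : LinearIndependent ℝ (Matrix.of ![x, y]).row := by
      have h1 := (pair_indep_iff _ _).1 (Y.indep_of_span hY)
      have : LinearIndependent ℝ ![x, y] := by
        rw [LinearIndependent.pair_iff]
        intro a b e
        apply h1 a b
        rw [← vecMulLinear_eq_comb, ← vecMulLinear_eq_comb, ← map_smul, ← map_smul, ← map_add, e,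
          map_zero]
      exact this
    refine ⟨Gr.rowSpan _ hli, ⟨Matrix.of ![x, y], rfl, fun i j hij => by simpa using hpos i j hij⟩,
      ?_⟩
    rw [hY, Gr.rowSpan, Submodule.map_span]
    congr 1
    rw [← Set.range_comp, ← range_pair]
    congr 1
    funext i
    fin_cases i <;> exact (vecMulLinear_eq_comb _).symm

theorem br_comb_left (x : Fin n → ℝ) (B C D : Fin 4 → ℝ) :
    br (comb Z x) B C D = ∑ i, x i * br (Z i) B C D := by
  have : ∀ s : Finset (Fin n), br (∑ i ∈ s, x i • Z i) B C D = ∑ i ∈ s, x i * br (Z i) B C D := by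
    intro s
    induction s using Finset.induction_on with
    | empty => simp
    | insert a s ha ih => rw [Finset.sum_insert ha, Finset.sum_insert ha, br_add₁, br_smul₁, ih]
  exact this _

/-- Cauchy–Binet, summed over ordered pairs; hence the factor two. -/
theorem two_mul_br_comb (x y : Fin n → ℝ) (C D : Fin 4 → ℝ) :
    2 * br (comb Z x) (comb Z y) C D =
      ∑ i, ∑ j, (x i * y j - x j * y i) * br (Z i) (Z j) C D := by
  have h1 : br (comb Z x) (comb Z y) C D = ∑ i, ∑ j, x i * y j * br (Z i) (Z j) C D := by
    rw [br_comb_left]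
    refine Finset.sum_congr rfl fun i _ => ?_
    rw [br_swap₁₂, br_comb_left, ← Finset.sum_neg_distrib, Finset.mul_sum]
    refine Finset.sum_congr rfl fun j _ => ?_
    rw [br_swap₁₂]; ring
  have h2 : br (comb Z x) (comb Z y) C D = ∑ i, ∑ j, -(x j * y i * br (Z i) (Z j) C D) := by
    rw [h1, Finset.sum_comm]
    refine Finset.sum_congr rfl fun i _ => Finset.sum_congr rfl fun j _ => ?_
    rw [br_swap₁₂]; ring
  rw [two_mul]
  nth_rewrite 1 [h1]
  rw [h2, ← Finset.sum_add_distrib]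
  refine Finset.sum_congr rfl fun i _ => ?_
  rw [← Finset.sum_add_distrib]
  exact Finset.sum_congr rfl fun j _ => by ring

theorem OrderedSign.term_nonneg {ε : ℝ} (hε : OrderedSign Z ε) {x y : Fin n → ℝ}
    (h : NonnegMinors x y) (k i j : Fin n) :
    0 ≤ ε * edgeSign k * ((x i * y j - x j * y i) * br (Z i) (Z j) (Z k) (Z (cycSucc k))) := by
  by_cases h1 : i = k
  · subst h1; simp
  by_cases h2 : i = cycSucc k
  · subst h2; simp
  by_cases h3 : j = k
  · subst h3; simp
  by_cases h4 : j = cycSucc k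
  · subst h4; simp
  rcases lt_trichotomy i j with h5 | rfl | h5
  · have := mul_nonneg (hε.edge_pos h5 h1 h2 h3 h4).le (h i j h5)
    linarith
  · simp
  · have := mul_nonneg (hε.edge_pos h5 h3 h4 h1 h2).le (h j i h5)
    rw [br_swap₁₂] at this
    linarith

theorem OrderedSign.br_comb_nonneg {ε : ℝ} (hε : OrderedSign Z ε) {x y : Fin n → ℝ}
    (h : NonnegMinors x y) (k : Fin n) :
    0 ≤ ε * edgeSign k * br (comb Z x) (comb Z y) (Z k) (Z (cycSucc k)) := by
  have := two_mul_br_comb (Z := Z) x y (Z k) (Z (cycSucc k))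
  have h2 : 0 ≤ ε * edgeSign k * (2 * br (comb Z x) (comb Z y) (Z k) (Z (cycSucc k))) := by
    rw [this, Finset.mul_sum]
    refine Finset.sum_nonneg fun i _ => ?_
    rw [Finset.mul_sum]
    exact Finset.sum_nonneg fun j _ => hε.term_nonneg h k i j
  linarith

/-- The bracket is, up to sign, a sum of nonnegative terms. If it vanishes, so does each term, and
the determinants of the vertices in the relevant terms are nonzero. -/
theorem OrderedSign.minor_eq_zero {ε : ℝ} (hε : OrderedSign Z ε) (hu : Uniform Z) (hn : 4 ≤ n)
    {x y : Fin n → ℝ} (h : NonnegMinors x y) {k : Fin n}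
    (h0 : br (comb Z x) (comb Z y) (Z k) (Z (cycSucc k)) = 0) {i j : Fin n}
    (h₁ : i ≠ k) (h₂ : i ≠ cycSucc k) (h₃ : j ≠ k) (h₄ : j ≠ cycSucc k) :
    x i * y j - x j * y i = 0 := by
  by_cases hij : i = j
  · subst hij; ring
  have hε0 : ε ≠ 0 := by
    rintro rfl
    have := hε ⟨0, by omega⟩ ⟨1, by omega⟩ ⟨2, by omega⟩ ⟨3, by omega⟩ (by simp [Fin.lt_def])
      (by simp [Fin.lt_def]) (by simp [Fin.lt_def])
    simp at this
  have h2 := two_mul_br_comb (Z := Z) x y (Z k) (Z (cycSucc k))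
  rw [h0, mul_zero] at h2
  have h3 : ∑ i, ∑ j, ε * edgeSign k *
      ((x i * y j - x j * y i) * br (Z i) (Z j) (Z k) (Z (cycSucc k))) = 0 := by
    simp only [← Finset.mul_sum, ← h2, mul_zero]
  rw [Finset.sum_eq_zero_iff_of_nonneg fun i _ => Finset.sum_nonneg fun j _ =>
    hε.term_nonneg h k i j] at h3
  have h4 := h3 i (Finset.mem_univ _)
  rw [Finset.sum_eq_zero_iff_of_nonneg fun j _ => hε.term_nonneg h k i j] at h4
  have h5 := h4 j (Finset.mem_univ _)
  have := hu i j k (cycSucc k) hij h₁ h₂ h₃ h₄ (cycSucc_ne hn k).symm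
  simpa [hε0, edgeSign_ne_zero, this] using h5

theorem complexify_space {Y : Gr ℝ 2 4} {A B : Fin 4 → ℝ}
    (h : Y.space = Submodule.span ℝ {A, B}) :
    Y.complexify.space = Submodule.span ℂ {toComplex A, toComplex B} := by
  have hli : LinearIndependent ℂ ![toComplex A, toComplex B] := by
    have := linearIndependent_toComplex (Y.indep_of_span h)
    convert this using 1
    funext i; fin_cases i <;> rfl
  refine Y.complexify.eq_span_of_mem ?_ ?_ hli
  · exact Submodule.subset_span ⟨A, by rw [h]; exact Submodule.subset_span (by simp), rfl⟩
  · exact Submodule.subset_span ⟨B, by rw [h]; exact Submodule.subset_span (by simp), rfl⟩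

theorem complexify_mem_line (hu : Uniform Z) (hn : 4 ≤ n) {Y : Gr ℝ 2 4} {A B : Fin 4 → ℝ}
    (h : Y.space = Submodule.span ℝ {A, B}) (k : Fin n) :
    Y.complexify ∈ lineCondition Z k ↔ br A B (Z k) (Z (cycSucc k)) = 0 := by
  rw [mem_lineCondition_iff_br hu hn (complexify_space h), zc, zc, br_toComplex]
  exact_mod_cast Iff.rfl

theorem exists_minor_ne_zero {Y : Gr ℝ 2 4} {x y : Fin n → ℝ}
    (h : Y.space = Submodule.span ℝ {comb Z x, comb Z y}) :
    ∃ i j, x i * y j - x j * y i ≠ 0 := by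
  by_contra! hc
  obtain ⟨C, D, hne⟩ := exists_br_ne_zero (Y.indep_of_span h)
  have := two_mul_br_comb (Z := Z) x y C D
  simp [hc] at this
  exact hne this

/-- Some minor x_u y_v - x_v y_u is nonzero, and then {u, v} must meet each of three pairwise
disjoint edges, which is impossible for two indices. -/
theorem disjoint_residualConic (hu : Uniform Z) (hn : 4 ≤ n) {ε : ℝ} (hε : OrderedSign Z ε)
    {S : Set (Gr ℂ 2 4)} (hS : IsResidualConic Z S) :
    Disjoint S (Gr.complexify '' amplituhedron Z) := by
  obtain ⟨i, j, k, h₁, h₂, h₃, rfl⟩ := hS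
  rw [disjoint_pair_pair] at h₁ h₂ h₃
  rw [Set.disjoint_left]
  rintro _ ⟨⟨hi, hj⟩, hk⟩ ⟨Y, hY, rfl⟩
  obtain ⟨x, y, hxy, hs⟩ := mem_amplituhedron.1 hY
  rw [complexify_mem_line hu hn hs] at hi hj hk
  obtain ⟨u, v, huv⟩ := exists_minor_ne_zero hs
  have key : ∀ l, br (comb Z x) (comb Z y) (Z l) (Z (cycSucc l)) = 0 →
      (u = l ∨ u = cycSucc l) ∨ (v = l ∨ v = cycSucc l) := by
    intro l hl
    by_contra! h
    exact huv (hε.minor_eq_zero hu hn hxy hl h.1.1 h.1.2 h.2.1 h.2.2)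
  have ki := key i hi
  have kj := key j hj
  have kk := key k hk
  clear key hi hj hk huv hs hY hxy
  grind

/-- Meeting the two edges of the plane and the edge `k` leaves only the minors joining the middle
vertex `c` to an endpoint of `k`. Containment in the plane gives one more equation, ⟨Y j (c+1)⟩ = 0,
whose two terms have the same sign by total positivity. Both vanish, so all minors vanish and the
line degenerates. -/
theorem disjoint_residualLine (hu : Uniform Z) (hn : 4 ≤ n) {ε : ℝ} (hε : OrderedSign Z ε)
    {S : Set (Gr ℂ 2 4)} (hS : IsResidualLine Z S) :
    Disjoint S (Gr.complexify '' amplituhedron Z) := by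
  obtain ⟨i, k, h, rfl⟩ := hS
  obtain ⟨j, rfl⟩ : ∃ j, i = cycSucc j := ⟨cycPred i, by simp⟩
  rw [cycPred_cycSucc, disjoint_triple_pair] at h
  obtain ⟨e1, e2, e3, e4, e5, e6⟩ := h
  rw [Set.disjoint_left]
  rintro _ ⟨hp, hk⟩ ⟨Y, hY, rfl⟩
  obtain ⟨x, y, hxy, hs⟩ := mem_amplituhedron.1 hY
  have hj := plane_succ_subset_line hu hn j hp
  have hj' := plane_subset_line hu hn _ hp
  have n1 := cycSucc_ne hn j
  have n2 := cycSucc₂_ne hn j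
  have n3 := cycSucc_ne hn (cycSucc j)
  have nk := cycSucc_ne hn k
  rw [complexify_mem_line hu hn hs] at hj hj' hk
  have hpl : br (comb Z x) (comb Z y) (Z j) (Z (cycSucc (cycSucc j))) = 0 := by
    rw [mem_planeCondition_succ, le_span_triple_iff (hu.br_ne n1.symm n2.symm e1 n3.symm e3 e5)
      (complexify_space hs)] at hp
    have := hp.2.1
    rw [zc, zc, br_toComplex] at this
    exact_mod_cast this
  set p : Fin n → Fin n → ℝ := fun u v => x u * y v - x v * y u with hp'
  have hp0 : ∀ u v, p u v ≠ 0 → (u = cycSucc j ∧ (v = k ∨ v = cycSucc k)) ∨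
      (v = cycSucc j ∧ (u = k ∨ u = cycSucc k)) := by
    intro u v huv
    have key : ∀ l, br (comb Z x) (comb Z y) (Z l) (Z (cycSucc l)) = 0 →
        (u = l ∨ u = cycSucc l) ∨ (v = l ∨ v = cycSucc l) := by
      intro l hl
      by_contra! h
      exact huv (hε.minor_eq_zero hu hn hxy hl h.1.1 h.1.2 h.2.1 h.2.2)
    have kj := key j hj
    have kj' := key _ hj'
    have kk := key k hk
    clear key hj hj' hk huv hs hY hxy
    grind
  have hanti : ∀ u v, p u v = -p v u := fun u v => by simp only [hp']; ring
  set c := cycSucc j with hc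
  have hexp : ∀ C D, br (comb Z x) (comb Z y) C D =
      p c k * br (Z c) (Z k) C D + p c (cycSucc k) * br (Z c) (Z (cycSucc k)) C D := by
    intro C D
    have h2 := two_mul_br_comb (Z := Z) x y C D
    have hz : ∀ u v, ¬ ((u = c ∧ (v = k ∨ v = cycSucc k)) ∨ (v = c ∧ (u = k ∨ u = cycSucc k))) →
        (x u * y v - x v * y u) * br (Z u) (Z v) C D = 0 := by
      intro u v h
      have : p u v = 0 := by by_contra h'; exact h (hp0 u v h')
      simp only [hp'] at this
      rw [this, zero_mul]
    have hrow_c : ∑ v, (x c * y v - x v * y c) * br (Z c) (Z v) C D =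
        p c k * br (Z c) (Z k) C D + p c (cycSucc k) * br (Z c) (Z (cycSucc k)) C D := by
      rw [Fintype.sum_eq_add k (cycSucc k) nk.symm]
      intro v hv
      apply hz
      grind
    have hrow : ∀ u, u = k ∨ u = cycSucc k →
        ∑ v, (x u * y v - x v * y u) * br (Z u) (Z v) C D = p c u * br (Z c) (Z u) C D := by
      intro u hu'
      rw [Fintype.sum_eq_single c]
      · rw [br_swap₁₂]; simp only [hp']; ring
      · intro v hv
        apply hz
        grind
    have htot : ∑ u, ∑ v, (x u * y v - x v * y u) * br (Z u) (Z v) C D =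
        ∑ u ∈ {c, k, cycSucc k}, ∑ v, (x u * y v - x v * y u) * br (Z u) (Z v) C D := by
      symm
      apply Finset.sum_subset (Finset.subset_univ _)
      intro u _ hu'
      simp only [Finset.mem_insert, Finset.mem_singleton, not_or] at hu'
      apply Finset.sum_eq_zero
      intro v _
      apply hz
      grind
    rw [htot, Finset.sum_insert (by simp [e3, e4]), Finset.sum_pair nk.symm, hrow_c,
      hrow k (Or.inl rfl), hrow _ (Or.inr rfl)] at h2
    linarith
  have hT := hexp (Z j) (Z (cycSucc c))
  rw [hpl] at hT
  have hb := hε.adjacent_pos (u := c) (v := j) (w := cycSucc c) (k := k) n1 n3.symm n2.symm e3 e4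
    e1 e2 e5 e6
  have hsgn : 0 ≤ edgeSign k * p c k * p c (cycSucc k) := by
    have hv := cycSucc_val k
    have hk' := k.isLt
    have hc' := c.isLt
    rw [Ne, Fin.ext_iff] at e3 e4
    unfold edgeSign
    split_ifs at hv ⊢ with hl
    · have h1 := hxy c k (by rw [Fin.lt_def]; omega)
      have h2 := hxy (cycSucc k) c (by rw [Fin.lt_def]; omega)
      have := hanti c (cycSucc k)
      simp only [hp'] at this ⊢
      rw [this]
      nlinarith [mul_nonneg h1 h2]
    · rcases lt_or_ge (c : ℕ) k with h | h
      · have h1 := hxy c k (by rw [Fin.lt_def]; omega)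
        have h2 := hxy c (cycSucc k) (by rw [Fin.lt_def]; omega)
        simp only [hp']
        nlinarith [mul_nonneg h1 h2]
      · have h1 := hxy k c (by rw [Fin.lt_def]; omega)
        have h2 := hxy (cycSucc k) c (by rw [Fin.lt_def]; omega)
        simp only [hp']
        nlinarith [mul_nonneg h1 h2]
  have s1 : ∀ w, br (Z c) w (Z j) (Z (cycSucc c)) = br (Z c) (Z j) (Z (cycSucc c)) w := fun w => by
    rw [br_swap₂₃, br_swap₃₄, neg_neg]
  rw [s1, s1] at hT
  set b1 := br (Z c) (Z j) (Z (cycSucc c)) (Z k)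
  set b2 := br (Z c) (Z j) (Z (cycSucc c)) (Z (cycSucc k))
  have hb1 : b1 ≠ 0 := by intro h0; simp [h0] at hb
  have hb2 : b2 ≠ 0 := by intro h0; simp [h0] at hb
  have hprod : 0 ≤ (p c k * b1) * (p c (cycSucc k) * b2) := by
    have := mul_nonneg hsgn hb.le
    have e := edgeSign_mul_self k
    have : 0 ≤ (edgeSign k * edgeSign k) * ((p c k * b1) * (p c (cycSucc k) * b2)) := by linarith
    rwa [e, one_mul] at this
  have hz1 : p c k * b1 = 0 := by nlinarith
  have hz2 : p c (cycSucc k) * b2 = 0 := by nlinarith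
  have hp1 : p c k = 0 := (mul_eq_zero.1 hz1).resolve_right hb1
  have hp2 : p c (cycSucc k) = 0 := (mul_eq_zero.1 hz2).resolve_right hb2
  obtain ⟨C, D, hne⟩ := exists_br_ne_zero (Y.indep_of_span hs)
  apply hne
  rw [hexp, hp1, hp2]; ring

theorem vertexLine_mem_amplituhedron (hn : 4 ≤ n) {i j : Fin n} (hu : Uniform Z) (hij : i < j) :
    ∃ Y ∈ amplituhedron Z, Y.complexify.space = Submodule.span ℂ {zc Z i, zc Z j} := by
  obtain ⟨k, l, h1, h2, h3, h4, h5⟩ := exists_two_others hn i j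
  have hli := indep_of_br_ne_zero (hu i j k l hij.ne h2 h3 h4 h5 h1)
  refine ⟨mkGr _ _ hli, mem_amplituhedron.2 ⟨Pi.single i 1, Pi.single j 1, ?_, ?_⟩,
    complexify_space rfl⟩
  · intro u v huv
    simp only [Pi.single_apply]
    rw [Fin.lt_def] at hij huv
    simp only [Fin.ext_iff]
    split_ifs <;> first | omega | norm_num
  · have : ∀ i, comb Z (Pi.single i 1) = Z i := fun i => by
      rw [comb, Finset.sum_eq_single i (fun j _ hj => by simp [hj]) (by simp)]
      simp
    rw [this, this]; rfl

/-- The line through two vertices is the image of the row span of two unit vectors, whose minors are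
0 or 1 in the right order. -/
theorem IsRegular.not_disjoint (hu : Uniform Z) (hn : 4 ≤ n) {M : Set (Gr ℂ 2 4)}
    (hM : IsRegular Z M) : ¬ Disjoint M (Gr.complexify '' amplituhedron Z) := by
  obtain ⟨x, y, hxy, V, hV, hx, hy⟩ := hM.vertexLine
  rw [Set.not_disjoint_iff]
  refine ⟨V, hV, ?_⟩
  have hVs := hu.space_eq hn hxy hx hy
  rcases lt_or_gt_of_ne hxy with h | h
  · obtain ⟨Y, hY, hs⟩ := vertexLine_mem_amplituhedron hn hu h
    exact ⟨Y, hY, Gr.ext (hs.trans hVs.symm)⟩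
  · obtain ⟨Y, hY, hs⟩ := vertexLine_mem_amplituhedron hn hu h
    exact ⟨Y, hY, Gr.ext (by rw [hs, hVs, Set.pair_comm])⟩

end Real

/-! ### Sign flips and the Euclidean boundary -/

section Boundary

variable {n : ℕ} {Z : Matrix (Fin n) (Fin 4) ℝ}

theorem comb_single (i : Fin n) (c : ℝ) : comb Z (Pi.single i c) = c • Z i := by
  rw [comb, Finset.sum_eq_single i (fun j _ hj => by simp [hj]) (by simp)]
  simp

theorem comb_add (x y : Fin n → ℝ) : comb Z (x + y) = comb Z x + comb Z y := by
  simp only [← vecMulLinear_eq_comb, map_add]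

theorem comb_smul (c : ℝ) (x : Fin n → ℝ) : comb Z (c • x) = c • comb Z x := by
  simp only [← vecMulLinear_eq_comb, map_smul]

/-- The three-term relation in the plane obtained by projecting from the line `A B`. -/
theorem three_term_mem {K : Type} [Field K] (A B u v w : Fin 4 → K) :
    br A B u v • w + br A B v w • u + br A B w u • v ∈ Submodule.span K {A, B} := by
  have := cramer A B u v w
  rw [Submodule.mem_span_pair]
  refine ⟨br w B u v, br A w u v, ?_⟩
  rw [this, br_swap₃₄ A B u w, br_swap₃₄ A B w v]
  module

theorem plucker_relation {K : Type} [Field K] (A B u v w t : Fin 4 → K) :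
    br A B u v * br A B w t + br A B v w * br A B u t + br A B w u * br A B v t = 0 := by
  obtain ⟨a, b, h⟩ := Submodule.mem_span_pair.1 (three_term_mem A B u v w)
  have := congrArg (fun x => br A B x t) h
  simp only [br_add₃, br_smul₃, br_same₁₃, br_same₂₃] at this
  linear_combination -this

/-- The sign conditions that cut out the interior of the amplituhedron. -/
def SignCondition (Z : Matrix (Fin n) (Fin 4) ℝ) (z o : Fin n) (A B : Fin 4 → ℝ) : Prop :=
  (∀ k, 0 < br A B (Z z) (Z o) * (edgeSign k * br A B (Z k) (Z (cycSucc k)))) ∧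
    ∃ j, br A B (Z z) (Z o) * br A B (Z z) (Z j) < 0

/-- Used with `z` the first index: away from `z` both rows are nonnegative and `hab` removes every
product that would enter a minor negatively; the entry of `b` at `z` has the sign needed for the
minors through `z`. -/
theorem nonnegMinors_of_signs {a b : Fin n → ℝ} {z : Fin n} (hz : ∀ u, z ≤ u)
    (ha : ∀ u, 0 ≤ a u) (hbz : b z ≤ 0) (hb : ∀ u, u ≠ z → 0 ≤ b u)
    (hab : ∀ u v, u ≠ z → u < v → a v * b u = 0) : NonnegMinors a b := by
  intro u v huv
  have hv : v ≠ z := (lt_of_le_of_lt (hz u) huv).ne'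
  have h1 := mul_nonneg (ha u) (hb v hv)
  by_cases hu : u = z
  · subst hu
    have := mul_nonneg (ha v) (neg_nonneg.2 hbz)
    linarith
  · linarith [hab u v hu huv]

/-- The sequence f j = s⟨AB z j⟩ is positive right after `z` and at the last index, the latter
because of the twisted closing edge, and negative somewhere between. The descent into the first
negative index and the ascent out of the last one each give a three-term relation, that is, a vector
of the line with coefficients of controlled sign. These two vectors are the rows of the required
matrix. -/
theorem SignCondition.mem_amplituhedron (hu : Uniform Z) (hn : 4 ≤ n) {ε : ℝ}
    (hε : OrderedSign Z ε) {A B : Fin 4 → ℝ} {z o : Fin n} (hz : (z : ℕ) = 0) (ho : (o : ℕ) = 1)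
    (h : SignCondition Z z o A B) {Y : Gr ℝ 2 4} (hY : Y.space = Submodule.span ℝ {A, B}) :
    Y ∈ amplituhedron Z := by
  obtain ⟨hedge, j₀, hj₀⟩ := h
  set s := br A B (Z z) (Z o) with hs
  set f : Fin n → ℝ := fun j => s * br A B (Z z) (Z j) with hf
  have hz0 : f z = 0 := by simp [hf]
  have hstep : ∀ k k' : Fin n, (k' : ℕ) = k + 1 → 0 < s * br A B (Z k) (Z k') := by
    intro k k' hk
    have hv := cycSucc_val k
    have hlt := k'.isLt
    rw [if_neg (by omega)] at hv
    have hk' : cycSucc k = k' := Fin.ext (by omega)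
    have := hedge k
    rwa [hk', edgeSign, if_neg (by omega), one_mul] at this
  have ho0 : 0 < f o := hstep z o (by omega)
  have hlast : ∀ l : Fin n, (l : ℕ) + 1 = n → 0 < f l := by
    intro l hl
    have hv := cycSucc_val l
    rw [if_pos hl] at hv
    have hl' : cycSucc l = z := Fin.ext (by omega)
    have := hedge l
    rw [hl', edgeSign, if_pos hl, br_swap₃₄] at this
    simp only [hf]
    linarith
  set N : Finset (Fin n) := Finset.univ.filter fun j => f j < 0 with hN
  have hNe : N.Nonempty := ⟨j₀, by simpa [hN, hf] using hj₀⟩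
  set m := N.min' hNe with hm
  set j := N.max' hNe with hj
  have hmN : f m < 0 := (Finset.mem_filter.1 (N.min'_mem hNe)).2
  have hjN : f j < 0 := (Finset.mem_filter.1 (N.max'_mem hNe)).2
  have hmj : m ≤ j := N.min'_le _ (N.max'_mem hNe)
  have hm2 : 2 ≤ (m : ℕ) := by
    by_contra hlt
    rcases (by omega : (m : ℕ) = 0 ∨ (m : ℕ) = 1) with h0 | h0
    · rw [show m = z from Fin.ext (by omega), hz0] at hmN; exact lt_irrefl _ hmN
    · rw [show m = o from Fin.ext (by omega)] at hmN; exact hmN.not_gt ho0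
  have hjlt : (j : ℕ) + 1 < n := by
    have := j.isLt
    by_contra hge
    exact hjN.not_gt (hlast j (by omega))
  set i : Fin n := ⟨m - 1, by omega⟩ with hi
  set j' : Fin n := ⟨j + 1, hjlt⟩ with hj'
  have hi0 : 0 ≤ f i := by
    by_contra! hlt
    have := N.min'_le i (by simp [hN, hlt])
    rw [← hm, Fin.le_def] at this
    simp only [hi] at this
    omega
  have hj0 : 0 ≤ f j' := by
    by_contra! hlt
    have := N.le_max' j' (by simp [hN, hlt])
    rw [← hj, Fin.le_def] at this
    simp only [hj'] at this
    omega
  have him : 0 < s * br A B (Z i) (Z m) := hstep i m (by simp only [hi]; omega)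
  have hjj : 0 < s * br A B (Z j) (Z j') := hstep j j' rfl
  -- The coefficients of the three-term relations for (z, i, m) and (z, j, j'), normalised by `s`.
  -- Since i < m ≤ j < j', away from `z` the support of `a` does not pass that of `b`.
  set a : Fin n → ℝ := Pi.single z (s * br A B (Z i) (Z m)) + Pi.single i (-f m) +
    Pi.single m (f i) with ha
  set b : Fin n → ℝ := Pi.single z (-(s * br A B (Z j) (Z j'))) + Pi.single j (f j') +
    Pi.single j' (-f j) with hb
  have hzi : z ≠ i := fun e => by have := congrArg Fin.val e; simp only [hi] at this; omega
  have hzm : z ≠ m := fun e => by have := congrArg Fin.val e; omega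
  have hzj : z ≠ j := fun e => by have := congrArg Fin.val e; rw [Fin.le_def] at hmj; omega
  have hzj' : z ≠ j' := fun e => by have := congrArg Fin.val e; simp only [hj'] at this; omega
  have hpos : NonnegMinors a b := by
    have single_nonneg : ∀ (k u : Fin n) (c : ℝ), 0 ≤ c → 0 ≤ (Pi.single k c : Fin n → ℝ) u :=
      fun k u c hc => by
        rw [Pi.single_apply]; split_ifs <;> [exact hc; exact le_rfl]
    refine nonnegMinors_of_signs (z := z) (fun u => by rw [Fin.le_def]; omega) ?_ ?_ ?_ ?_
    · intro u
      have h1 := single_nonneg z u _ him.le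
      have h2 := single_nonneg i u (-f m) (by linarith)
      have h3 := single_nonneg m u _ hi0
      simp only [ha, Pi.add_apply]
      linarith
    · simp only [hb, Pi.add_apply, Pi.single_eq_same, Pi.single_eq_of_ne hzj,
        Pi.single_eq_of_ne hzj']
      linarith
    · intro u hu
      have h2 := single_nonneg j u _ hj0
      have h3 := single_nonneg j' u (-f j) (by linarith)
      simp only [hb, Pi.add_apply, Pi.single_eq_of_ne hu]
      linarith
    · intro u v hu huv
      have hv : v ≠ z := by
        intro e; rw [Fin.lt_def] at huv; subst e; omega
      simp only [ha, hb, Pi.add_apply, Pi.single_eq_of_ne hu, Pi.single_eq_of_ne hv]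
      rw [Fin.lt_def] at huv
      rw [Fin.le_def] at hmj
      by_cases hv1 : v = i ∨ v = m
      · have hu1 : u ≠ j := by
          rintro rfl
          rcases hv1 with rfl | rfl
          · simp only [hi] at huv; omega
          · omega
        have hu2 : u ≠ j' := by
          rintro rfl
          rcases hv1 with rfl | rfl
          · simp only [hi, hj'] at huv; omega
          · simp only [hj'] at huv; omega
        simp [Pi.single_eq_of_ne hu1, Pi.single_eq_of_ne hu2]
      · push Not at hv1
        simp [Pi.single_eq_of_ne hv1.1, Pi.single_eq_of_ne hv1.2]
  have hamem : comb Z a ∈ Y.space := by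
    have : comb Z a = s • (br A B (Z i) (Z m) • Z z + br A B (Z m) (Z z) • Z i +
        br A B (Z z) (Z i) • Z m) := by
      simp only [ha, comb_add, comb_single, hf]
      rw [br_swap₃₄ A B (Z z) (Z m)]
      module
    rw [this, hY]
    exact Submodule.smul_mem _ _ (three_term_mem A B (Z i) (Z m) (Z z))
  have hbmem : comb Z b ∈ Y.space := by
    have : comb Z b = (-s) • (br A B (Z j) (Z j') • Z z + br A B (Z j') (Z z) • Z j +
        br A B (Z z) (Z j) • Z j') := by
      simp only [hb, comb_add, comb_single, hf]
      rw [br_swap₃₄ A B (Z z) (Z j')]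
      module
    rw [this, hY]
    exact Submodule.smul_mem _ _ (three_term_mem A B (Z j) (Z j') (Z z))
  refine TreeAmplituhedron.mem_amplituhedron.2 ⟨a, b, hpos, Y.eq_span_of_mem hamem hbmem ?_⟩
  have hov := cycSucc_val o
  rw [if_neg (by omega)] at hov
  have hmj' : (m : ℕ) ≤ j := hmj
  have hj'v : (j' : ℕ) = j + 1 := rfl
  apply indep_of_br_ne_zero (C := Z o) (D := Z (cycSucc o))
  intro h0
  -- The minor at z, j' is strictly positive, and both indices avoid the edge starting at `o`; so
  -- the bracket with that edge cannot vanish and the two combinations are independent.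
  have := hε.minor_eq_zero hu hn hpos h0 (i := z) (j := j')
    (fun e => by have := congrArg Fin.val e; omega) (fun e => by have := congrArg Fin.val e; omega)
    (fun e => by have := congrArg Fin.val e; omega) (fun e => by have := congrArg Fin.val e; omega)
  have hij' : i ≠ j' := fun e => by
    have := congrArg Fin.val e
    simp only [hi, hj'] at this; omega
  have hmj'' : m ≠ j' := fun e => by
    have := congrArg Fin.val e
    simp only [hj'] at this; omega
  have hjj'' : j ≠ j' := fun e => by
    have := congrArg Fin.val e
    simp only [hj'] at this; omega
  simp only [ha, hb, Pi.add_apply, Pi.single_eq_same, Pi.single_eq_of_ne hzi,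
    Pi.single_eq_of_ne hzm, Pi.single_eq_of_ne hzj, Pi.single_eq_of_ne hzj',
    Pi.single_eq_of_ne hzj'.symm, Pi.single_eq_of_ne hij'.symm, Pi.single_eq_of_ne hmj''.symm,
    Pi.single_eq_of_ne hjj''.symm] at this
  nlinarith [mul_pos him (neg_pos.2 hjN)]

/-- The edge signs come from Cauchy–Binet. For the negative entry, suppose that all s⟨AB z j⟩ are
nonnegative. With `a` the first nonzero column, p_j = x_a y_j - x_j y_a is nonnegative and ∑ p_j Z_j
lies on the line. Bracketing with Z_z leaves p_j only where ⟨AB z j⟩ = 0, and bracketing with Z_o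
removes those too, so A and B would be dependent. -/
theorem signCondition_of_mem (hn : 4 ≤ n) {ε : ℝ} (hε : OrderedSign Z ε) {x y : Fin n → ℝ}
    (hxy : NonnegMinors x y) (hli : LinearIndependent ℝ ![comb Z x, comb Z y]) {z o : Fin n}
    (hz : (z : ℕ) = 0) (ho : (o : ℕ) = 1)
    (hne : ∀ k, br (comb Z x) (comb Z y) (Z k) (Z (cycSucc k)) ≠ 0) :
    SignCondition Z z o (comb Z x) (comb Z y) := by
  have hε0 : ε ≠ 0 := by
    rintro rfl
    have := hε ⟨0, by omega⟩ ⟨1, by omega⟩ ⟨2, by omega⟩ ⟨3, by omega⟩ (by simp [Fin.lt_def])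
      (by simp [Fin.lt_def]) (by simp [Fin.lt_def])
    simp at this
  set A := comb Z x with hA
  set B := comb Z y with hB
  have hpos : ∀ k, 0 < ε * edgeSign k * br A B (Z k) (Z (cycSucc k)) := fun k =>
    lt_of_le_of_ne (hε.br_comb_nonneg hxy k)
      (mul_ne_zero (mul_ne_zero hε0 (edgeSign_ne_zero k)) (hne k)).symm
  have hzv := cycSucc_val z
  rw [if_neg (by omega)] at hzv
  have hzo : cycSucc z = o := Fin.ext (by omega)
  have hε2 : 0 < ε * ε := mul_self_pos.2 hε0
  have hedge : ∀ k, 0 < br A B (Z z) (Z o) * (edgeSign k * br A B (Z k) (Z (cycSucc k))) := by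
    intro k
    have h1 := hpos z
    rw [hzo, edgeSign, if_neg (by omega), mul_one] at h1
    have h2 := mul_pos h1 (hpos k)
    have h3 : 0 < (ε * ε) *
      (br A B (Z z) (Z o) * (edgeSign k * br A B (Z k) (Z (cycSucc k)))) := by linarith
    exact (mul_pos_iff_of_pos_left hε2).1 h3
  refine ⟨hedge, ?_⟩
  by_contra! hnn
  set s := br A B (Z z) (Z o) with hs
  have hs2 : 0 < s * s := by
    have := hedge z
    rwa [hzo, edgeSign, if_neg (by omega), one_mul] at this
  have hs0 : s ≠ 0 := by rintro h; simp [h] at hs2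
  -- the first nonzero column
  have hex : (Finset.univ.filter fun j : Fin n => x j ≠ 0 ∨ y j ≠ 0).Nonempty := by
    by_contra hemp
    rw [Finset.not_nonempty_iff_eq_empty, Finset.filter_eq_empty_iff] at hemp
    have hx0 : ∀ j, x j = 0 := fun j => by
      have := hemp (Finset.mem_univ j); push Not at this; exact this.1
    have : A = 0 := by simp [hA, comb, hx0]
    exact hli.ne_zero 0 this
  set a := Finset.min' _ hex with ha
  have haN : x a ≠ 0 ∨ y a ≠ 0 := (Finset.mem_filter.1 (Finset.min'_mem _ hex)).2
  have hlt : ∀ j, j < a → x j = 0 ∧ y j = 0 := by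
    intro j hj
    by_contra hne'
    have := Finset.min'_le (Finset.univ.filter fun j : Fin n => x j ≠ 0 ∨ y j ≠ 0) j
      (by simp only [Finset.mem_filter, Finset.mem_univ, true_and]; tauto)
    exact absurd hj this.not_gt
  have hp : ∀ j, 0 ≤ x a * y j - x j * y a := by
    intro j
    rcases lt_trichotomy j a with h | h | h
    · simp [hlt j h]
    · rw [h]; linarith
    · exact hxy a j h
  have hsum : ∀ C, ∑ j, (x a * y j - x j * y a) * br (Z j) A B C = 0 := by
    intro C
    have h1 := br_comb_left (Z := Z) x A B C
    have h2 := br_comb_left (Z := Z) y A B C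
    rw [← hA, br_same₁₂] at h1
    rw [← hB, br_same₁₃] at h2
    have : ∑ j, (x a * y j - x j * y a) * br (Z j) A B C =
        x a * ∑ j, y j * br (Z j) A B C - y a * ∑ j, x j * br (Z j) A B C := by
      rw [Finset.mul_sum, Finset.mul_sum, ← Finset.sum_sub_distrib]
      exact Finset.sum_congr rfl fun j _ => by ring
    rw [this, ← h1, ← h2]; ring
  have hrot : ∀ j C, br (Z j) A B C = br A B (Z j) C := fun j C => by
    rw [br_swap₁₂, br_swap₂₃, neg_neg]
  have h1 : ∀ j, (x a * y j - x j * y a) * (s * br A B (Z z) (Z j)) = 0 := by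
    have := hsum (Z z)
    have h' : ∑ j, (x a * y j - x j * y a) * (s * br A B (Z z) (Z j)) = 0 := by
      rw [← mul_zero (-s), ← this, Finset.mul_sum]
      refine Finset.sum_congr rfl fun j _ => ?_
      rw [hrot, br_swap₃₄]; ring
    rw [Finset.sum_eq_zero_iff_of_nonneg fun j _ => mul_nonneg (hp j) (hnn j)] at h'
    exact fun j => h' j (Finset.mem_univ _)
  -- The Plücker relation for z, o, j, j+1 loses one term here and transfers the sign of ⟨AB j(j+1)⟩
  -- to ⟨AB j o⟩. The last index is excluded since the closing bracket is nonzero.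
  have h2 : ∀ j, br A B (Z z) (Z j) = 0 → 0 < s * br A B (Z j) (Z o) := by
    intro j hj0
    by_cases hjz : j = z
    · subst hjz; exact hs2
    have hjv := cycSucc_val j
    have hjlt := j.isLt
    split_ifs at hjv with hl
    · exfalso
      apply hne j
      rw [show cycSucc j = z from Fin.ext (by omega), br_swap₃₄, hj0, neg_zero]
    · have hrel := plucker_relation A B (Z z) (Z o) (Z j) (Z (cycSucc j))
      rw [br_swap₃₄ A B (Z z) (Z j), hj0] at hrel
      have h3 := hedge j
      rw [edgeSign, if_neg hl, one_mul] at h3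
      have h4 := hnn (cycSucc j)
      rw [br_swap₃₄ A B (Z j) (Z o)] at hrel
      have h5 : (s * br A B (Z j) (Z o)) * (s * br A B (Z z) (Z (cycSucc j))) =
          (s * s) * (s * br A B (Z j) (Z (cycSucc j))) := by
        linear_combination (-s * s) * hrel
      have h6 : 0 < (s * br A B (Z j) (Z o)) * (s * br A B (Z z) (Z (cycSucc j))) := by
        rw [h5]; exact mul_pos hs2 h3
      exact pos_of_mul_pos_left h6 h4
  have h3 : ∀ j, x a * y j - x j * y a = 0 := by
    have := hsum (Z o)
    have hnonneg : ∀ j, 0 ≤ (x a * y j - x j * y a) * (s * br A B (Z j) (Z o)) := by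
      intro j
      rcases mul_eq_zero.1 (h1 j) with h | h
      · rw [h, zero_mul]
      · exact mul_nonneg (hp j) (h2 j ((mul_eq_zero.1 h).resolve_left hs0)).le
    have h' : ∑ j, (x a * y j - x j * y a) * (s * br A B (Z j) (Z o)) = 0 := by
      rw [← mul_zero s, ← this, Finset.mul_sum]
      refine Finset.sum_congr rfl fun j _ => ?_
      rw [hrot]; ring
    rw [Finset.sum_eq_zero_iff_of_nonneg fun j _ => hnonneg j] at h'
    intro j
    rcases mul_eq_zero.1 (h1 j) with h | h
    · exact h
    · have := h2 j ((mul_eq_zero.1 h).resolve_left hs0)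
      exact (mul_eq_zero.1 (h' j (Finset.mem_univ _))).resolve_right this.ne'
  have hdep := (pair_indep_iff A B).1 hli (-y a) (x a) (by
    rw [hA, hB, ← comb_smul, ← comb_smul, ← comb_add]
    have : (-y a) • x + x a • y = 0 := by
      funext j
      simp only [Pi.add_apply, Pi.smul_apply, smul_eq_mul, Pi.zero_apply]
      linear_combination h3 j
    rw [this]; simp [comb])
  rcases haN with h | h
  · exact h hdep.2
  · exact h (neg_eq_zero.1 hdep.1)

theorem SignCondition.of_comb {A B : Fin 4 → ℝ} {z o : Fin n} (h : SignCondition Z z o A B)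
    {a b c d : ℝ} (hd : a * d - b * c ≠ 0) :
    SignCondition Z z o (a • A + b • B) (c • A + d • B) := by
  have h2 : 0 < (a * d - b * c) * (a * d - b * c) := mul_self_pos.2 hd
  obtain ⟨h1, j, hj⟩ := h
  refine ⟨fun k => ?_, j, ?_⟩
  · rw [br_comb, br_comb]
    have := mul_pos h2 (h1 k)
    linarith
  · rw [br_comb, br_comb]
    have := mul_neg_of_pos_of_neg h2 hj
    linarith

theorem continuous_br {X : Type*} [TopologicalSpace X] {a b c d : X → Fin 4 → ℝ}
    (ha : Continuous a) (hb : Continuous b) (hc : Continuous c) (hd : Continuous d) :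
    Continuous fun x => br (a x) (b x) (c x) (d x) := by
  simp only [br_eq]
  fun_prop

theorem rowSpan_space (X : Matrix (Fin 2) (Fin 4) ℝ) (hX : LinearIndependent ℝ X.row) :
    (Gr.rowSpan X hX).space = Submodule.span ℝ {X 0, X 1} := by
  change Submodule.span ℝ (Set.range X.row) = _
  rw [← range_pair]
  congr 2
  funext i; fin_cases i <;> rfl

/-- A change of basis multiplies products of two brackets by the square of its determinant, so the
condition depends on the line only. It is given by strict inequalities, hence open. -/
theorem SignCondition.mem_interior (hu : Uniform Z) (hn : 4 ≤ n) {ε : ℝ}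
    (hε : OrderedSign Z ε) {A B : Fin 4 → ℝ} {z o : Fin n} (hz : (z : ℕ) = 0) (ho : (o : ℕ) = 1)
    (h : SignCondition Z z o A B) {Y : Gr ℝ 2 4} (hY : Y.space = Submodule.span ℝ {A, B}) :
    Y ∈ interior (amplituhedron Z) := by
  rw [_root_.mem_interior]
  have hinv : ∀ (W : Gr ℝ 2 4) (A B A' B' : Fin 4 → ℝ), W.space = Submodule.span ℝ {A, B} →
      W.space = Submodule.span ℝ {A', B'} → SignCondition Z z o A B →
      SignCondition Z z o A' B' := by
    intro W A B A' B' hW hW' h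
    obtain ⟨a, b, c, d, hd, rfl, rfl⟩ := W.exists_comb hW hW'
    exact h.of_comb hd
  refine ⟨{W | ∀ A B, W.space = Submodule.span ℝ {A, B} → SignCondition Z z o A B}, ?_, ?_, ?_⟩
  · intro W hW
    obtain ⟨A', B', -, hW'⟩ := W.exists_basis
    exact (hW A' B' hW').mem_amplituhedron hu hn hε hz ho hW'
  · rw [isOpen_coinduced]
    have : ((fun X : {X : Matrix (Fin 2) (Fin 4) ℝ // LinearIndependent ℝ X.row} =>
        Gr.rowSpan X.1 X.2) ⁻¹'
        {W | ∀ A B, W.space = Submodule.span ℝ {A, B} → SignCondition Z z o A B}) =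
        {X | SignCondition Z z o (X.1 0) (X.1 1)} := by
      ext X
      constructor
      · intro h
        exact h _ _ (rowSpan_space X.1 X.2)
      · intro h A' B' h'
        exact hinv _ _ _ _ _ (rowSpan_space X.1 X.2) h' h
    rw [this]
    have hc : ∀ C D : Fin 4 → ℝ, Continuous fun X : {X : Matrix (Fin 2) (Fin 4) ℝ //
        LinearIndependent ℝ X.row} => br (X.1 0) (X.1 1) C D := fun C D =>
      continuous_br ((continuous_apply 0).comp continuous_subtype_val)
        ((continuous_apply 1).comp continuous_subtype_val) continuous_const continuous_const
    simp only [SignCondition, Set.ofPred_and, Set.ofPred_forall, Set.ofPred_exists]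
    refine IsOpen.inter (isOpen_iInter_of_finite fun k => ?_) (isOpen_iUnion fun j => ?_)
    · exact isOpen_lt continuous_const ((hc _ _).mul (continuous_const.mul (hc _ _)))
    · exact isOpen_lt ((hc _ _).mul (hc _ _)) continuous_const
  · intro A' B' h'
    exact hinv _ _ _ _ _ hY h' h

/-- A boundary point of the amplituhedron meets an edge. -/
theorem exists_line_of_boundary (hu : Uniform Z) (hn : 4 ≤ n) {ε : ℝ} (hε : OrderedSign Z ε)
    {Y : Gr ℝ 2 4} (hY : Y ∈ amplituhedron Z) (hY' : Y ∉ interior (amplituhedron Z)) :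
    ∃ k, Y.complexify ∈ lineCondition Z k := by
  obtain ⟨x, y, hxy, hs⟩ := mem_amplituhedron.1 hY
  by_contra! h
  simp only [complexify_mem_line hu hn hs] at h
  exact hY' ((signCondition_of_mem hn hε hxy (Y.indep_of_span hs) (z := ⟨0, by omega⟩)
    (o := ⟨1, by omega⟩) rfl rfl h).mem_interior hu hn hε rfl rfl hs)

/-- A point of the amplituhedron at which an edge bracket changes sign is a boundary point. -/
theorem notMem_interior (hn : 4 ≤ n) {ε : ℝ} (hε : OrderedSign Z ε) {P B D : Fin 4 → ℝ}
    {Y : Gr ℝ 2 4} (hY : Y.space = Submodule.span ℝ {P, B}) {i j : Fin n}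
    (h₀ : br P B (Z i) (Z (cycSucc i)) = 0) (hj : br P B (Z j) (Z (cycSucc j)) ≠ 0)
    (hD : br D B (Z i) (Z (cycSucc i)) ≠ 0) : Y ∉ interior (amplituhedron Z) := by
  have hε0 : ε ≠ 0 := by
    rintro rfl
    have := hε ⟨0, by omega⟩ ⟨1, by omega⟩ ⟨2, by omega⟩ ⟨3, by omega⟩ (by simp [Fin.lt_def])
      (by simp [Fin.lt_def]) (by simp [Fin.lt_def])
    simp at this
  intro hint
  set M : ℝ → Matrix (Fin 2) (Fin 4) ℝ := fun t => Matrix.of ![P + t • D, B] with hM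
  have hMc : Continuous M := by
    refine continuous_matrix fun a b => ?_
    fin_cases a <;> simp [hM] <;> fun_prop
  have hopen : IsOpen ((fun X : {X : Matrix (Fin 2) (Fin 4) ℝ // LinearIndependent ℝ X.row} =>
        Gr.rowSpan X.1 X.2) ⁻¹' interior (amplituhedron Z)) := by
    have := isOpen_interior (s := amplituhedron Z)
    rwa [isOpen_coinduced] at this
  obtain ⟨O, hO, hOe⟩ := isOpen_induced_iff.1 hopen
  have hP0 : M 0 ∈ O := by
    have hli : LinearIndependent ℝ (M 0).row := by
      have := Y.indep_of_span hY
      have e : (M 0).row = ![P, B] := by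
        funext a; fin_cases a <;> simp [hM, Matrix.row] <;> rfl
      rwa [e]
    have : (⟨M 0, hli⟩ : {X : Matrix (Fin 2) (Fin 4) ℝ // LinearIndependent ℝ X.row}) ∈
        Subtype.val ⁻¹' O := by
      rw [hOe]
      change Gr.rowSpan (M 0) hli ∈ interior (amplituhedron Z)
      have : Gr.rowSpan (M 0) hli = Y := by
        ext1
        rw [rowSpan_space, hY]
        simp [hM]
        rfl
      rwa [this]
    exact this
  have hev1 : ∀ᶠ t in nhds (0 : ℝ), M t ∈ O := hMc.continuousAt.eventually_mem (hO.mem_nhds hP0)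
  set g : ℝ → ℝ := fun t => br (P + t • D) B (Z j) (Z (cycSucc j)) with hg
  have hgc : Continuous g := continuous_br (by fun_prop) continuous_const continuous_const
    continuous_const
  have hev2 : ∀ᶠ t in nhds (0 : ℝ), 0 < g t * g 0 := by
    have h1 : 0 < g 0 * g 0 := by
      have : g 0 ≠ 0 := by simpa [hg] using hj
      exact mul_self_pos.2 this
    exact ((hgc.mul continuous_const).continuousAt).eventually (lt_mem_nhds h1)
  -- Inside the amplituhedron the twisted brackets at `i` and `j` have the same weak sign. Along the
  -- path the bracket at `i` is a nonzero multiple of t while the bracket at `j` keeps its sign, so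
  -- t and -t contradict each other.
  have key : ∀ t, M t ∈ O → 0 < g t * g 0 →
      0 ≤ (edgeSign i * (t * br D B (Z i) (Z (cycSucc i)))) * (edgeSign j * g t) := by
    intro t ht hgt
    have hgt0 : g t ≠ 0 := by intro h; simp [h] at hgt
    have hli' := indep_of_br_ne_zero hgt0
    have hrow : (M t).row = ![P + t • D, B] := by
      funext a; fin_cases a <;> simp [hM, Matrix.row] <;> rfl
    have hli : LinearIndependent ℝ (M t).row := by rwa [hrow]
    have hmem : (⟨M t, hli⟩ : {X : Matrix (Fin 2) (Fin 4) ℝ // LinearIndependent ℝ X.row}) ∈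
        Subtype.val ⁻¹' O := ht
    rw [hOe] at hmem
    have hA : Gr.rowSpan (M t) hli ∈ amplituhedron Z := interior_subset hmem
    obtain ⟨x, y, hxy, hs⟩ := mem_amplituhedron.1 hA
    obtain ⟨a, b, c, d, -, h1, h2⟩ := (Gr.rowSpan (M t) hli).exists_comb hs
      (A' := P + t • D) (B' := B) (by rw [rowSpan_space]; rfl)
    have e1 := hε.br_comb_nonneg hxy i
    have e2 := hε.br_comb_nonneg hxy j
    have f1 : br (P + t • D) B (Z i) (Z (cycSucc i)) = t * br D B (Z i) (Z (cycSucc i)) := by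
      rw [br_add₁, br_smul₁, h₀, zero_add]
    have f2 : g t = br (P + t • D) B (Z j) (Z (cycSucc j)) := rfl
    rw [← f1, f2, h1, h2, br_comb, br_comb]
    have e3 := mul_nonneg e1 e2
    have e4 : 0 ≤ (ε * ε) * ((edgeSign i * br (comb Z x) (comb Z y) (Z i) (Z (cycSucc i))) *
      (edgeSign j * br (comb Z x) (comb Z y) (Z j) (Z (cycSucc j)))) := by linarith
    have e5 : 0 < ε * ε := mul_self_pos.2 hε0
    have e6 := (mul_nonneg_iff_of_pos_left e5).1 e4
    have e7 := mul_nonneg (mul_self_nonneg (a * d - b * c)) e6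
    linarith
  obtain ⟨δ, hδ, hball⟩ := Metric.eventually_nhds_iff.1 (hev1.and hev2)
  have hp := hball (y := δ / 2) (by rw [Real.dist_eq, sub_zero, abs_of_pos] <;> linarith)
  have hm := hball (y := -(δ / 2)) (by
    rw [Real.dist_eq, sub_zero, abs_neg, abs_of_pos] <;> linarith)
  have kp := key _ hp.1 hp.2
  have km := key _ hm.1 hm.2
  have hgp := hp.2
  have hgm := hm.2
  have hprod : 0 < g (δ / 2) * g (-(δ / 2)) := by
    have h1 := mul_pos hgp hgm
    have h2 : 0 < (g 0 * g 0) * (g (δ / 2) * g (-(δ / 2))) := by linarith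
    have h3 : 0 < g 0 * g 0 := by
      have : g 0 ≠ 0 := by simpa [hg] using hj
      exact mul_self_pos.2 this
    exact (mul_pos_iff_of_pos_left h3).1 h2
  set w := br D B (Z i) (Z (cycSucc i)) with hw
  have e := edgeSign_mul_self i
  have e' := edgeSign_mul_self j
  have := mul_nonneg kp km
  have h2 : (edgeSign i * (δ / 2 * w) * (edgeSign j * g (δ / 2))) *
      (edgeSign i * (-(δ / 2) * w) * (edgeSign j * g (-(δ / 2)))) =
      (edgeSign i * edgeSign i) * (edgeSign j * edgeSign j) *
        (-(δ / 2 * w) ^ 2 * (g (δ / 2) * g (-(δ / 2)))) := by ring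
  rw [h2, e, e'] at this
  have h3 : 0 < (δ / 2 * w) ^ 2 := by positivity
  nlinarith [mul_pos h3 hprod]

/-! ### Zariski density of the boundary in the edge conditions -/

/-- The function is polynomial along every line. -/
def LinePoly {ι : Type} (g : (ι → ℂ) → ℂ) : Prop := ∀ u v, PolyFun fun t => g (u + t • v)

theorem LinePoly.mul {ι : Type} {g h : (ι → ℂ) → ℂ} (hg : LinePoly g) (hh : LinePoly h) :
    LinePoly fun u => g u * h u := fun u v => (hg u v).mul (hh u v)

/-- On the line joining the two witnesses each factor vanishes only finitely often. -/
theorem LinePoly.exists_mul_ne_zero {ι : Type} {g h : (ι → ℂ) → ℂ} (hg : LinePoly g)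
    (hh : LinePoly h) (hg0 : ∃ u, g u ≠ 0) (hh0 : ∃ u, h u ≠ 0) : ∃ u, g u * h u ≠ 0 := by
  obtain ⟨u, hu⟩ := hg0
  obtain ⟨v, hv⟩ := hh0
  have h1 := (hg u (v - u)).eventually_ne (t₀ := 0) (by simpa using hu)
  have h2 := (hh u (v - u)).eventually_ne (t₀ := 1) (by simpa using hv)
  obtain ⟨t, ht1, ht2⟩ := (h1.and h2).exists
  exact ⟨_, mul_ne_zero ht1 ht2⟩

theorem eventually_ofReal {p : ℂ → Prop} (h : ∀ᶠ t in Filter.cofinite, p t) :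
    ∀ᶠ t : ℝ in Filter.cofinite, p t :=
  (Complex.ofReal_injective.tendsto_cofinite).eventually h

/-- The real positive orthant is Zariski dense: the line re u + t im u reaches the witness at t = I,
so it carries a good real point, and a shift along the all-ones vector by a large real parameter
makes the coordinates positive. -/
theorem LinePoly.exists_pos {ι : Type} [Finite ι] {g : (ι → ℂ) → ℂ} (hg : LinePoly g)
    (hg0 : ∃ u, g u ≠ 0) : ∃ u : ι → ℝ, (∀ i, 0 < u i) ∧ g (fun i => (u i : ℂ)) ≠ 0 := by
  obtain ⟨u, hu⟩ := hg0
  have h1 := (hg (fun i => ((u i).re : ℂ)) (fun i => ((u i).im : ℂ))).eventually_ne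
    (t₀ := Complex.I) (by
      convert hu using 2
      funext i
      simp [mul_comm Complex.I, Complex.re_add_im])
  obtain ⟨r, hr⟩ := (eventually_ofReal h1).exists
  set v : ι → ℝ := fun i => (u i).re + r * (u i).im with hv
  have h2 := (hg (fun i => (v i : ℂ)) 1).eventually_ne (t₀ := 0) (by
    convert hr using 2
    funext i
    simp [hv])
  have h3 := eventually_ofReal h2
  have h4 : ∀ᶠ t : ℝ in Filter.atTop, g ((fun i => (v i : ℂ)) + (t : ℂ) • 1) ≠ 0 :=
    h3.filter_mono (Filter.atTop_le_cofinite)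
  have h5 : ∀ᶠ t : ℝ in Filter.atTop, ∀ i, 0 < v i + t := by
    rw [Filter.eventually_all]
    intro i
    filter_upwards [Filter.eventually_gt_atTop (-v i)] with t ht
    linarith
  obtain ⟨t, ht1, ht2⟩ := (h4.and h5).exists
  refine ⟨fun i => v i + t, ht2, ?_⟩
  convert ht1 using 2
  funext i
  simp

end Boundary

section Density

variable {n : ℕ} {Z : Matrix (Fin n) (Fin 4) ℝ}

theorem toComplex_comb (x : Fin n → ℝ) : toComplex (comb Z x) = ∑ i, (x i : ℂ) • zc Z i := by
  funext a
  simp [toComplex, comb, zc, Finset.sum_apply]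

/-- The sign pattern of the second row of the boundary points on the edge `i`. -/
def sideSign (i k : Fin n) : ℝ := if k ≤ i then -1 else 1

theorem sideSign_mul_self (i k : Fin n) : sideSign i k * sideSign i k = 1 := by
  unfold sideSign; split_ifs <;> norm_num

/-- Parametrization of the points of the edge `i`. -/
def edgePoint (Z : Matrix (Fin n) (Fin 4) ℝ) (i : Fin n) (u : Fin 2 ⊕ Fin n → ℂ) : Fin 4 → ℂ :=
  u (Sum.inl 0) • zc Z i + ((edgeSign i : ℂ) * u (Sum.inl 1)) • zc Z (cycSucc i)

/-- Parametrization of all points by combinations of the vertices. -/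
def freePoint (Z : Matrix (Fin n) (Fin 4) ℝ) (i : Fin n) (u : Fin 2 ⊕ Fin n → ℂ) : Fin 4 → ℂ :=
  ∑ k, ((sideSign i k : ℂ) * u (Sum.inr k)) • zc Z k

theorem polyVec_edgePoint (i : Fin n) (u v : Fin 2 ⊕ Fin n → ℂ) :
    PolyVec fun t => edgePoint Z i (u + t • v) := by
  have : (fun t : ℂ => edgePoint Z i (u + t • v)) =
      fun t => edgePoint Z i u + t • edgePoint Z i v := by
    funext t
    simp only [edgePoint, Pi.add_apply, Pi.smul_apply, smul_eq_mul]
    module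
  rw [this]
  exact (PolyVec.const _).add (PolyVec.smul PolyFun.id (PolyVec.const _))

theorem polyVec_freePoint (i : Fin n) (u v : Fin 2 ⊕ Fin n → ℂ) :
    PolyVec fun t => freePoint Z i (u + t • v) := by
  have : (fun t : ℂ => freePoint Z i (u + t • v)) =
      fun t => freePoint Z i u + t • freePoint Z i v := by
    funext t
    simp only [freePoint, Pi.add_apply, Pi.smul_apply, smul_eq_mul]
    rw [Finset.smul_sum, ← Finset.sum_add_distrib]
    refine Finset.sum_congr rfl fun k _ => ?_
    module
  rw [this]
  exact (PolyVec.const _).add (PolyVec.smul PolyFun.id (PolyVec.const _))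

theorem exists_comb_eq (hu : Uniform Z) (hn : 4 ≤ n) (B : Fin 4 → ℂ) :
    ∃ c : Fin n → ℂ, ∑ k, c k • zc Z k = B := by
  obtain ⟨k, l, h1, h2, h3, h4, h5⟩ := exists_two_others hn ⟨0, by omega⟩ ⟨1, by omega⟩
  have hne := hu.br_ne (i := ⟨0, by omega⟩) (j := ⟨1, by omega⟩) (by simp) h2 h3 h4 h5 h1
  have hB : B ∈ Submodule.span ℂ (Set.range (zc Z)) := by
    rw [← Submodule.smul_mem_iff _ hne, cramer]
    have hm : ∀ k, zc Z k ∈ Submodule.span ℂ (Set.range (zc Z)) := fun k =>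
      Submodule.subset_span ⟨k, rfl⟩
    exact Submodule.add_mem _ (Submodule.add_mem _ (Submodule.add_mem _
      (Submodule.smul_mem _ _ (hm _)) (Submodule.smul_mem _ _ (hm _)))
      (Submodule.smul_mem _ _ (hm _))) (Submodule.smul_mem _ _ (hm _))
  rw [Submodule.mem_span_range_iff_exists_fun] at hB
  exact hB

theorem exists_param (hu : Uniform Z) (hn : 4 ≤ n) (i : Fin n) {P : Fin 4 → ℂ}
    (hP : P ∈ Submodule.span ℂ {zc Z i, zc Z (cycSucc i)}) (B : Fin 4 → ℂ) :
    ∃ u, edgePoint Z i u = P ∧ freePoint Z i u = B := by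
  obtain ⟨s, t, rfl⟩ := Submodule.mem_span_pair.1 hP
  obtain ⟨c, rfl⟩ := exists_comb_eq hu hn B
  refine ⟨Sum.elim ![s, (edgeSign i : ℂ) * t] fun k => (sideSign i k : ℂ) * c k, ?_, ?_⟩
  · have e : (edgeSign i : ℂ) * edgeSign i = 1 := by exact_mod_cast edgeSign_mul_self i
    simp [edgePoint, ← mul_assoc, e]
  · simp only [freePoint, Sum.elim_inr]
    refine Finset.sum_congr rfl fun k _ => ?_
    have e : (sideSign i k : ℂ) * sideSign i k = 1 := by exact_mod_cast sideSign_mul_self i k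
    rw [← mul_assoc, e, one_mul]

/-- The first row is supported on the edge `i`, and the second row changes sign just after `i`; the
twist for the closing edge is again `edgeSign`. -/
theorem nonnegMinors_edge (i : Fin n) {s t : ℝ} (hs : 0 ≤ s) (ht : 0 ≤ t) {c : Fin n → ℝ}
    (hc : ∀ k, 0 ≤ c k) :
    NonnegMinors (Pi.single i s + Pi.single (cycSucc i) (edgeSign i * t))
      (fun k => sideSign i k * c k) := by
  intro u v huv
  have hv := cycSucc_val i
  have hv' := v.isLt
  simp only [Pi.add_apply, Pi.single_apply, Fin.ext_iff, sideSign, edgeSign, Fin.le_def]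
  rw [Fin.lt_def] at huv
  have h1 := mul_nonneg hs (hc u)
  have h2 := mul_nonneg hs (hc v)
  have h3 := mul_nonneg ht (hc u)
  have h4 := mul_nonneg ht (hc v)
  split_ifs at hv ⊢ <;> first | omega | nlinarith

/-- Every line meeting the edge `i` arises from some complex parameters, and positive real
parameters give points of the amplituhedron. Three polynomial conditions are imposed at once: the
test form `f` is nonzero, the bracket at the edge `j` is nonzero, and the bracket at `i` can be
changed by adding a multiple of Z_j to the first point. The last two put the point on the boundary
by `notMem_interior`. -/
theorem mem_closure_boundary (hu : Uniform Z) (hn : 4 ≤ n) {ε : ℝ} (hε : OrderedSign Z ε)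
    {i : Fin n} {V : Gr ℂ 2 4} (hV : V ∈ lineCondition Z i) : V ∈ algBoundary Z := by
  rw [algBoundary, mem_closure_iff]
  intro U hU hVU
  obtain ⟨d, f, hf, hfV, hfU⟩ := exists_form_of_isOpen hU V hVU
  rw [lineCondition_eq] at hV
  obtain ⟨P, hP, B, -, hPB⟩ := hV
  rw [vanishesAt_iff hf V hPB] at hfV
  set j := cycSucc (cycSucc i) with hj
  have n1 := cycSucc_ne hn i
  have n2 := cycSucc₂_ne hn i
  have n3 := cycSucc₃_ne hn i
  have n4 := cycSucc_ne hn (cycSucc i)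
  have n5 := cycSucc₂_ne hn (cycSucc i)
  have n6 := cycSucc_ne hn j
  set g₀ : (Fin 2 ⊕ Fin n → ℂ) → ℂ := fun u => evalAt (edgePoint Z i u) (freePoint Z i u) f
  set g₁ : (Fin 2 ⊕ Fin n → ℂ) → ℂ := fun u =>
    br (edgePoint Z i u) (freePoint Z i u) (zc Z j) (zc Z (cycSucc j))
  set g₂ : (Fin 2 ⊕ Fin n → ℂ) → ℂ := fun u =>
    br (zc Z j) (freePoint Z i u) (zc Z i) (zc Z (cycSucc i))
  have p₀ : LinePoly g₀ := fun u v =>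
    polyFun_evalAt f (polyVec_edgePoint i u v) (polyVec_freePoint i u v)
  have p₁ : LinePoly g₁ := fun u v => PolyVec.br (polyVec_edgePoint i u v)
    (polyVec_freePoint i u v) (PolyVec.const _) (PolyVec.const _)
  have p₂ : LinePoly g₂ := fun u v => PolyVec.br (PolyVec.const _)
    (polyVec_freePoint i u v) (PolyVec.const _) (PolyVec.const _)
  have q₀ : ∃ u, g₀ u ≠ 0 := by
    obtain ⟨u, hu1, hu2⟩ := exists_param hu hn i hP B
    exact ⟨u, by simp only [g₀, hu1, hu2]; exact hfV⟩
  have q₁ : ∃ u, g₁ u ≠ 0 := by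
    obtain ⟨u, hu1, hu2⟩ := exists_param hu hn i
      (Submodule.subset_span (by simp) : zc Z i ∈ _) (zc Z (cycSucc i))
    refine ⟨u, ?_⟩
    simp only [g₁, hu1, hu2]
    exact hu.br_ne n1.symm n2.symm n3.symm n4.symm n5.symm n6.symm
  have q₂ : ∃ u, g₂ u ≠ 0 := by
    obtain ⟨u, hu1, hu2⟩ := exists_param hu hn i
      (Submodule.subset_span (by simp) : zc Z i ∈ _) (zc Z (cycSucc j))
    refine ⟨u, ?_⟩
    simp only [g₂, hu2]
    exact hu.br_ne n6.symm n2 n4 n3 n5 n1.symm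
  obtain ⟨u, hupos, hune⟩ := ((p₀.mul p₁).mul p₂).exists_pos
    (LinePoly.exists_mul_ne_zero (p₀.mul p₁) p₂ (LinePoly.exists_mul_ne_zero p₀ p₁ q₀ q₁) q₂)
  have r₂ := right_ne_zero_of_mul hune
  have r₁ := right_ne_zero_of_mul (left_ne_zero_of_mul hune)
  have r₀ := left_ne_zero_of_mul (left_ne_zero_of_mul hune)
  simp only [g₀, g₁, g₂] at r₀ r₁ r₂
  set x : Fin n → ℝ := Pi.single i (u (Sum.inl 0)) +
    Pi.single (cycSucc i) (edgeSign i * u (Sum.inl 1)) with hx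
  set y : Fin n → ℝ := fun k => sideSign i k * u (Sum.inr k) with hy
  have hxc : edgePoint Z i (fun k => (u k : ℂ)) = toComplex (comb Z x) := by
    rw [hx, comb_add, comb_single, comb_single]
    funext a
    simp [edgePoint, toComplex, zc]
  have hyc : freePoint Z i (fun k => (u k : ℂ)) = toComplex (comb Z y) := by
    rw [toComplex_comb]
    simp [freePoint, hy]
  rw [hxc, hyc] at r₀ r₁
  rw [hyc] at r₂
  rw [zc, zc, br_toComplex] at r₁
  rw [zc, zc, zc, br_toComplex] at r₂
  have r₁' : br (comb Z x) (comb Z y) (Z j) (Z (cycSucc j)) ≠ 0 := by exact_mod_cast r₁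
  have r₂' : br (Z j) (comb Z y) (Z i) (Z (cycSucc i)) ≠ 0 := by exact_mod_cast r₂
  set Y := mkGr (comb Z x) (comb Z y) (indep_of_br_ne_zero r₁') with hY
  have h₀ : br (comb Z x) (comb Z y) (Z i) (Z (cycSucc i)) = 0 := by
    rw [hx, comb_add, comb_single, comb_single]
    simp [br_add₁, br_smul₁]
  refine ⟨Y.complexify, hfU _ ?_, Y, ⟨mem_amplituhedron.2 ⟨x, y, ?_, rfl⟩, ?_⟩, rfl⟩
  · rwa [vanishesAt_iff hf _ (complexify_space rfl)]
  · exact nonnegMinors_edge i (hupos _).le (hupos _).le fun k => (hupos _).le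
  · exact notMem_interior hn hε rfl h₀ r₁' r₂'

theorem algBoundary_eq (hu : Uniform Z) (hn : 4 ≤ n) {ε : ℝ} (hε : OrderedSign Z ε) :
    algBoundary Z = ⋃ k, lineCondition Z k := by
  apply subset_antisymm
  · refine closure_minimal ?_ (isClosed_iUnion_of_finite fun k => isClosed_lineCondition hu hn k)
    rintro _ ⟨Y, ⟨hY, hY'⟩, rfl⟩
    exact Set.mem_iUnion.2 (exists_line_of_boundary hu hn hε hY hY')
  · exact Set.iUnion_subset fun k V hV => mem_closure_boundary hu hn hε hV

/-- The residual arrangement is the union of the residual lines and conics. -/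
theorem residualArrangement_eq (hu : Uniform Z) (hn : 4 ≤ n) {ε : ℝ} (hε : OrderedSign Z ε) :
    residualArrangement Z = residualSet Z := by
  have hb := algBoundary_eq hu hn hε
  apply subset_antisymm
  · rintro V ⟨S, ⟨hS, hd⟩, hV⟩
    rcases hS.residual_or_regular hu hn hb with h | h
    · exact h hV
    · exact absurd hd (h.not_disjoint hu hn)
  · rintro V ⟨S, hS, hV⟩
    refine ⟨S, ?_, hV⟩
    rcases hS with hS | hS
    · exact ⟨isStratum_residualLine hu hn hb hS, disjoint_residualLine hu hn hε hS⟩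
    · exact ⟨isStratum_residualConic hu hn hb hS, disjoint_residualConic hu hn hε hS⟩

end Density

/-! ### Forms vanishing at every line -/

/-- Modulo the Plücker relation, multiplication by p₁₂ replaces p₃₄ by a polynomial in the other
coordinates. -/
theorem exists_pow_mul_sub_mem (F : MvPolynomial (Fin 6) ℂ) :
    ∃ (N : ℕ) (G : MvPolynomial (Fin 5) ℂ),
      MvPolynomial.X 0 ^ N * F - MvPolynomial.rename Fin.castSucc G ∈ pluckerIdeal := by
  induction F using MvPolynomial.induction_on with
  | C c => exact ⟨0, MvPolynomial.C c, by simp⟩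
  | add p q hp hq =>
    obtain ⟨N, G, hG⟩ := hp
    obtain ⟨M, H, hH⟩ := hq
    refine ⟨N + M, MvPolynomial.X 0 ^ M * G + MvPolynomial.X 0 ^ N * H, ?_⟩
    have := pluckerIdeal.add_mem (pluckerIdeal.mul_mem_left (MvPolynomial.X 0 ^ M) hG)
      (pluckerIdeal.mul_mem_left (MvPolynomial.X 0 ^ N) hH)
    convert this using 1
    simp
    ring
  | mul_X p i hp =>
    obtain ⟨N, G, hG⟩ := hp
    by_cases hi : i = Fin.last 5
    · subst hi
      refine ⟨N + 1, G * (MvPolynomial.X 1 * MvPolynomial.X 4 - MvPolynomial.X 2 * MvPolynomial.X 3),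
        ?_⟩
      have hq : (MvPolynomial.X 0 * MvPolynomial.X 5 - MvPolynomial.X 1 * MvPolynomial.X 4
        + MvPolynomial.X 2 * MvPolynomial.X 3 : MvPolynomial (Fin 6) ℂ) ∈ pluckerIdeal :=
        Ideal.subset_span rfl
      have := pluckerIdeal.add_mem
        (pluckerIdeal.mul_mem_left (MvPolynomial.X 0 * MvPolynomial.X 5) hG)
        (pluckerIdeal.mul_mem_left (MvPolynomial.rename Fin.castSucc G) hq)
      convert this using 1
      simp only [map_mul, map_sub, MvPolynomial.rename_X]
      rw [show Fin.last 5 = 5 from rfl, show Fin.castSucc (1 : Fin 5) = 1 from rfl,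
        show Fin.castSucc (2 : Fin 5) = 2 from rfl, show Fin.castSucc (3 : Fin 5) = 3 from rfl,
        show Fin.castSucc (4 : Fin 5) = 4 from rfl]
      ring
    · obtain ⟨j, rfl⟩ := Fin.exists_castSucc_eq.2 hi
      refine ⟨N, G * MvPolynomial.X j, ?_⟩
      have := pluckerIdeal.mul_mem_right (MvPolynomial.X (Fin.castSucc j)) hG
      convert this using 1
      simp
      ring

/-- The prime p₁₂ does not divide the Plücker quadric, which is nonzero at a point with p₁₂ = 0; so
p₁₂ is not a zero divisor in the coordinate ring. -/
theorem mem_pluckerIdeal_of_X_mul_mem {F : MvPolynomial (Fin 6) ℂ}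
    (h : MvPolynomial.X 0 * F ∈ pluckerIdeal) : F ∈ pluckerIdeal := by
  rw [pluckerIdeal, Ideal.mem_span_singleton] at h ⊢
  obtain ⟨g, hg⟩ := h
  have hp : Prime (MvPolynomial.X 0 : MvPolynomial (Fin 6) ℂ) := MvPolynomial.X_prime
  have hdvd : (MvPolynomial.X 0 : MvPolynomial (Fin 6) ℂ) ∣ g := by
    refine (hp.dvd_or_dvd (Dvd.intro _ hg)).resolve_left ?_
    rintro ⟨r, hr⟩
    have := congrArg (MvPolynomial.eval ![0, 1, 0, 0, 1, 0]) hr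
    simp at this
  obtain ⟨g', rfl⟩ := hdvd
  refine ⟨g', mul_left_cancel₀ hp.ne_zero ?_⟩
  rw [hg]
  ring

/-- An element of the coordinate ring that is zero at all decomposable vectors is zero. -/
theorem eq_zero_of_evalAt {f : CoordRing} (h : ∀ A B, evalAt A B f = 0) : f = 0 := by
  obtain ⟨F, rfl⟩ := Ideal.Quotient.mk_surjective f
  simp only [evalAt_mk] at h
  obtain ⟨N, G, hG⟩ := exists_pow_mul_sub_mem F
  have hev : ∀ A B, MvPolynomial.eval (plucker A B)
      (MvPolynomial.X 0 ^ N * F - MvPolynomial.rename Fin.castSucc G) = 0 := by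
    intro A B
    rw [← evalAt_mk, Ideal.Quotient.eq_zero_iff_mem.2 hG, map_zero]
  have hG0 : MvPolynomial.X 0 * G = 0 := by
    apply MvPolynomial.funext
    intro x
    rw [map_mul, MvPolynomial.eval_X, map_zero, mul_eq_zero]
    by_cases hx : x 0 = 0
    · exact Or.inl hx
    · right
      -- The affine chart p₁₂ ≠ 0: this pair of vectors has the first five Plücker coordinates
      -- prescribed by `x`.
      have := hev ![1, 0, -x 3 / x 0, -x 4 / x 0] ![0, x 0, x 1, x 2]
      rw [map_sub, map_mul, h, mul_zero, zero_sub, neg_eq_zero, MvPolynomial.eval_rename] at this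
      have e : plucker ![1, 0, -x 3 / x 0, -x 4 / x 0] ![0, x 0, x 1, x 2] ∘ Fin.castSucc = x := by
        funext i
        fin_cases i <;> simp [plucker] <;> field_simp
      rwa [e] at this
  have hG1 : G = 0 := (mul_eq_zero.1 hG0).resolve_left (MvPolynomial.X_prime.ne_zero)
  rw [hG1, map_zero, sub_zero] at hG
  rw [Ideal.Quotient.eq_zero_iff_mem]
  clear h hev hG0 hG1
  induction N with
  | zero => simpa using hG
  | succ N ih =>
    apply ih
    apply mem_pluckerIdeal_of_X_mul_mem
    rw [← mul_assoc, ← pow_succ']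
    exact hG

/-! ### Forms vanishing on many hyperplanes -/

/-- `g` restricts to polynomials of degree at most `d` on all affine lines. -/
def LineDegLE {V : Type} [AddCommGroup V] [Module ℂ V] (d : ℕ) (g : V → ℂ) : Prop :=
  ∀ B C, ∃ p : Polynomial ℂ, p.natDegree ≤ d ∧ ∀ t : ℂ, g (B + t • C) = p.eval t

/-- Through a point B off all the hyperplanes there is a line meeting them at pairwise different
parameters -φ_c(B)/φ_c(C). The restriction of g has more zeros than its degree allows, so it
vanishes at B too. -/
theorem LineDegLE.eq_zero {V : Type} [AddCommGroup V] [Module ℂ V] {d : ℕ} {g : V → ℂ}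
    (hg : LineDegLE d g) {ι : Type} (S : Finset ι) (hS : d < S.card) (φ : ι → V →ₗ[ℂ] ℂ)
    (hφ : ∀ c ∈ S, ∀ c' ∈ S, c ≠ c' → ∃ B C, φ c B * φ c' C ≠ φ c' B * φ c C)
    (h0 : ∀ c ∈ S, ∀ B, φ c B = 0 → g B = 0) (B : V) : g B = 0 := by
  by_cases hB : ∃ c ∈ S, φ c B = 0
  · obtain ⟨c, hc, hcB⟩ := hB
    exact h0 c hc B hcB
  push Not at hB
  -- The direction C must avoid the kernels of finitely many nonzero functionals: the φ_c, so that
  -- the parameters exist, and the combinations φ_c(B)φ_c' - φ_c'(B)φ_c, so that they differ.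
  obtain ⟨C, hC⟩ := Module.Dual.exists_forall_ne_zero_of_forall_exists (K := ℂ) (M := V)
    (ι := S ⊕ {x : S × S // x.1 ≠ x.2})
    (Sum.elim (fun c => φ c.1) fun x => φ x.1.1 B • φ x.1.2 - φ x.1.2 B • φ x.1.1) (by
      rintro (c | ⟨⟨c, c'⟩, hcc⟩)
      · exact ⟨B, hB c.1 c.2⟩
      · by_contra! hne
        simp only [Sum.elim_inr, LinearMap.sub_apply, LinearMap.smul_apply, smul_eq_mul,
          sub_eq_zero] at hne
        obtain ⟨D, E, hDE⟩ := hφ c.1 c.2 c'.1 c'.2 (fun h => hcc (Subtype.ext h))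
        apply hDE
        apply mul_left_cancel₀ (hB c.1 c.2)
        linear_combination φ c.1 D * hne E - φ c.1 E * hne D)
  obtain ⟨p, hp, hpe⟩ := hg B C
  have hp0 : p = 0 := by
    refine Polynomial.eq_zero_of_natDegree_lt_card_of_eval_eq_zero p (ι := S)
      (f := fun c => -(φ c.1 B / φ c.1 C)) ?_ ?_ ?_
    · intro c c' hcc
      by_contra hne
      have h1 := hC (Sum.inl c)
      have h2 := hC (Sum.inl c')
      have h3 := hC (Sum.inr ⟨(c, c'), hne⟩)
      simp only [Sum.elim_inl, Sum.elim_inr, LinearMap.sub_apply, LinearMap.smul_apply,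
        smul_eq_mul] at h1 h2 h3
      simp only [neg_inj] at hcc
      rw [div_eq_div_iff h1 h2] at hcc
      exact h3 (by rw [hcc, sub_self])
    · intro c
      have h1 : φ c.1 C ≠ 0 := hC (Sum.inl c)
      rw [← hpe]
      apply h0 c.1 c.2
      simp [h1]
    · rw [Fintype.card_coe]; omega
  have := hpe 0
  simpa [hp0] using this

/-- With A fixed the Plücker vector is linear in B. -/
theorem lineDegLE_evalAt {d : ℕ} {f : CoordRing} (hf : f ∈ forms d) (A : Fin 4 → ℂ) :
    LineDegLE d fun B => evalAt A B f := by
  intro B C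
  obtain ⟨F, hF, rfl⟩ := mem_forms.1 hf
  refine ⟨MvPolynomial.aeval (fun i => Polynomial.C (plucker A B i) +
    Polynomial.C (plucker A C i) * Polynomial.X) F, ?_, fun t => ?_⟩
  · refine (MvPolynomial.aeval_natDegree_le F hF.totalDegree_le _ (n := 1) fun i => ?_).trans
      (by simp)
    compute_degree
  · simp only [evalAt_mk]
    clear hF hf
    induction F using MvPolynomial.induction_on with
    | C c => simp
    | add p q hp hq => simp [hp, hq]
    | mul_X p i hp =>
      rw [map_mul, map_mul, Polynomial.eval_mul, hp, MvPolynomial.eval_X, MvPolynomial.aeval_X]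
      congr 1
      fin_cases i <;> simp [plucker] <;> ring

theorem LineDegLE.comp {V W : Type} [AddCommGroup V] [Module ℂ V] [AddCommGroup W] [Module ℂ W]
    {d : ℕ} {g : V → ℂ} (hg : LineDegLE d g) (u : W →ₗ[ℂ] V) : LineDegLE d fun x => g (u x) := by
  intro B C
  simpa using hg (u B) (u C)

/-! ### Uniqueness of the adjoint -/

section Unique

variable {n : ℕ} {Z : Matrix (Fin n) (Fin 4) ℝ}

/-- The parametrization of the edge `Z_a Z_{a+1}`. -/
def edgeMap (Z : Matrix (Fin n) (Fin 4) ℝ) (a : Fin n) : ℂ × ℂ →ₗ[ℂ] (Fin 4 → ℂ) :=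
  (LinearMap.fst ℂ ℂ ℂ).smulRight (zc Z a) + (LinearMap.snd ℂ ℂ ℂ).smulRight (zc Z (cycSucc a))

theorem edgeMap_apply (a : Fin n) (x : ℂ × ℂ) :
    edgeMap Z a x = x.1 • zc Z a + x.2 • zc Z (cycSucc a) := rfl

/-- The bracket as a linear function of its second argument. -/
def brLin (A C D : Fin 4 → ℂ) : (Fin 4 → ℂ) →ₗ[ℂ] ℂ where
  toFun B := br A B C D
  map_add' B B' := br_add₂ A B B' C D
  map_smul' t B := br_smul₂ t A B C D

@[simp] theorem brLin_apply (A B C D : Fin 4 → ℂ) : brLin A C D B = br A B C D := rfl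

/-- The bracket `⟨A B c (c+1)⟩`. -/
def edgeBr (Z : Matrix (Fin n) (Fin 4) ℝ) (A B : Fin 4 → ℂ) (c : Fin n) : ℂ :=
  br A B (zc Z c) (zc Z (cycSucc c))

theorem edgeBr_swap (A B : Fin 4 → ℂ) (c : Fin n) : edgeBr Z B A c = -edgeBr Z A B c :=
  br_swap₁₂ _ _ _ _

section Forms

variable {d : ℕ} {f : CoordRing}

theorem evalAt_swap (hf : f ∈ forms d) {A B : Fin 4 → ℂ} (h : evalAt A B f = 0) :
    evalAt B A f = 0 := by
  have := evalAt_comb hf A B 0 1 1 0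
  simp only [zero_smul, one_smul, zero_add, add_zero, h, mul_zero] at this
  exact this

theorem evalAt_smul_left (hf : f ∈ forms d) (s : ℂ) (A B : Fin 4 → ℂ) :
    evalAt (s • A) B f = s ^ d * evalAt A B f := by
  have := evalAt_comb hf A B s 0 0 1
  simpa using this

theorem evalAt_add_smul (hf : f ∈ forms d) (s : ℂ) (A B : Fin 4 → ℂ) :
    evalAt A (s • A + B) f = evalAt A B f := by
  have := evalAt_comb hf A B 1 0 s 1
  simpa using this

theorem evalAt_eq_zero_of_dep (hd : 0 < d) (hf : f ∈ forms d) {A B : Fin 4 → ℂ}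
    (h : ¬ LinearIndependent ℂ ![A, B]) : evalAt A B f = 0 := by
  rw [← plucker_eq_zero_iff] at h
  obtain ⟨F, hF, rfl⟩ := mem_forms.1 hf
  have := eval_smul_of_isHomogeneous hF 0 0
  rw [evalAt_mk, h]
  simpa [hd.ne'] using this

/-- The segment covers all points with nonzero coordinate sum up to scale; the remaining ones are
reached by moving in the direction Z_{a+1}. -/
theorem evalAt_edge_of_eventually (hf : f ∈ forms d) {a : Fin n} {B : Fin 4 → ℂ}
    (h : ∀ᶠ t in Filter.cofinite, evalAt (edgeMap Z a (1 - t, t)) B f = 0) (x : ℂ × ℂ) :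
    evalAt (edgeMap Z a x) B f = 0 := by
  have h1 := (polyFun_evalAt f (PolyVec.segment (zc Z a) (zc Z (cycSucc a)))
    (PolyVec.const B)).eq_zero_of_eventually h
  have h2 : ∀ x : ℂ × ℂ, x.1 + x.2 ≠ 0 → evalAt (edgeMap Z a x) B f = 0 := by
    intro x hx
    have e : x = (x.1 + x.2) • ((1 - x.2 / (x.1 + x.2), x.2 / (x.1 + x.2)) : ℂ × ℂ) := by
      ext <;> simp <;> field_simp
      simp
    rw [e, map_smul, evalAt_smul_left hf]
    exact mul_eq_zero_of_right _ (h1 _)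
  have h3 := ((polyFun_evalAt f ((PolyVec.const (edgeMap Z a x)).add
    (PolyVec.smul PolyFun.id (PolyVec.const (zc Z (cycSucc a))))) (PolyVec.const B))
    ).eq_zero_of_eventually (by
      have : ∀ᶠ s in Filter.cofinite, x.1 + x.2 + s ≠ 0 := by
        rw [Filter.eventually_cofinite]
        refine (Set.finite_singleton (-(x.1 + x.2))).subset fun s hs => ?_
        simp only [ne_eq, not_not, Set.mem_ofPred_eq] at hs
        rw [Set.mem_singleton_iff]
        linear_combination hs
      filter_upwards [this] with s hs
      have := h2 (x.1, x.2 + s) (by simpa [add_assoc] using hs)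
      rw [edgeMap_apply] at this ⊢
      rw [← this]
      congr 2
      module) 0
  simpa using h3

end Forms

/-- The edges `a` and `b` have no common vertex. -/
def SkewEdges (a b : Fin n) : Prop := a ≠ b ∧ cycSucc a ≠ b ∧ cycSucc b ≠ a

theorem SkewEdges.symm {a b : Fin n} (h : SkewEdges a b) : SkewEdges b a :=
  ⟨h.1.symm, h.2.2, h.2.1⟩

theorem Uniform.edgeBr_ne (hu : Uniform Z) (hn : 4 ≤ n) {c v w : Fin n} (h₁ : v ≠ c)
    (h₂ : v ≠ cycSucc c) (h₃ : w ≠ c) (h₄ : w ≠ cycSucc c) (h : v ≠ w) :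
    edgeBr Z (zc Z v) (zc Z w) c ≠ 0 :=
  hu.br_ne h h₁ h₂ h₃ h₄ (cycSucc_ne hn c).symm

/-- Two different edges do not have the same vertices. -/
theorem exists_end_notMem (hn : 4 ≤ n) {b c : Fin n} (h : b ≠ c) :
    ∃ w, (w = b ∨ w = cycSucc b) ∧ w ≠ c ∧ w ≠ cycSucc c := by
  by_cases h' : b = cycSucc c
  · refine ⟨cycSucc b, Or.inr rfl, ?_, ?_⟩
    · rw [h']; exact cycSucc₂_ne hn c
    · rw [h']; exact cycSucc_ne hn _
  · exact ⟨b, Or.inl rfl, h, h'⟩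

theorem exists_edgeBr_ne (hu : Uniform Z) (hn : 4 ≤ n) {a b c v : Fin n} (hab : SkewEdges a b)
    (hac : SkewEdges a c) (hbc : b ≠ c) (hv : v = a ∨ v = cycSucc a) :
    ∃ w, (w = b ∨ w = cycSucc b) ∧ edgeBr Z (zc Z v) (zc Z w) c ≠ 0 := by
  obtain ⟨w, hw, h1, h2⟩ := exists_end_notMem hn hbc
  refine ⟨w, hw, hu.edgeBr_ne hn ?_ ?_ h1 h2 ?_⟩
  · rcases hv with rfl | rfl
    · exact hac.1
    · exact hac.2.1
  · rcases hv with rfl | rfl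
    · exact hac.2.2.symm
    · exact fun h => hac.1 (cycSucc_inj.1 h)
  · rcases hv with rfl | rfl <;> rcases hw with rfl | rfl
    · exact hab.1
    · exact hab.2.2.symm
    · exact hab.2.1
    · exact fun h => hab.1 (cycSucc_inj.1 h)

theorem edgeMap_end (b : Fin n) {w : Fin n} (hw : w = b ∨ w = cycSucc b) :
    ∃ s : ℂ, edgeMap Z b (1 - s, s) = zc Z w := by
  rcases hw with rfl | rfl
  · exact ⟨0, by simp [edgeMap_apply]⟩
  · exact ⟨1, by simp [edgeMap_apply]⟩

/-- Stated over any field: applied to real data it gives a real line, as `IsGeneral` requires. -/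
theorem exists_kernel_vector {K : Type} [Field K] {u v u' v' : K} (h : u * v' = v * u') :
    ∃ x y : K, (x ≠ 0 ∨ y ≠ 0) ∧ x * u + y * v = 0 ∧ x * u' + y * v' = 0 := by
  by_cases h1 : u = 0 ∧ v = 0
  · by_cases h2 : u' = 0 ∧ v' = 0
    · exact ⟨1, 0, Or.inl one_ne_zero, by simp [h1.1], by simp [h2.1]⟩
    · refine ⟨v', -u', ?_, by simp [h1.1, h1.2], by ring⟩
      rw [not_and_or] at h2
      simpa [or_comm] using h2
  · refine ⟨v, -u, ?_, by ring, by linear_combination -h⟩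
    rw [not_and_or] at h1
    simpa [or_comm] using h1

theorem IsGeneral.card_le (hgen : IsGeneral Z) {A B : Fin 4 → ℝ}
    (h : LinearIndependent ℝ ![A, B]) (s : Finset (Fin n))
    (hs : ∀ i ∈ s, br A B (Z i) (Z (cycSucc i)) = 0) : s.card ≤ 4 := by
  refine le_trans ?_ (hgen A B h)
  rw [← Set.ncard_coe_finset]
  exact Set.ncard_le_ncard (fun i hi => hs i hi) (Set.toFinite _)

/-- The edges cutting out residual curves on the lines meeting the edges `a` and `b`. -/
def cutEdges (a b : Fin n) : Finset (Fin n) := {a, b, cycPred b, cycSucc b}ᶜ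

theorem mem_cutEdges {a b c : Fin n} : c ∈ cutEdges a b ↔ c ≠ a ∧ SkewEdges b c := by
  simp only [cutEdges, Finset.mem_compl, Finset.mem_insert, Finset.mem_singleton, not_or,
    eq_cycPred_iff, SkewEdges]
  tauto

/-- Cut edges may be adjacent to `a`; only `a` itself, `b` and the two neighbours of `b` are
excluded, which makes their number equal to the degree of the adjoint. -/
theorem card_cutEdges (hn : 4 ≤ n) {a b : Fin n} (h : SkewEdges a b) :
    (cutEdges a b).card = n - 4 := by
  rw [cutEdges, Finset.card_compl, Fintype.card_fin]
  congr 1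
  rw [Finset.card_insert_of_notMem, Finset.card_insert_of_notMem, Finset.card_insert_of_notMem,
    Finset.card_singleton]
  · rw [Finset.mem_singleton]
    intro h'
    rw [eq_comm, eq_cycPred_iff] at h'
    exact cycSucc₂_ne hn b h'
  · simp only [Finset.mem_insert, Finset.mem_singleton, not_or, eq_cycPred_iff]
    exact ⟨cycSucc_ne hn b, (cycSucc_ne hn b).symm⟩
  · simp only [Finset.mem_insert, Finset.mem_singleton, not_or, eq_cycPred_iff]
    exact ⟨h.1, h.2.1, h.2.2.symm⟩

/-- The vanishing of a form on the residual arrangement, tested on a line through two edges. -/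
theorem evalAt_eq_zero_of_cut (hu : Uniform Z) (hn : 4 ≤ n) {d : ℕ} (hd : 0 < d) {f : CoordRing}
    (hf : f ∈ forms d) (hv : ∀ V ∈ residualSet Z, VanishesAt f V) {a b c : Fin n}
    (hab : SkewEdges a b) (hc : c ∈ cutEdges a b) {x y : ℂ × ℂ} (hx₁ : x.1 ≠ 0) (hx₂ : x.2 ≠ 0)
    (h : edgeBr Z (edgeMap Z a x) (edgeMap Z b y) c = 0) :
    evalAt (edgeMap Z a x) (edgeMap Z b y) f = 0 := by
  by_cases hl : LinearIndependent ℂ ![edgeMap Z a x, edgeMap Z b y]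
  swap
  · exact evalAt_eq_zero_of_dep hd hf hl
  rw [← vanishesAt_iff hf (mkGr _ _ hl) rfl]
  apply hv
  have hPV : edgeMap Z a x ∈ (mkGr _ _ hl).space := Submodule.subset_span (by simp)
  have hQV : edgeMap Z b y ∈ (mkGr _ _ hl).space := Submodule.subset_span (by simp)
  have hPa : edgeMap Z a x ∈ Submodule.span ℂ {zc Z a, zc Z (cycSucc a)} :=
    Submodule.mem_span_pair.2 ⟨_, _, rfl⟩
  have hQb : edgeMap Z b y ∈ Submodule.span ℂ {zc Z b, zc Z (cycSucc b)} :=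
    Submodule.mem_span_pair.2 ⟨_, _, rfl⟩
  have hVa : mkGr _ _ hl ∈ lineCondition Z a := mem_lineCondition.2 ⟨_, hPV, hPa, hl.ne_zero 0⟩
  have hVb : mkGr _ _ hl ∈ lineCondition Z b := mem_lineCondition.2 ⟨_, hQV, hQb, hl.ne_zero 1⟩
  obtain ⟨hca, hbc⟩ := mem_cutEdges.1 hc
  have hplane : ∀ j : Fin n, (edgeMap Z a x ∈ Submodule.span ℂ
      {zc Z j, zc Z (cycSucc j), zc Z (cycSucc (cycSucc j))}) →
      br (edgeMap Z b y) (zc Z j) (zc Z (cycSucc j)) (zc Z (cycSucc (cycSucc j))) = 0 →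
      mkGr _ _ hl ∈ planeCondition Z (cycSucc j) := by
    intro j hP hQ
    obtain ⟨l, hl1, hl2, hl3⟩ := exists_other hn j (cycSucc j) (cycSucc (cycSucc j))
    rw [mem_planeCondition_succ, mkGr, Submodule.span_le]
    rintro v (rfl | rfl)
    · exact hP
    · exact mem_span_triple_of_br (hu.br_ne (cycSucc_ne hn j).symm (cycSucc₂_ne hn j).symm hl1
        (cycSucc_ne hn _).symm hl2 hl3) hQ
  -- If `c` is adjacent to `a`, the bracket is a nonzero coordinate of `x` times the equation of the
  -- plane of both edges, and the line is on a residual line. If `c` is disjoint from `a`, it is on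
  -- a residual conic.
  by_cases h1 : cycSucc a = c
  · subst h1
    refine mem_residualSet_of_plane (hplane a ?_ ?_) hVb hab.1 hab.2.2 hab.2.1 hbc.2.2
    · exact Submodule.span_mono (by simp [Set.insert_subset_iff]) hPa
    · rw [edgeBr, edgeMap_apply a, br_add₁, br_smul₁, br_smul₁, br_same₁₃, mul_zero, add_zero,
        br_swap₁₂] at h
      simpa [hx₁] using h
  by_cases h2 : cycSucc c = a
  · subst h2
    refine mem_residualSet_of_plane (hplane c ?_ ?_) hVb hbc.1.symm hbc.2.1 hab.1 hab.2.1
    · exact Submodule.span_mono (by simp) hPa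
    · rw [edgeBr, edgeMap_apply (cycSucc c), br_add₁, br_smul₁, br_smul₁, br_same₁₄, mul_zero,
        zero_add] at h
      rw [br_swap₃₄, br_swap₂₃, br_swap₁₂]
      simpa [hx₂] using h
  have hVc : mkGr _ _ hl ∈ lineCondition Z c := (mem_lineCondition_iff_br hu hn rfl c).2 h
  exact mem_residualSet_of_lines hVa hVb hVc hab.1 hab.2.1 hab.2.2 hca.symm h1 h2 hbc.1 hbc.2.1
    hbc.2.2

end Unique

/-! ### General points of an edge have distinct cut points -/

section Unique

variable {n : ℕ} {Z : Matrix (Fin n) (Fin 4) ℝ}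

/-- The determinant of the two linear functions `⟨P · c (c+1)⟩` and `⟨P · c' (c'+1)⟩` on the
edge `b`. -/
def cutDet (Z : Matrix (Fin n) (Fin 4) ℝ) (P : Fin 4 → ℂ) (b c c' : Fin n) : ℂ :=
  edgeBr Z P (zc Z b) c * edgeBr Z P (zc Z (cycSucc b)) c' -
    edgeBr Z P (zc Z (cycSucc b)) c * edgeBr Z P (zc Z b) c'

/-- This is where genericity enters. Coinciding cuts seen from the vertex `v` give a real line
through `v` that meets `b`, `c`, `c'` and the edges at `v`, which are too many edges. -/
theorem cutDet_vertex_ne (hu : Uniform Z) (hn : 4 ≤ n) (hgen : IsGeneral Z) {v b c c' : Fin n}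
    (hv₁ : v ≠ b) (hv₂ : v ≠ cycSucc b) {s : Finset (Fin n)} (hs : 4 < s.card)
    (h : ∀ i ∈ s, i = b ∨ i = c ∨ i = c' ∨ v = i ∨ v = cycSucc i) :
    cutDet Z (zc Z v) b c c' ≠ 0 := by
  intro h0
  simp only [cutDet, edgeBr, zc, br_toComplex] at h0
  rw [sub_eq_zero] at h0
  obtain ⟨x, y, hxy, h1, h2⟩ := exists_kernel_vector (K := ℝ) (by exact_mod_cast h0)
  obtain ⟨l, hl1, hl2, hl3⟩ := exists_other hn v b (cycSucc b)
  have hv0 : Z v ≠ 0 := by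
    intro h
    have := hu v l b (cycSucc b) hl1 hv₁ hv₂ hl2.symm hl3.symm (cycSucc_ne hn b).symm
    simp [h] at this
  have hbb : LinearIndependent ℝ ![Z b, Z (cycSucc b)] :=
    indep_of_br_ne_zero (hu b (cycSucc b) v l (cycSucc_ne hn b).symm hv₁.symm hl2 hv₂.symm hl3 hl1)
  have hl := indep_of_lines (P := Z v) (Q := x • Z b + y • Z (cycSucc b))
    (hu v l b (cycSucc b) hl1 hv₁ hv₂ hl2.symm hl3.symm (cycSucc_ne hn b).symm)
    (Submodule.subset_span (by simp)) (Submodule.mem_span_pair.2 ⟨x, y, rfl⟩) hv0 (by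
      intro h
      have := (pair_indep_iff _ _).1 hbb x y h
      tauto)
  have := hgen.card_le hl s (by
    intro i hi
    rw [br_add₂, br_smul₂, br_smul₂]
    rcases h i hi with rfl | rfl | rfl | rfl | rfl
    · simp
    · exact h1
    · exact h2
    · simp
    · simp)
  omega

/-- For the two neighbours of the edge `k+1` the cuts seen from an inner point are its intersections
with two adjacent planes. A common zero on `b` would lie in both planes, hence on the edge `k+1`
itself, which is skew to `b`. -/
theorem exists_cutDet_opposite (hu : Uniform Z) (hn : 4 ≤ n) {b k : Fin n}
    (hab : SkewEdges (cycSucc k) b) :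
    ∃ t : ℂ, cutDet Z (edgeMap Z (cycSucc k) (1 - t, t)) b k (cycSucc (cycSucc k)) ≠ 0 := by
  refine ⟨1 / 2, fun h0 => ?_⟩
  rw [cutDet, sub_eq_zero] at h0
  obtain ⟨x, y, hxy, h1, h2⟩ := exists_kernel_vector h0
  simp only [edgeBr, edgeMap_apply, br_add₁, br_smul₁, br_same₁₃, br_same₁₄, mul_zero, zero_add,
    add_zero] at h1 h2
  set Q := x • zc Z b + y • zc Z (cycSucc b) with hQ
  have h1' : br (zc Z (cycSucc (cycSucc k))) Q (zc Z k) (zc Z (cycSucc k)) = 0 := by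
    rw [hQ, br_add₂, br_smul₂, br_smul₂]
    linear_combination 2 * h1
  have h2' : br (zc Z (cycSucc k)) Q (zc Z (cycSucc (cycSucc k)))
      (zc Z (cycSucc (cycSucc (cycSucc k)))) = 0 := by
    rw [hQ, br_add₂, br_smul₂, br_smul₂]
    linear_combination 2 * h2
  have hne := hu.br_ne (cycSucc_ne hn k).symm (cycSucc₂_ne hn k).symm
    (cycSucc₃_ne hn k).symm (cycSucc_ne hn _).symm (cycSucc₂_ne hn _).symm (cycSucc_ne hn _).symm
  obtain ⟨l, hl1, hl2, hl3⟩ := exists_other hn (cycSucc k) (cycSucc (cycSucc k))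
    (cycSucc (cycSucc (cycSucc k)))
  have hQ1 : Q ∈ Submodule.span ℂ {zc Z k, zc Z (cycSucc k), zc Z (cycSucc (cycSucc k))} := by
    refine mem_span_triple_of_br hne ?_
    rw [← neg_eq_zero, ← h1']
    simp only [br_eq]; ring
  have hQ2 : Q ∈ Submodule.span ℂ {zc Z (cycSucc k), zc Z (cycSucc (cycSucc k)),
      zc Z (cycSucc (cycSucc (cycSucc k)))} := by
    refine mem_span_triple_of_br (hu.br_ne (cycSucc_ne hn _).symm (cycSucc₂_ne hn _).symm
      hl1 (cycSucc_ne hn _).symm hl2 hl3) ?_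
    rw [br_swap₁₂, h2', neg_zero]
  have hQ3 := span_mem_of_planes hne hQ1 hQ2
  have hQ4 : Q ∈ Submodule.span ℂ {zc Z b, zc Z (cycSucc b)} :=
    Submodule.mem_span_pair.2 ⟨_, _, rfl⟩
  have hQ0 : Q ≠ 0 := by
    intro h
    have := (pair_indep_iff _ _).1 (hu.indep hn (cycSucc_ne hn b).symm) x y h
    tauto
  have hl := indep_of_lines (hu.br_ne (cycSucc_ne hn (cycSucc k)).symm hab.1 hab.2.2.symm
    hab.2.1 (fun h => hab.1 (cycSucc_inj.1 h)) (cycSucc_ne hn b).symm) hQ3 hQ4 hQ0 hQ0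
  have := (pair_indep_iff _ _).1 hl 1 (-1) (by module)
  simp at this

/-- The five edges needed at an endpoint of `a` are distinct unless one of `c`, `c'` is the other
edge at that endpoint. If this fails at both ends, `c` and `c'` are the two neighbours of `a`. -/
theorem exists_cutDet_ne (hu : Uniform Z) (hn : 4 ≤ n) (hgen : IsGeneral Z) {a b c c' : Fin n}
    (hab : SkewEdges a b) (hc : c ∈ cutEdges a b) (hc' : c' ∈ cutEdges a b) (hcc : c ≠ c') :
    ∃ t : ℂ, cutDet Z (edgeMap Z a (1 - t, t)) b c c' ≠ 0 := by
  obtain ⟨hca, hbc⟩ := mem_cutEdges.1 hc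
  obtain ⟨hca', hbc'⟩ := mem_cutEdges.1 hc'
  by_cases h1 : cycSucc c ≠ a ∧ cycSucc c' ≠ a
  · refine ⟨0, ?_⟩
    rw [edgeMap_apply]
    simp only [sub_zero, one_smul, zero_smul, add_zero]
    refine cutDet_vertex_ne hu hn hgen (s := {cycPred a, a, b, c, c'}) hab.1 hab.2.2.symm ?_ ?_
    · rw [Finset.card_insert_of_notMem, Finset.card_insert_of_notMem, Finset.card_insert_of_notMem,
        Finset.card_pair hcc]
      · norm_num
      · simp [hbc.1, hbc'.1]
      · simp [hab.1, hca.symm, hca'.symm]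
      · simp only [Finset.mem_insert, Finset.mem_singleton, not_or]
        simp only [eq_comm (a := cycPred a), eq_cycPred_iff]
        exact ⟨cycSucc_ne hn a, hab.2.2, h1.1, h1.2⟩
    · intro i hi
      simp only [Finset.mem_insert, Finset.mem_singleton] at hi
      rcases hi with rfl | rfl | rfl | rfl | rfl <;> simp
  by_cases h2 : cycSucc a ≠ c ∧ cycSucc a ≠ c'
  · refine ⟨1, ?_⟩
    rw [edgeMap_apply]
    simp only [sub_self, one_smul, zero_smul, zero_add]
    refine cutDet_vertex_ne hu hn hgen (s := {a, cycSucc a, b, c, c'}) hab.2.1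
      (fun h => hab.1 (cycSucc_inj.1 h)) ?_ ?_
    · rw [Finset.card_insert_of_notMem, Finset.card_insert_of_notMem, Finset.card_insert_of_notMem,
        Finset.card_pair hcc]
      · norm_num
      · simp [hbc.1, hbc'.1]
      · simp [hab.2.1, h2.1, h2.2]
      · simp [hab.1, hca.symm, hca'.symm, (cycSucc_ne hn a).symm]
    · intro i hi
      simp only [Finset.mem_insert, Finset.mem_singleton] at hi
      rcases hi with rfl | rfl | rfl | rfl | rfl <;> simp
  have hsymm : ∀ P, cutDet Z P b c' c = -cutDet Z P b c c' := fun P => by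
    rw [cutDet, cutDet]; ring
  by_cases h3 : cycSucc c = a
  · have h4 : cycSucc a ≠ c := by rw [← h3]; exact cycSucc₂_ne hn c
    have h5 : cycSucc a = c' := by simpa [h4] using h2
    subst h5 h3
    exact exists_cutDet_opposite hu hn hab
  · have h3' : cycSucc c' = a := by tauto
    have h4 : cycSucc a ≠ c' := by rw [← h3']; exact cycSucc₂_ne hn c'
    have h5 : cycSucc a = c := by simpa [h4] using h2
    subst h5 h3'
    obtain ⟨t, ht⟩ := exists_cutDet_opposite hu hn hab
    exact ⟨t, by rwa [← neg_ne_zero, ← hsymm]⟩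

theorem polyVec_edgeMap (a : Fin n) : PolyVec fun t => edgeMap Z a (1 - t, t) :=
  PolyVec.segment _ _

theorem polyFun_edgeBr {p q : ℂ → Fin 4 → ℂ} (hp : PolyVec p) (hq : PolyVec q) (c : Fin n) :
    PolyFun fun t => edgeBr Z (p t) (q t) c :=
  PolyVec.br hp hq (PolyVec.const _) (PolyVec.const _)

theorem eventually_cutDet_ne (hu : Uniform Z) (hn : 4 ≤ n) (hgen : IsGeneral Z) {a b : Fin n}
    (hab : SkewEdges a b) : ∀ᶠ t : ℂ in Filter.cofinite, ∀ c ∈ cutEdges a b, ∀ c' ∈ cutEdges a b,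
      c ≠ c' → cutDet Z (edgeMap Z a (1 - t, t)) b c c' ≠ 0 := by
  simp only [Filter.eventually_all_finset, Filter.eventually_all]
  intro c hc c' hc' hcc
  obtain ⟨t, ht⟩ := exists_cutDet_ne hu hn hgen hab hc hc' hcc
  have hp := polyVec_edgeMap (Z := Z) a
  exact PolyFun.eventually_ne (((polyFun_edgeBr hp (PolyVec.const _) c).mul
    (polyFun_edgeBr hp (PolyVec.const _) c')).sub ((polyFun_edgeBr hp (PolyVec.const _) c).mul
    (polyFun_edgeBr hp (PolyVec.const _) c'))) ht

theorem eventually_ne_const (s : ℂ) : ∀ᶠ t : ℂ in Filter.cofinite, t ≠ s := by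
  rw [Filter.eventually_cofinite]
  exact (Set.finite_singleton s).subset fun t ht => by simpa using ht

/-! ### Vanishing on the lines meeting two skew edges -/

section Forms

variable {f : CoordRing}

/-- A binary form of degree n-4 on the edge `b` has n-4 zeros from the cut edges and one more at
`y₀`. The zero at `y₀` is the `none` element of the index set. -/
theorem evalAt_edge_eq_zero (hu : Uniform Z) (hn : 5 ≤ n) (hf : f ∈ forms (n - 4))
    (hv : ∀ V ∈ residualSet Z, VanishesAt f V) {a b : Fin n} (hab : SkewEdges a b) {x y₀ : ℂ × ℂ}
    (hx₁ : x.1 ≠ 0) (hx₂ : x.2 ≠ 0) (hD : ∀ c ∈ cutEdges a b, ∀ c' ∈ cutEdges a b,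
      c ≠ c' → cutDet Z (edgeMap Z a x) b c c' ≠ 0) (hy₀ : y₀.1 ≠ 0 ∨ y₀.2 ≠ 0)
    (hne : ∀ c ∈ cutEdges a b, edgeBr Z (edgeMap Z a x) (edgeMap Z b y₀) c ≠ 0)
    (h₀ : evalAt (edgeMap Z a x) (edgeMap Z b y₀) f = 0) (y : ℂ × ℂ) :
    evalAt (edgeMap Z a x) (edgeMap Z b y) f = 0 := by
  have hn4 : 4 ≤ n := by omega
  set P := edgeMap Z a x with hP
  refine ((lineDegLE_evalAt hf P).comp (edgeMap Z b)).eq_zero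
    (Finset.insertNone (cutEdges a b)) (by rw [Finset.card_insertNone, card_cutEdges hn4 hab]; omega)
    (fun o => o.elim (y₀.2 • LinearMap.fst ℂ ℂ ℂ - y₀.1 • LinearMap.snd ℂ ℂ ℂ)
      fun c => (brLin P (zc Z c) (zc Z (cycSucc c))).comp (edgeMap Z b)) ?_ ?_ y
  · have key : ∀ c ∈ cutEdges a b, ∃ C : ℂ × ℂ, y₀.2 * C.1 - y₀.1 * C.2 ≠ 0 := by
      intro c hc
      rcases hy₀ with h | h
      · exact ⟨(0, 1), by simpa using h⟩
      · exact ⟨(1, 0), by simpa using h⟩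
    rintro (_ | c) hc (_ | c') hc' hcc
    · exact absurd rfl hcc
    · rw [Finset.some_mem_insertNone] at hc'
      obtain ⟨C, hC⟩ := key c' hc'
      refine ⟨C, y₀, ?_⟩
      have := hne c' hc'
      simp only [Option.elim, LinearMap.sub_apply, LinearMap.smul_apply, LinearMap.fst_apply,
        LinearMap.snd_apply, smul_eq_mul, LinearMap.comp_apply, brLin_apply]
      rw [mul_comm y₀.2 y₀.1, sub_self, mul_zero]
      exact mul_ne_zero hC this
    · rw [Finset.some_mem_insertNone] at hc
      obtain ⟨C, hC⟩ := key c hc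
      refine ⟨y₀, C, ?_⟩
      have := hne c hc
      simp only [Option.elim, LinearMap.sub_apply, LinearMap.smul_apply, LinearMap.fst_apply,
        LinearMap.snd_apply, smul_eq_mul, LinearMap.comp_apply, brLin_apply]
      rw [mul_comm y₀.2 y₀.1, sub_self, zero_mul]
      exact mul_ne_zero this hC
    · rw [Finset.some_mem_insertNone] at hc hc'
      refine ⟨(1, 0), (0, 1), ?_⟩
      have := hD c hc c' hc' (by simpa using hcc)
      simp only [Option.elim, LinearMap.comp_apply, brLin_apply, edgeMap_apply]
      simp only [one_smul, zero_smul, zero_add, add_zero]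
      rw [cutDet, sub_ne_zero] at this
      rw [mul_comm (br P (zc Z b) (zc Z c') _)]
      exact this
  · rintro (_ | c) hc B hB
    · simp only [Option.elim, LinearMap.sub_apply, LinearMap.smul_apply, LinearMap.fst_apply,
        LinearMap.snd_apply, smul_eq_mul] at hB
      have : ∃ s : ℂ, B = s • y₀ := by
        rcases hy₀ with h | h
        · refine ⟨B.1 / y₀.1, ?_⟩
          ext <;> simp <;> field_simp
          linear_combination -hB
        · refine ⟨B.2 / y₀.2, ?_⟩
          ext <;> simp <;> field_simp
          linear_combination hB
      obtain ⟨s, rfl⟩ := this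
      apply evalAt_swap hf
      rw [map_smul, evalAt_smul_left hf, evalAt_swap hf h₀, mul_zero]
    · rw [Finset.some_mem_insertNone] at hc
      exact evalAt_eq_zero_of_cut hu hn4 (by omega) hf hv hab hc hx₁ hx₂ hB

/-- `f` vanishes at all lines meeting the edges `a` and `b`. -/
def ZeroOnEdges (Z : Matrix (Fin n) (Fin 4) ℝ) (f : CoordRing) (a b : Fin n) : Prop :=
  ∀ x y, evalAt (edgeMap Z a x) (edgeMap Z b y) f = 0

theorem ZeroOnEdges.symm (hf : f ∈ forms (n - 4)) {a b : Fin n} (h : ZeroOnEdges Z f a b) :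
    ZeroOnEdges Z f b a := fun x y => evalAt_swap hf (h y x)

/-- The roles of the edges are exchanged: seen from a general point of `b`, the point `x₀` of `a` is
the extra zero, and `hne` keeps it away from the cuts. -/
theorem zeroOnEdges_of_point (hu : Uniform Z) (hn : 5 ≤ n) (hgen : IsGeneral Z)
    (hf : f ∈ forms (n - 4)) (hv : ∀ V ∈ residualSet Z, VanishesAt f V) {a b : Fin n}
    (hab : SkewEdges a b) {x₀ : ℂ × ℂ} (hx₀ : x₀.1 ≠ 0 ∨ x₀.2 ≠ 0)
    (hne : ∀ c ∈ cutEdges b a, ∃ w, (w = b ∨ w = cycSucc b) ∧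
      edgeBr Z (edgeMap Z a x₀) (zc Z w) c ≠ 0)
    (h : ∀ y, evalAt (edgeMap Z a x₀) (edgeMap Z b y) f = 0) : ZeroOnEdges Z f a b := by
  refine ZeroOnEdges.symm hf fun y x => evalAt_edge_of_eventually hf ?_ y
  have h1 : ∀ᶠ s : ℂ in Filter.cofinite, ∀ c ∈ cutEdges b a,
      edgeBr Z (edgeMap Z b (1 - s, s)) (edgeMap Z a x₀) c ≠ 0 := by
    rw [Filter.eventually_all_finset]
    intro c hc
    obtain ⟨w, hw, hne⟩ := hne c hc
    obtain ⟨s, hs⟩ := edgeMap_end (Z := Z) b hw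
    refine PolyFun.eventually_ne (polyFun_edgeBr (polyVec_edgeMap b) (PolyVec.const _) c)
      (t₀ := s) ?_
    rwa [hs, edgeBr_swap, neg_ne_zero]
  filter_upwards [h1, eventually_ne_const 0, eventually_ne_const 1,
    eventually_cutDet_ne hu (by omega) hgen hab.symm] with s h1 h2 h3 h4
  exact evalAt_edge_eq_zero hu hn hf hv hab.symm (sub_ne_zero.2 h3.symm) h2 h4 hx₀ h1
    (evalAt_swap hf (h _)) x

/-- The edges `a` and `a+1` share a vertex, and vanishing at the lines from this vertex to `b` is
enough to restart the argument. -/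
theorem ZeroOnEdges.succ_left (hu : Uniform Z) (hn : 5 ≤ n) (hgen : IsGeneral Z)
    (hf : f ∈ forms (n - 4)) (hv : ∀ V ∈ residualSet Z, VanishesAt f V) {a b : Fin n}
    (h : ZeroOnEdges Z f a b) (hab : SkewEdges (cycSucc a) b) :
    ZeroOnEdges Z f (cycSucc a) b := by
  have e : edgeMap Z (cycSucc a) (1, 0) = edgeMap Z a (0, 1) := by simp [edgeMap_apply]
  refine zeroOnEdges_of_point hu hn hgen hf hv hab (x₀ := (1, 0)) (by simp) ?_ ?_
  · intro c hc
    obtain ⟨hcb, hac⟩ := mem_cutEdges.1 hc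
    obtain ⟨w, hw, h⟩ := exists_edgeBr_ne hu (by omega) hab hac hcb.symm (Or.inl rfl)
    exact ⟨w, hw, by simpa [edgeMap_apply] using h⟩
  · intro y
    rw [e]
    exact h _ _

theorem ZeroOnEdges.succ_right (hu : Uniform Z) (hn : 5 ≤ n) (hgen : IsGeneral Z)
    (hf : f ∈ forms (n - 4)) (hv : ∀ V ∈ residualSet Z, VanishesAt f V) {a b : Fin n}
    (h : ZeroOnEdges Z f a b) (hab : SkewEdges a (cycSucc b)) :
    ZeroOnEdges Z f a (cycSucc b) :=
  ((h.symm hf).succ_left hu hn hgen hf hv hab.symm).symm hf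

/-- Two skew edges carry a test line for the vanishing of adjoints. -/
theorem exists_test_line (hu : Uniform Z) (hn : 5 ≤ n) (hgen : IsGeneral Z) {a b : Fin n}
    (hab : SkewEdges a b) : ∃ A B, ∀ f ∈ forms (n - 4),
      (∀ V ∈ residualSet Z, VanishesAt f V) → evalAt A B f = 0 → ZeroOnEdges Z f a b := by
  have hn4 : 4 ≤ n := by omega
  have h1 : ∀ᶠ t : ℂ in Filter.cofinite, ∀ c ∈ cutEdges b a, ∃ w, (w = b ∨ w = cycSucc b) ∧
      edgeBr Z (edgeMap Z a (1 - t, t)) (zc Z w) c ≠ 0 := by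
    rw [Filter.eventually_all_finset]
    intro c hc
    obtain ⟨hcb, hac⟩ := mem_cutEdges.1 hc
    obtain ⟨w, hw, h⟩ := exists_edgeBr_ne hu hn4 hab hac hcb.symm (Or.inl rfl)
    filter_upwards [PolyFun.eventually_ne (polyFun_edgeBr (polyVec_edgeMap a)
      (PolyVec.const (zc Z w)) c) (t₀ := 0) (by simpa [edgeMap_apply] using h)] with t ht
    exact ⟨w, hw, ht⟩
  have h2 : ∀ᶠ t : ℂ in Filter.cofinite, ∀ c ∈ cutEdges a b,
      edgeBr Z (edgeMap Z a (1 - t, t)) (zc Z b) c ≠ 0 := by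
    rw [Filter.eventually_all_finset]
    intro c hc
    obtain ⟨hca, hbc⟩ := mem_cutEdges.1 hc
    obtain ⟨w, hw, h⟩ := exists_edgeBr_ne hu hn4 hab.symm hbc hca.symm (Or.inl rfl)
    obtain ⟨s, hs⟩ := edgeMap_end (Z := Z) a hw
    refine PolyFun.eventually_ne (polyFun_edgeBr (polyVec_edgeMap a) (PolyVec.const _) c)
      (t₀ := s) ?_
    rwa [hs, edgeBr_swap, neg_ne_zero]
  obtain ⟨t, h1, h2, h3, h4, h5⟩ := (h1.and (h2.and ((eventually_ne_const 0).and
    ((eventually_ne_const 1).and (eventually_cutDet_ne hu hn4 hgen hab))))).exists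
  -- The test line joins a general point of `a` to the first endpoint of `b`.
  refine ⟨edgeMap Z a (1 - t, t), edgeMap Z b (1, 0), fun f hf hv h0 => ?_⟩
  refine zeroOnEdges_of_point hu hn hgen hf hv hab (x₀ := (1 - t, t)) (Or.inr h3) h1 fun y => ?_
  refine evalAt_edge_eq_zero hu hn hf hv hab (sub_ne_zero.2 h4.symm) h3 h5 (y₀ := (1, 0)) (by simp)
    (fun c hc => ?_) h0 y
  simpa [edgeMap_apply] using h2 c hc

end Forms
end Unique

/-! ### From one pair of skew edges to all lines -/

section Unique

variable {n : ℕ} {Z : Matrix (Fin n) (Fin 4) ℝ} {f : CoordRing}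

theorem cycSucc_mk {m : ℕ} (h : m + 1 < n) :
    cycSucc (⟨m, by omega⟩ : Fin n) = ⟨m + 1, h⟩ := by
  ext
  rw [cycSucc_val, if_neg]
  simp only
  omega

theorem skewEdges_of_val {a b : Fin n} (h : (a : ℕ) + 2 ≤ b) (h' : (a : ℕ) ≠ 0 ∨ (b : ℕ) + 1 ≠ n) :
    SkewEdges a b := by
  have ha := cycSucc_val a
  have hb := cycSucc_val b
  refine ⟨?_, ?_, ?_⟩ <;> rw [Ne, Fin.ext_iff]
  · omega
  · split_ifs at ha <;> omega
  · split_ifs at hb <;> omega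

theorem SkewEdges.val {a b : Fin n} (h : SkewEdges a b) (hab : (a : ℕ) ≤ b) :
    (a : ℕ) + 2 ≤ b ∧ ((a : ℕ) ≠ 0 ∨ (b : ℕ) + 1 ≠ n) := by
  obtain ⟨h1, h2, h3⟩ := h
  rw [Ne, Fin.ext_iff] at h1 h2 h3
  rw [cycSucc_val] at h2 h3
  split_ifs at h2 h3 <;> omega

/-- Vanishing spreads from one pair of skew edges to all pairs of skew edges. -/
theorem zeroOnEdges_of_zeroOnEdges (hu : Uniform Z) (hn : 5 ≤ n) (hgen : IsGeneral Z)
    (hf : f ∈ forms (n - 4)) (hv : ∀ V ∈ residualSet Z, VanishesAt f V)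
    (h : ZeroOnEdges Z f ⟨0, by omega⟩ ⟨2, by omega⟩) {a b : Fin n} (hab : SkewEdges a b) :
    ZeroOnEdges Z f a b := by
  have right : ∀ (i j : ℕ) (hij : i + 2 ≤ j) (hj : j + 1 < n), (i ≠ 0 ∨ j + 1 + 1 ≠ n) →
      ZeroOnEdges Z f ⟨i, by omega⟩ ⟨j, by omega⟩ → ZeroOnEdges Z f ⟨i, by omega⟩ ⟨j + 1, hj⟩ := by
    intro i j hij hj hne hz
    have := hz.succ_right hu hn hgen hf hv
    rw [cycSucc_mk hj] at this
    exact this (skewEdges_of_val (by simp; omega) hne)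
  have left : ∀ (i j : ℕ) (hij : i + 3 ≤ j) (hj : j < n),
      ZeroOnEdges Z f ⟨i, by omega⟩ ⟨j, hj⟩ → ZeroOnEdges Z f ⟨i + 1, by omega⟩ ⟨j, hj⟩ := by
    intro i j hij hj hz
    have := hz.succ_left hu hn hgen hf hv
    rw [cycSucc_mk (by omega)] at this
    exact this (skewEdges_of_val (by simp; omega) (Or.inl (by simp)))
  have diag : ∀ (i : ℕ) (hi : i + 2 < n), ZeroOnEdges Z f ⟨i, by omega⟩ ⟨i + 2, hi⟩ := by
    intro i
    induction i with
    | zero => exact fun _ => h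
    | succ i ih =>
      intro hi
      -- The pair (i, i+2) moves to (i+1, i+3) through (i, i+3), since (i+1, i+2) would not be skew.
      -- For i = 0 the intermediate pair is skew because n ≥ 5.
      exact left _ _ (by omega) _ (right _ _ le_rfl (by omega) (by omega) (ih (by omega)))
  have all : ∀ (i k : ℕ) (hk : i + 2 + k < n), (i ≠ 0 ∨ i + 2 + k + 1 ≠ n) →
      ZeroOnEdges Z f ⟨i, by omega⟩ ⟨i + 2 + k, hk⟩ := by
    intro i k
    induction k with
    | zero => exact fun hk _ => diag i hk
    | succ k ih =>
      intro hk hne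
      exact right i (i + 2 + k) (by omega) hk hne (ih (by omega) (by omega))
  have main : ∀ a b : Fin n, (a : ℕ) ≤ b → SkewEdges a b → ZeroOnEdges Z f a b := by
    intro a b hle hab
    obtain ⟨h1, h2⟩ := hab.val hle
    have := all a (b - a - 2) (by omega) (by omega)
    convert this
    omega
  rcases le_total (a : ℕ) b with hle | hle
  · exact main a b hle hab
  · exact (main b a hle hab.symm).symm hf

/-- Edge functionals are pairwise independent if the point is not coplanar with them. -/
theorem exists_independent_values {A : Fin 4 → ℂ} {b c : Fin n} {w : Fin n}
    (hw : w = b ∨ w = cycSucc b) (h : edgeBr Z A (zc Z w) c ≠ 0) {D : Fin 4 → ℂ}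
    (hD : edgeBr Z A D b ≠ 0) : ∃ B C, edgeBr Z A B b * edgeBr Z A C c ≠
      edgeBr Z A B c * edgeBr Z A C b := by
  refine ⟨D, zc Z w, ?_⟩
  have : edgeBr Z A (zc Z w) b = 0 := by
    rcases hw with rfl | rfl <;> simp [edgeBr]
  rw [this, mul_zero]
  exact mul_ne_zero hD h

theorem exists_of_edgeBr_eq_zero {A B D : Fin 4 → ℂ} {b : Fin n} (hD : edgeBr Z A D b ≠ 0)
    (h : edgeBr Z A B b = 0) : ∃ (s : ℂ) (y : ℂ × ℂ), B = s • A + edgeMap Z b y := by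
  have h1 : br A (zc Z b) (zc Z (cycSucc b)) D ≠ 0 := by
    rw [br_swap₃₄, br_swap₂₃]
    simpa [edgeBr] using hD
  have h2 : br B A (zc Z b) (zc Z (cycSucc b)) = 0 := by
    rw [br_swap₁₂, neg_eq_zero]
    exact h
  obtain ⟨s, x, y, rfl⟩ := Submodule.mem_span_triple.1 (mem_span_triple_of_br h1 h2)
  exact ⟨s, (x, y), by rw [edgeMap_apply]; module⟩

/-- From a general point P of the edge `a`, the planes joining P to the edges skew to `a` number at
least n-3, one more than the degree. A line through P in such a plane meets the corresponding edge.
-/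
theorem evalAt_edge_of_zeroOnEdges (hu : Uniform Z) (hn : 5 ≤ n) (hf : f ∈ forms (n - 4))
    {a : Fin n} (h : ∀ b, SkewEdges a b → ZeroOnEdges Z f a b) (x : ℂ × ℂ) (B : Fin 4 → ℂ) :
    evalAt (edgeMap Z a x) B f = 0 := by
  have hn4 : 4 ≤ n := by omega
  refine evalAt_edge_of_eventually hf ?_ x
  set T : Finset (Fin n) := {a, cycPred a, cycSucc a}ᶜ with hT
  have hmem : ∀ c, c ∈ T ↔ SkewEdges a c := by
    intro c
    simp only [hT, Finset.mem_compl, Finset.mem_insert, Finset.mem_singleton, not_or,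
      eq_cycPred_iff, SkewEdges]
    tauto
  have hcard : n - 4 < T.card := by
    rw [hT, Finset.card_compl, Fintype.card_fin]
    have := Finset.card_le_three (a := a) (b := cycPred a) (c := cycSucc a)
    omega
  have h1 : ∀ᶠ t : ℂ in Filter.cofinite, ∀ b ∈ T, ∀ c ∈ T, b ≠ c →
      ∃ w, (w = b ∨ w = cycSucc b) ∧ edgeBr Z (edgeMap Z a (1 - t, t)) (zc Z w) c ≠ 0 := by
    simp only [Filter.eventually_all_finset, Filter.eventually_all]
    intro b hb c hc hbc
    obtain ⟨w, hw, h⟩ := exists_edgeBr_ne hu hn4 ((hmem b).1 hb) ((hmem c).1 hc) hbc (Or.inl rfl)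
    filter_upwards [PolyFun.eventually_ne (polyFun_edgeBr (polyVec_edgeMap a)
      (PolyVec.const (zc Z w)) c) (t₀ := 0) (by simpa [edgeMap_apply] using h)] with t ht
    exact ⟨w, hw, ht⟩
  filter_upwards [h1, eventually_ne_const 1] with t h1 h2
  set P := edgeMap Z a (1 - t, t) with hP
  have hD : ∀ b ∈ T, edgeBr Z P (zc Z (cycSucc a)) b ≠ 0 := by
    intro b hb
    obtain ⟨e1, e2, e3⟩ := (hmem b).1 hb
    rw [hP, edgeMap_apply, edgeBr, br_add₁, br_smul₁, br_smul₁, br_same₁₂, mul_zero, add_zero]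
    exact mul_ne_zero (sub_ne_zero.2 h2.symm) (hu.edgeBr_ne hn4 e1 e3.symm e2
      (fun h => e1 (cycSucc_inj.1 h)) (cycSucc_ne hn4 a).symm)
  refine (lineDegLE_evalAt hf P).eq_zero T hcard
    (fun c => brLin P (zc Z c) (zc Z (cycSucc c))) ?_ ?_ B
  · intro b hb c hc hbc
    obtain ⟨w, hw, hne⟩ := h1 b hb c hc hbc
    exact exists_independent_values hw hne (hD b hb)
  · intro b hb C hC
    obtain ⟨s, y, rfl⟩ := exists_of_edgeBr_eq_zero (hD b hb) hC
    rw [evalAt_add_smul hf]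
    exact h b ((hmem b).1 hb) _ _

/-- The same count with an arbitrary first point and the n planes joining it to all edges. -/
theorem eq_zero_of_zeroOnEdges (hu : Uniform Z) (hn : 5 ≤ n) (hf : f ∈ forms (n - 4))
    (h : ∀ a b, SkewEdges a b → ZeroOnEdges Z f a b) : f = 0 := by
  have hn4 : 4 ≤ n := by omega
  -- Moving A in the direction W takes it off every plane spanned by an edge and a further vertex,
  -- so that the n planes become distinct; the result returns to A by polynomial continuation.
  obtain ⟨W, hW⟩ := Module.Dual.exists_forall_ne_zero_of_forall_exists (K := ℂ) (M := Fin 4 → ℂ)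
    (ι := {x : Fin n × Fin n // x.1 ≠ x.2 ∧ x.1 ≠ cycSucc x.2})
    (fun x => brLin (zc Z x.1.1) (zc Z x.1.2) (zc Z (cycSucc x.1.2))) (by
      rintro ⟨⟨w, c⟩, h1, h2⟩
      obtain ⟨l, hl1, hl2, hl3⟩ := exists_other hn4 w c (cycSucc c)
      exact ⟨zc Z l, hu.edgeBr_ne hn4 h1 h2 hl2.symm hl3.symm hl1⟩)
  refine eq_zero_of_evalAt fun A B => ?_
  have h1 : ∀ᶠ t : ℂ in Filter.cofinite, ∀ w c : Fin n, w ≠ c → w ≠ cycSucc c →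
      edgeBr Z (A + t • W) (zc Z w) c ≠ 0 := by
    simp only [Filter.eventually_all]
    intro w c hwc hwc'
    have hne : edgeBr Z W (zc Z w) c ≠ 0 := by
      rw [edgeBr_swap, neg_ne_zero]
      exact hW ⟨(w, c), hwc, hwc'⟩
    have hp := polyFun_edgeBr (Z := Z) ((PolyVec.const A).add (PolyVec.smul PolyFun.id
      (PolyVec.const W))) (PolyVec.const (zc Z w)) c
    by_cases h0 : edgeBr Z A (zc Z w) c = 0
    · refine PolyFun.eventually_ne hp (t₀ := 1) ?_
      rw [edgeBr, br_add₁, br_smul₁]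
      rw [edgeBr] at h0 hne
      simpa [h0] using hne
    · exact PolyFun.eventually_ne hp (t₀ := 0) (by simpa using h0)
  have key := PolyFun.eq_zero_of_eventually (polyFun_evalAt f ((PolyVec.const A).add
    (PolyVec.smul PolyFun.id (PolyVec.const W))) (PolyVec.const B)) (by
      filter_upwards [h1] with t h1
      have hD : ∀ b, ∃ D, edgeBr Z (A + t • W) D b ≠ 0 := by
        intro b
        obtain ⟨l, hl1, hl2, -⟩ := exists_other hn4 b (cycSucc b) b
        exact ⟨_, h1 l b hl1.symm hl2.symm⟩
      refine (lineDegLE_evalAt hf (A + t • W)).eq_zero Finset.univ (by simp; omega)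
        (fun c => brLin (A + t • W) (zc Z c) (zc Z (cycSucc c))) ?_ ?_ B
      · intro b _ c _ hbc
        obtain ⟨w, hw, hwc, hwc'⟩ := exists_end_notMem hn4 hbc
        obtain ⟨D, hD⟩ := hD b
        exact exists_independent_values hw (h1 w c hwc hwc') hD
      · intro b _ C hC
        obtain ⟨D, hD⟩ := hD b
        obtain ⟨s, y, rfl⟩ := exists_of_edgeBr_eq_zero hD hC
        rw [evalAt_add_smul hf]
        exact evalAt_swap hf (evalAt_edge_of_zeroOnEdges hu hn hf (h b) y _)) 0
  simpa using key

/-- There is a line such that no nonzero adjoint vanishes at it. -/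
theorem exists_test_point (hu : Uniform Z) (hn : 5 ≤ n) (hgen : IsGeneral Z) :
    ∃ A B, ∀ f ∈ forms (n - 4), (∀ V ∈ residualSet Z, VanishesAt f V) → evalAt A B f = 0 →
      f = 0 := by
  obtain ⟨A, B, h⟩ := exists_test_line hu hn hgen (a := ⟨0, by omega⟩) (b := ⟨2, by omega⟩)
    (skewEdges_of_val (by simp) (Or.inr (by simp; omega)))
  exact ⟨A, B, fun f hf hv h0 => eq_zero_of_zeroOnEdges hu hn hf fun a b hab =>
    zeroOnEdges_of_zeroOnEdges hu hn hgen hf hv (h f hf hv h0) hab⟩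

/-- Evaluation at the test line is injective on the space of adjoints. -/
theorem adjoint_unique (hu : Uniform Z) (hn : 5 ≤ n) (hgen : IsGeneral Z) {g : CoordRing}
    (hf : f ∈ forms (n - 4)) (hv : ∀ V ∈ residualSet Z, VanishesAt f V) (hf0 : f ≠ 0)
    (hg : g ∈ forms (n - 4)) (hv' : ∀ V ∈ residualSet Z, VanishesAt g V) : ∃ c : ℂ, g = c • f := by
  obtain ⟨A, B, h⟩ := exists_test_point hu hn hgen
  have h0 : evalAt A B f ≠ 0 := fun h0 => hf0 (h f hf hv h0)
  refine ⟨evalAt A B g / evalAt A B f, ?_⟩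
  rw [← sub_eq_zero]
  refine h _ (Submodule.sub_mem _ hg (Submodule.smul_mem _ _ hf)) ?_ ?_
  · intro V hV A B hAB
    rw [map_sub, map_smul, hv V hV A B hAB, hv' V hV A B hAB]
    simp
  · rw [map_sub, map_smul, smul_eq_mul, div_mul_cancel₀ _ h0, sub_self]

end Unique

/-! ### The adjoint as an explicit sum -/

section Adjoint

/-- `⟨A p (p+1) (p+2)⟩`. -/
def planeBr (z : ℕ → Fin 4 → ℂ) (A : Fin 4 → ℂ) (p : ℕ) : ℂ := br A (z p) (z (p + 1)) (z (p + 2))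

/-- `⟨A B k (k+1)⟩`. -/
def stepBr (z : ℕ → Fin 4 → ℂ) (A B : Fin 4 → ℂ) (k : ℕ) : ℂ := br A B (z k) (z (k + 1))

/-- The numerator attached to a pair of planes. -/
def adjNum (z : ℕ → Fin 4 → ℂ) (A B : Fin 4 → ℂ) (p q : ℕ) : ℂ :=
  -- For neighbouring planes the expression of the other branch equals this constant times `stepBr z
  -- A B (p + 1)`. That factor is cancelled, since p + 1 = q is removed only once in `restProd`.
  if q = p + 1 then br (z p) (z (p + 1)) (z (p + 2)) (z (p + 3))
  else planeBr z A p * planeBr z B q - planeBr z B p * planeBr z A q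

/-- The product of the brackets of all edges of the open polygon outside of `S`. -/
def restProd (M : ℕ) (z : ℕ → Fin 4 → ℂ) (A B : Fin 4 → ℂ) (S : Finset ℕ) : ℂ :=
  ∏ k ∈ Finset.range (M + 1) \ S, stepBr z A B k

/-- The summands of the adjoint. -/
def adjTerm (M : ℕ) (z : ℕ → Fin 4 → ℂ) (A B : Fin 4 → ℂ) (p q : ℕ) : ℂ :=
  br (z (M + 1)) (z 0) (z (p + 1)) (z (q + 1)) * adjNum z A B p q *
    restProd M z A B {p, p + 1, q, q + 1}

/-- The index set of the sum defining the adjoint. -/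
def adjPairs (M : ℕ) : Finset (ℕ × ℕ) :=
  (Finset.range M ×ˢ Finset.range M).filter fun x => x.1 < x.2

theorem mem_adjPairs {M : ℕ} {x : ℕ × ℕ} : x ∈ adjPairs M ↔ x.1 < x.2 ∧ x.2 < M := by
  simp only [adjPairs, Finset.mem_filter, Finset.mem_product, Finset.mem_range]
  omega

/-- The value of the adjoint at the line `A B`. -/
def adjVal (M : ℕ) (z : ℕ → Fin 4 → ℂ) (A B : Fin 4 → ℂ) : ℂ :=
  ∑ x ∈ adjPairs M, adjTerm M z A B x.1 x.2

variable {M : ℕ} {z : ℕ → Fin 4 → ℂ} {P Q : Fin 4 → ℂ}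

theorem restProd_eq {S T : Finset ℕ} {k : ℕ} (hk : k ≤ M) (hS : k ∉ S)
    (hT : ∀ m, m ∈ T ↔ m = k ∨ m ∈ S) :
    restProd M z P Q S = stepBr z P Q k * restProd M z P Q T := by
  have hT' : T = insert k S := by ext m; simp [hT]
  rw [restProd, restProd, hT', Finset.sdiff_insert, Finset.mul_prod_erase]
  simp [hS]; omega

theorem restProd_eq_zero {S : Finset ℕ} {k : ℕ} (hk : k ≤ M) (hS : k ∉ S)
    (h : stepBr z P Q k = 0) : restProd M z P Q S = 0 :=
  Finset.prod_eq_zero (i := k) (by simp [hS]; omega) h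

theorem adjTerm_eq_zero_of_step {p q k : ℕ} (hk : k ≤ M) (h : stepBr z P Q k = 0)
    (hS : ¬ (k = p ∨ k = p + 1 ∨ k = q ∨ k = q + 1)) : adjTerm M z P Q p q = 0 := by
  rw [adjTerm, restProd_eq_zero hk (by simpa using hS) h, mul_zero]

/-- Both vanishing brackets must be among the omitted factors. As they are at least two apart, each
of the two blocks {p, p+1}, {q, q+1} has to omit one of them, in order. -/
theorem adjTerm_eq_zero_of_steps {p q a b : ℕ} (hpq : p < q) (hab : a + 2 ≤ b) (hb : b ≤ M)
    (ha₀ : stepBr z P Q a = 0) (hb₀ : stepBr z P Q b = 0)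
    (h : ¬ ((a = p ∨ a = p + 1) ∧ (b = q ∨ b = q + 1))) : adjTerm M z P Q p q = 0 := by
  by_cases h' : a = p ∨ a = p + 1 ∨ a = q ∨ a = q + 1
  · exact adjTerm_eq_zero_of_step hb hb₀ (by omega)
  · exact adjTerm_eq_zero_of_step (by omega) ha₀ h'

theorem adjVal_eq_sum (S : Finset (ℕ × ℕ)) (hS : ∀ x ∈ S, x.1 < x.2 ∧ x.2 < M)
    (h : ∀ p q, p < q → q < M → (p, q) ∉ S → adjTerm M z P Q p q = 0) :
    adjVal M z P Q = ∑ x ∈ S, adjTerm M z P Q x.1 x.2 := by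
  symm
  apply Finset.sum_subset
  · intro x hx
    exact mem_adjPairs.2 (hS x hx)
  · intro x hx hx'
    exact h _ _ (mem_adjPairs.1 hx).1 (mem_adjPairs.1 hx).2 hx'

/-- The adjoint vanishes at the lines meeting three disjoint edges of the open polygon. -/
theorem adjVal_eq_zero_of_steps {a b c : ℕ} (hab : a + 2 ≤ b) (hbc : b + 2 ≤ c) (hc : c ≤ M)
    (ha₀ : stepBr z P Q a = 0) (hb₀ : stepBr z P Q b = 0) (hc₀ : stepBr z P Q c = 0) :
    adjVal M z P Q = 0 := by
  rw [adjVal_eq_sum ∅ (by simp), Finset.sum_empty]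
  intro p q hpq _ _
  by_cases h : (a = p ∨ a = p + 1) ∧ (b = q ∨ b = q + 1)
  -- Two blocks of consecutive edges cannot omit three pairwise disjoint edges.
  · exact adjTerm_eq_zero_of_step hc hc₀ (by omega)
  · exact adjTerm_eq_zero_of_steps hpq hab (by omega) ha₀ hb₀ h

theorem adjNum_eq_zero {p q r : ℕ} (hpq : q ≠ p + 1) (hr : r = p ∨ r = q) (hP : planeBr z P r = 0)
    (hQ : planeBr z Q r = 0) : adjNum z P Q p q = 0 := by
  rw [adjNum, if_neg hpq]
  rcases hr with rfl | rfl <;> simp [hP, hQ]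

/-- The adjoint vanishes at the lines in a plane meeting an edge of the open polygon. -/
theorem adjVal_eq_zero_of_plane {p b : ℕ} (hb : b ≤ M) (hpb : b + 2 ≤ p ∨ p + 3 ≤ b)
    (hpM : p + 1 ≤ M) (hP : planeBr z P p = 0) (hQ : planeBr z Q p = 0)
    (h₁ : stepBr z P Q p = 0) (h₂ : stepBr z P Q (p + 1) = 0) (h₃ : stepBr z P Q b = 0) :
    adjVal M z P Q = 0 := by
  rw [adjVal_eq_sum ∅ (by simp), Finset.sum_empty]
  intro i j hij _ _
  by_cases h : i = p ∧ (b = j ∨ b = j + 1) ∨ j = p ∧ (b = i ∨ b = i + 1)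
  · rw [adjTerm, adjNum_eq_zero (r := p) (by omega) (by omega) hP hQ]
    simp
  · by_cases h4 : b = i ∨ b = i + 1 ∨ b = j ∨ b = j + 1
    · by_cases h5 : p = i ∨ p = i + 1 ∨ p = j ∨ p = j + 1
      · exact adjTerm_eq_zero_of_step hpM h₂ (by omega)
      · exact adjTerm_eq_zero_of_step (by omega) h₁ h5
    · exact adjTerm_eq_zero_of_step hb h₃ h4

theorem br_comb_left₁ (s s' : ℂ) (x y w A : Fin 4 → ℂ) :
    br (s • x + s' • y) A y w = -s * br A x y w := by
  simp only [br_eq, Pi.add_apply, Pi.smul_apply, smul_eq_mul]; ring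
theorem br_comb_left₂ (s s' : ℂ) (x y w A : Fin 4 → ℂ) :
    br (s • x + s' • y) A w x = -s' * br A w x y := by
  simp only [br_eq, Pi.add_apply, Pi.smul_apply, smul_eq_mul]; ring
theorem br_comb_right₁ (s s' : ℂ) (x y w A : Fin 4 → ℂ) :
    br A (s • x + s' • y) y w = s * br A x y w := by
  simp only [br_eq, Pi.add_apply, Pi.smul_apply, smul_eq_mul]; ring
theorem br_comb_right₂ (s s' : ℂ) (x y w A : Fin 4 → ℂ) :
    br A (s • x + s' • y) w x = s' * br A w x y := by
  simp only [br_eq, Pi.add_apply, Pi.smul_apply, smul_eq_mul]; ring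

theorem adjNum_of_ne {p q : ℕ} (h : q ≠ p + 1) (hP : planeBr z P p = 0) :
    adjNum z P Q p q = -(planeBr z Q p * planeBr z P q) := by
  rw [adjNum, if_neg h, hP]; ring

theorem adjNum_succ (p : ℕ) :
    adjNum z P Q p (p + 1) = br (z p) (z (p + 1)) (z (p + 2)) (z (p + 3)) := if_pos rfl

/-- Terms sharing p and having neighbouring second indices carry the two coordinates of Q on its
edge; by linearity their sum contains the bracket of Q with the closing edge and z_{p+1}. -/
theorem row_sum {p b : ℕ} (hpb : p + 2 ≤ b) (hb : b + 2 ≤ M) (hP : planeBr z P p = 0) {t t' : ℂ}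
    (hQ : Q = t • z (b + 1) + t' • z (b + 2)) :
    adjTerm M z P Q p b + adjTerm M z P Q p (b + 1) =
      -planeBr z Q p * planeBr z P b * planeBr z P (b + 1) *
        restProd M z P Q {p, p + 1, b, b + 1, b + 2} *
        br (z (M + 1)) (z 0) (z (p + 1)) Q := by
  rw [adjTerm, adjTerm, adjNum_of_ne (by omega) hP, adjNum_of_ne (by omega) hP,
    restProd_eq (S := {p, p + 1, b, b + 1}) (T := {p, p + 1, b, b + 1, b + 2}) (k := b + 2)
      (by omega) (by simp; omega) (by simp; omega),
    restProd_eq (S := {p, p + 1, b + 1, b + 1 + 1}) (T := {p, p + 1, b, b + 1, b + 2}) (k := b)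
      (by omega) (by simp; omega) (by simp; omega)]
  have e1 : stepBr z P Q (b + 2) = t * planeBr z P (b + 1) := by
    rw [hQ]; exact br_comb_right₁ _ _ _ _ _ _
  have e2 : stepBr z P Q b = t' * planeBr z P b := by
    rw [hQ]; exact br_comb_right₂ _ _ _ _ _ _
  have e3 : br (z (M + 1)) (z 0) (z (p + 1)) Q = t * br (z (M + 1)) (z 0) (z (p + 1)) (z (b + 1)) +
      t' * br (z (M + 1)) (z 0) (z (p + 1)) (z (b + 2)) := by
    rw [hQ, br_add₄, br_smul₄, br_smul₄]
  rw [e1, e2, e3]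
  ring

/-- The variant in which the first of the two terms belongs to neighbouring planes and has a
constant numerator. -/
theorem row_sum_succ {p : ℕ} (hb : p + 3 ≤ M) (hP : planeBr z P p = 0) {t t' : ℂ}
    (hQ : Q = t • z (p + 2) + t' • z (p + 3)) :
    adjTerm M z P Q p (p + 1) + adjTerm M z P Q p (p + 2) =
      br (z p) (z (p + 1)) (z (p + 2)) (z (p + 3)) * planeBr z P (p + 2) *
        restProd M z P Q {p, p + 1, p + 2, p + 3} * br (z (M + 1)) (z 0) (z (p + 1)) Q := by
  rw [adjTerm, adjTerm, adjNum_succ, adjNum_of_ne (by omega) hP,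
    restProd_eq (S := {p, p + 1, p + 1, p + 1 + 1}) (T := {p, p + 1, p + 2, p + 3}) (k := p + 3)
      (by omega) (by simp) (by simp; omega)]
  have e1 : stepBr z P Q (p + 3) = t * planeBr z P (p + 2) := by
    rw [hQ]; exact br_comb_right₁ _ _ _ _ _ _
  have e2 : planeBr z Q p = -t' * br (z p) (z (p + 1)) (z (p + 2)) (z (p + 3)) := by
    rw [hQ, planeBr, br_add₁, br_smul₁, br_smul₁, br_same₁₄]
    simp only [br_eq]; ring
  have e3 : br (z (M + 1)) (z 0) (z (p + 1)) Q = t * br (z (M + 1)) (z 0) (z (p + 1)) (z (p + 2)) +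
      t' * br (z (M + 1)) (z 0) (z (p + 1)) (z (p + 3)) := by
    rw [hQ, br_add₄, br_smul₄, br_smul₄]
  rw [e1, e2, e3]
  ring

theorem planeBr_edge_left {a : ℕ} {s s' : ℂ} (hP : P = s • z a + s' • z (a + 1)) :
    planeBr z P a = 0 := by
  rw [hP, planeBr, br_add₁, br_smul₁, br_smul₁]; simp

theorem planeBr_edge_right {a : ℕ} {s s' : ℂ} (hP : P = s • z (a + 1) + s' • z (a + 2)) :
    planeBr z P a = 0 := by
  rw [hP, planeBr, br_add₁, br_smul₁, br_smul₁]; simp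

/-- The same collapse in the first index, with P in place of Q. -/
theorem col_sum {a q : ℕ} (haq : a + 3 ≤ q) (hq : q < M) {s s' : ℂ}
    (hP : P = s • z (a + 1) + s' • z (a + 2)) :
    adjTerm M z P Q a q + adjTerm M z P Q (a + 1) q =
      planeBr z P q * planeBr z Q a * planeBr z Q (a + 1) *
        restProd M z P Q {a, a + 1, a + 2, q, q + 1} *
        br (z (M + 1)) (z 0) P (z (q + 1)) := by
  rw [adjTerm, adjTerm, adjNum_of_ne (by omega) (planeBr_edge_right hP),
    adjNum_of_ne (by omega) (planeBr_edge_left hP),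
    restProd_eq (S := {a, a + 1, q, q + 1}) (T := {a, a + 1, a + 2, q, q + 1}) (k := a + 2)
      (by omega) (by simp; omega) (by simp; omega),
    restProd_eq (S := {a + 1, a + 1 + 1, q, q + 1}) (T := {a, a + 1, a + 2, q, q + 1}) (k := a)
      (by omega) (by simp; omega) (by simp)]
  have e1 : stepBr z P Q (a + 2) = -s * planeBr z Q (a + 1) := by
    rw [hP]; exact br_comb_left₁ _ _ _ _ _ _
  have e2 : stepBr z P Q a = -s' * planeBr z Q a := by
    rw [hP]; exact br_comb_left₂ _ _ _ _ _ _
  have e3 : br (z (M + 1)) (z 0) P (z (q + 1)) = s * br (z (M + 1)) (z 0) (z (a + 1)) (z (q + 1)) +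
      s' * br (z (M + 1)) (z 0) (z (a + 2)) (z (q + 1)) := by
    rw [hP, br_add₃, br_smul₃, br_smul₃]
  rw [e1, e2, e3]
  ring

theorem col_sum_succ {a : ℕ} (hq : a + 2 < M) {s s' : ℂ}
    (hP : P = s • z (a + 1) + s' • z (a + 2)) :
    adjTerm M z P Q a (a + 2) + adjTerm M z P Q (a + 1) (a + 2) =
      -planeBr z Q a * br (z (a + 1)) (z (a + 2)) (z (a + 3)) (z (a + 4)) *
        restProd M z P Q {a, a + 1, a + 2, a + 3} *
        br (z (M + 1)) (z 0) P (z (a + 3)) := by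
  rw [adjTerm, adjTerm, adjNum_of_ne (by omega) (planeBr_edge_right hP), adjNum_succ,
    restProd_eq (S := {a + 1, a + 1 + 1, a + 2, a + 2 + 1}) (T := {a, a + 1, a + 2, a + 3})
      (k := a) (by omega) (by simp; omega) (by simp)]
  have e1 : planeBr z P (a + 2) = s * br (z (a + 1)) (z (a + 2)) (z (a + 3)) (z (a + 4)) := by
    rw [hP, planeBr, br_add₁, br_smul₁, br_smul₁, br_same₁₂]; ring
  have e2 : stepBr z P Q a = -s' * planeBr z Q a := by
    rw [hP]; exact br_comb_left₂ _ _ _ _ _ _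
  have e3 : br (z (M + 1)) (z 0) P (z (a + 3)) = s * br (z (M + 1)) (z 0) (z (a + 1)) (z (a + 3)) +
      s' * br (z (M + 1)) (z 0) (z (a + 2)) (z (a + 3)) := by
    rw [hP, br_add₃, br_smul₃, br_smul₃]
  rw [e1, e2, e3]
  ring

theorem stepBr_edge_left {a : ℕ} {s s' : ℂ} (hP : P = s • z a + s' • z (a + 1)) :
    stepBr z P Q a = 0 := by
  rw [hP, stepBr, br_add₁, br_smul₁, br_smul₁]; simp

theorem stepBr_edge_right {b : ℕ} {t t' : ℂ} (hQ : Q = t • z b + t' • z (b + 1)) :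
    stepBr z P Q b = 0 := by
  rw [hQ, stepBr, br_add₂, br_smul₂, br_smul₂]; simp

/-- The adjoint vanishes at the lines meeting two edges and the closing edge. -/
theorem adjVal_eq_zero_of_edges {a b : ℕ} (hab : a + 2 ≤ b) (hb : b + 2 ≤ M) {s s' t t' : ℂ}
    (hP : P = s • z (a + 1) + s' • z (a + 2)) (hQ : Q = t • z (b + 1) + t' • z (b + 2))
    (h : br (z (M + 1)) (z 0) P Q = 0) : adjVal M z P Q = 0 := by
  -- Four terms survive. Summed by rows and then over the two coordinates of P they become a
  -- multiple of the bracket of P and Q with the closing edge.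
  rw [adjVal_eq_sum {(a, b), (a, b + 1), (a + 1, b), (a + 1, b + 1)} (by simp; omega) (by
    intro p q hpq hq hS
    refine adjTerm_eq_zero_of_steps hpq (a := a + 1) (b := b + 1) (by omega) (by omega)
      (stepBr_edge_left hP) (stepBr_edge_right hQ) ?_
    simp at hS
    omega)]
  rw [Finset.sum_insert (by simp; try omega), Finset.sum_insert (by simp),
    Finset.sum_insert (by simp), Finset.sum_singleton]
  simp only
  rw [← add_assoc, row_sum hab hb (planeBr_edge_right hP) hQ]
  have e0 : br (z (M + 1)) (z 0) P Q = s * br (z (M + 1)) (z 0) (z (a + 1)) Q +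
      s' * br (z (M + 1)) (z 0) (z (a + 2)) Q := by
    rw [hP, br_add₃, br_smul₃, br_smul₃]
  have e2 : stepBr z P Q a = -s' * planeBr z Q a := by
    rw [hP]; exact br_comb_left₂ _ _ _ _ _ _
  -- When b = a + 2, the row of a + 1 starts with a pair of neighbouring planes.
  rcases hab.eq_or_lt with rfl | hab'
  · rw [row_sum_succ (p := a + 1) (by omega) (planeBr_edge_left hP) hQ,
      restProd_eq (S := {a + 1, a + 1 + 1, a + 1 + 2, a + 1 + 3})
        (T := {a, a + 1, a + 2, a + 2 + 1, a + 2 + 2})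
        (k := a) (by omega) (by simp; try omega) (by simp; try omega), e2]
    have e1 : planeBr z P (a + 2) = s * br (z (a + 1)) (z (a + 2)) (z (a + 3)) (z (a + 4)) := by
      rw [hP, planeBr, br_add₁, br_smul₁, br_smul₁, br_same₁₂]; ring
    rw [e0] at h
    rw [e1]
    linear_combination (-planeBr z Q a * br (z (a + 1)) (z (a + 2)) (z (a + 3)) (z (a + 4)) *
      planeBr z P (a + 2 + 1) * restProd M z P Q {a, a + 1, a + 2, a + 2 + 1, a + 2 + 2}) * h
  · rw [row_sum (p := a + 1) (by omega) hb (planeBr_edge_left hP) hQ,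
      restProd_eq (S := {a, a + 1, b, b + 1, b + 2}) (T := {a, a + 1, a + 2, b, b + 1, b + 2})
        (k := a + 2) (by omega) (by simp; omega) (by simp; omega),
      restProd_eq (S := {a + 1, a + 1 + 1, b, b + 1, b + 2})
        (T := {a, a + 1, a + 2, b, b + 1, b + 2})
        (k := a) (by omega) (by simp; omega) (by simp; try omega), e2]
    have e1 : stepBr z P Q (a + 2) = -s * planeBr z Q (a + 1) := by
      rw [hP]; exact br_comb_left₁ _ _ _ _ _ _
    rw [e0] at h
    rw [e1]
    linear_combination (planeBr z Q a * planeBr z Q (a + 1) * planeBr z P b *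
      planeBr z P (b + 1) * restProd M z P Q {a, a + 1, a + 2, b, b + 1, b + 2}) * h

/-- For lines in the plane around the vertex z 0: only the row p = 0 survives, and its sum contains
the equation of that plane at Q. -/
theorem adjVal_eq_zero_of_first {b : ℕ} (hb₁ : 1 ≤ b) (hb : b + 2 ≤ M) {s s' t t' : ℂ}
    (hP : P = s • z 0 + s' • z 1) (hQ : Q = t • z (b + 1) + t' • z (b + 2))
    (h : br (z (M + 1)) (z 0) (z 1) Q = 0) : adjVal M z P Q = 0 := by
  rw [adjVal_eq_sum {(0, b), (0, b + 1)} (by simp; omega) (by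
    intro p q hpq hq hS
    refine adjTerm_eq_zero_of_steps hpq (a := 0) (b := b + 1) (by omega) (by omega)
      (stepBr_edge_left hP) (stepBr_edge_right hQ) ?_
    simp at hS
    omega)]
  rw [Finset.sum_insert (by simp), Finset.sum_singleton]
  simp only
  rcases hb₁.eq_or_lt with rfl | hb'
  · rw [row_sum_succ (p := 0) (by omega) (planeBr_edge_left hP) hQ, h, mul_zero]
  · rw [row_sum (p := 0) (by omega) hb (planeBr_edge_left hP) hQ, h, mul_zero]

/-- For lines in the plane around the last vertex z (M + 1): only the last column survives, and its
sum contains the equation of that plane at P. -/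
theorem adjVal_eq_zero_of_last {a q : ℕ} (haq : a + 2 ≤ q) (hq : q + 1 = M) {s s' t t' : ℂ}
    (hP : P = s • z (a + 1) + s' • z (a + 2)) (hQ : Q = t • z (q + 1) + t' • z (q + 2))
    (h : br (z (M + 1)) (z 0) P (z (q + 1)) = 0) : adjVal M z P Q = 0 := by
  rw [adjVal_eq_sum {(a, q), (a + 1, q)} (by simp; omega) (by
    intro i j hij hj hS
    refine adjTerm_eq_zero_of_steps hij (a := a + 1) (b := q + 1) (by omega) (by omega)
      (stepBr_edge_left hP) (stepBr_edge_right hQ) ?_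
    simp at hS
    omega)]
  rw [Finset.sum_insert (by simp), Finset.sum_singleton]
  simp only
  rcases haq.eq_or_lt with rfl | hb'
  · rw [col_sum_succ (by omega) hP, h, mul_zero]
  · rw [col_sum (by omega) (by omega) hP, h, mul_zero]

/-- The adjoint vanishes at the lines in a plane meeting the closing edge. -/
theorem adjVal_eq_zero_of_plane_of_closing {p : ℕ} (hp : p + 3 ≤ M) {a b c a' b' c' : ℂ}
    (hP : P = a • z (p + 1) + b • z (p + 2) + c • z (p + 3))
    (hQ : Q = a' • z (p + 1) + b' • z (p + 2) + c' • z (p + 3))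
    (h : br (z (M + 1)) (z 0) P Q = 0) : adjVal M z P Q = 0 := by
  have hP₁ : planeBr z P (p + 1) = 0 := by
    rw [hP, planeBr]; simp [br_add₁, br_smul₁]
  have hQ₁ : planeBr z Q (p + 1) = 0 := by
    rw [hQ, planeBr]; simp [br_add₁, br_smul₁]
  have h₁ : stepBr z P Q (p + 1) = 0 := by
    rw [hP, hQ, stepBr]; simp [br_add₁, br_smul₁, br_add₂, br_smul₂]
  have h₂ : stepBr z P Q (p + 2) = 0 := by
    rw [hP, hQ, stepBr]; simp [br_add₁, br_smul₁, br_add₂, br_smul₂]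
  -- The plane p + 1 may occur only next to a neighbour, where the numerator is constant; otherwise
  -- p and p + 2 must omit the two vanishing edges. The three terms are the Plücker coordinates of
  -- the line within the plane, paired with the closing edge.
  rw [adjVal_eq_sum {(p, p + 1), (p + 1, p + 2), (p, p + 2)} (by simp; omega) (by
    intro i j hij hj hS
    simp at hS
    by_cases h' : i = p + 1 ∨ j = p + 1
    · rw [adjTerm, adjNum_eq_zero (r := p + 1) (by omega) (by omega) hP₁ hQ₁]
      simp
    · by_cases h3 : p + 1 = i ∨ p + 1 = i + 1 ∨ p + 1 = j ∨ p + 1 = j + 1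
      · exact adjTerm_eq_zero_of_step (by omega) h₂ (by omega)
      · exact adjTerm_eq_zero_of_step (by omega) h₁ h3)]
  rw [Finset.sum_insert (by simp), Finset.sum_insert (by simp), Finset.sum_singleton]
  simp only [adjTerm]
  rw [adjNum_succ, adjNum_succ, adjNum, if_neg (by omega),
    restProd_eq (S := {p, p + 1, p + 1, p + 1 + 1}) (T := {p, p + 1, p + 2, p + 3}) (k := p + 3)
      (by omega) (by simp) (by simp; omega),
    restProd_eq (S := {p + 1, p + 1 + 1, p + 2, p + 2 + 1}) (T := {p, p + 1, p + 2, p + 3}) (k := p)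
      (by omega) (by simp; omega) (by simp)]
  set D := br (z p) (z (p + 1)) (z (p + 2)) (z (p + 3)) with hD
  set E := br (z (p + 1)) (z (p + 2)) (z (p + 3)) (z (p + 4)) with hE
  have hl : ∀ x y w : ℂ, planeBr z (x • z (p + 1) + y • z (p + 2) + w • z (p + 3)) p = -w * D := by
    intro x y w
    simp only [hD, planeBr, br_eq, Pi.add_apply, Pi.smul_apply, smul_eq_mul]; ring
  have hr : ∀ x y w : ℂ,
      planeBr z (x • z (p + 1) + y • z (p + 2) + w • z (p + 3)) (p + 2) = x * E := by
    intro x y w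
    simp only [hE, planeBr, br_eq, Pi.add_apply, Pi.smul_apply, smul_eq_mul]; ring
  have e1 : stepBr z P Q p = (b * c' - c * b') * D := by
    rw [hP, hQ, stepBr]
    simp only [hD, br_eq, Pi.add_apply, Pi.smul_apply, smul_eq_mul]; ring
  have e2 : stepBr z P Q (p + 3) = (a * b' - b * a') * E := by
    rw [hP, hQ, stepBr]
    simp only [hE, br_eq, Pi.add_apply, Pi.smul_apply, smul_eq_mul]; ring
  have e3 : br (z (M + 1)) (z 0) P Q =
      (a * b' - b * a') * br (z (M + 1)) (z 0) (z (p + 1)) (z (p + 2)) +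
      (b * c' - c * b') * br (z (M + 1)) (z 0) (z (p + 2)) (z (p + 3)) +
      (a * c' - c * a') * br (z (M + 1)) (z 0) (z (p + 1)) (z (p + 3)) := by
    rw [hP, hQ]
    simp only [br_add₃, br_smul₃, br_add₄, br_smul₄, br_same₃₄]
    rw [br_swap₃₄ _ _ (z (p + 1)) (z (p + 2)), br_swap₃₄ _ _ (z (p + 2)) (z (p + 3)),
      br_swap₃₄ _ _ (z (p + 1)) (z (p + 3))]
    ring
  rw [e3] at h
  rw [e1, e2]
  rw [hP, hQ, hl, hl, hr, hr, ← hP, ← hQ]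
  linear_combination D * E * restProd M z P Q {p, p + 1, p + 2, p + 3} * h

end Adjoint

/-! ### The explicit sum as an adjoint polynomial -/

section Existence

/-- The coefficients of the linear function `⟨· x y w⟩`. -/
def covec (x y w : Fin 4 → ℂ) : Fin 4 → ℂ := fun i => br (Pi.single i 1) x y w

theorem sum_covec (A x y w : Fin 4 → ℂ) : ∑ i, A i * covec x y w i = br A x y w := by
  simp [covec, br_eq, Fin.sum_univ_four]; ring

theorem pairing_plucker (A B u v : Fin 4 → ℂ) : pairing (plucker A B) (plucker u v) =
    (∑ i, A i * u i) * (∑ i, B i * v i) - (∑ i, B i * u i) * (∑ i, A i * v i) := by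
  simp [pairing, plucker, Fin.sum_univ_six, Fin.sum_univ_four]; ring

/-- The polynomial with values `adjNum`. -/
def adjNumForm (z : ℕ → Fin 4 → ℂ) (p q : ℕ) : MvPolynomial (Fin 6) ℂ :=
  if q = p + 1 then MvPolynomial.C (br (z p) (z (p + 1)) (z (p + 2)) (z (p + 3)))
  else linForm (plucker (covec (z p) (z (p + 1)) (z (p + 2))) (covec (z q) (z (q + 1)) (z (q + 2))))

/-- The explicit adjoint polynomial. -/
def adjForm (M : ℕ) (z : ℕ → Fin 4 → ℂ) : MvPolynomial (Fin 6) ℂ :=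
  ∑ x ∈ adjPairs M, MvPolynomial.C (br (z (M + 1)) (z 0) (z (x.1 + 1)) (z (x.2 + 1))) *
    adjNumForm z x.1 x.2 *
    ∏ k ∈ Finset.range (M + 1) \ {x.1, x.1 + 1, x.2, x.2 + 1}, linForm (dualPlucker (z k) (z (k + 1)))

theorem eval_adjForm (M : ℕ) (z : ℕ → Fin 4 → ℂ) (A B : Fin 4 → ℂ) :
    MvPolynomial.eval (plucker A B) (adjForm M z) = adjVal M z A B := by
  rw [adjForm, adjVal, map_sum]
  refine Finset.sum_congr rfl fun x _ => ?_
  rw [adjTerm, map_mul, map_mul, MvPolynomial.eval_C, map_prod, restProd]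
  congr 2
  · rw [adjNumForm, adjNum]
    split_ifs
    · rw [MvPolynomial.eval_C]
    · rw [eval_linForm, pairing_plucker]
      simp only [sum_covec, planeBr]
  · funext k
    rw [eval_linForm, ← br_eq_pairing, stepBr]

/-- Of M + 1 linear edge factors, neighbouring planes omit three and have a constant numerator;
other pairs omit four and have a linear one. Both give M - 2 = n - 4, where n = M + 2. -/
theorem adjForm_isHomogeneous (M : ℕ) (z : ℕ → Fin 4 → ℂ) :
    (adjForm M z).IsHomogeneous (M - 2) := by
  refine MvPolynomial.IsHomogeneous.sum _ _ _ fun x hx => ?_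
  obtain ⟨h1, h2⟩ := mem_adjPairs.1 hx
  obtain ⟨p, q⟩ := x
  simp only at h1 h2
  have hsub : ({p, p + 1, q, q + 1} : Finset ℕ) ⊆ Finset.range (M + 1) := by
    intro k hk
    simp at hk ⊢
    omega
  have hprod := MvPolynomial.IsHomogeneous.prod (R := ℂ)
    (Finset.range (M + 1) \ {p, p + 1, q, q + 1})
    (fun k => linForm (dualPlucker (z k) (z (k + 1)))) (fun _ => 1)
    fun k _ => linForm_isHomogeneous _
  rw [Finset.sum_const, smul_eq_mul, mul_one, Finset.card_sdiff_of_subset hsub,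
    Finset.card_range] at hprod
  by_cases h : q = p + 1
  · subst h
    have hc : ({p, p + 1, p + 1, p + 1 + 1} : Finset ℕ).card = 3 := by
      rw [Finset.card_insert_of_notMem (by simp; omega), Finset.insert_idem, Finset.card_pair (by simp)]
    rw [hc] at hprod
    rw [adjNumForm, if_pos rfl]
    have := ((MvPolynomial.isHomogeneous_C (Fin 6)
      (br (z (M + 1)) (z 0) (z (p + 1)) (z (p + 1 + 1)))).mul
      (MvPolynomial.isHomogeneous_C (Fin 6) (br (z p) (z (p + 1)) (z (p + 2)) (z (p + 3))))).mul
      hprod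
    convert this using 1
    omega
  · have hc : ({p, p + 1, q, q + 1} : Finset ℕ).card = 4 := by
      rw [Finset.card_insert_of_notMem (by simp; omega),
        Finset.card_insert_of_notMem (by simp; omega), Finset.card_pair (by simp)]
    rw [hc] at hprod
    rw [adjNumForm, if_neg h]
    have := ((MvPolynomial.isHomogeneous_C (Fin 6)
      (br (z (M + 1)) (z 0) (z (p + 1)) (z (q + 1)))).mul (linForm_isHomogeneous (plucker
      (covec (z p) (z (p + 1)) (z (p + 2))) (covec (z q) (z (q + 1)) (z (q + 2)))))).mul hprod
    convert this using 1
    omega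

/-- The adjoint does not vanish at the line through the second and the fourth vertex. -/
theorem adjVal_ne_zero {M : ℕ} (hM : 3 ≤ M) {z : ℕ → Fin 4 → ℂ}
    (hz : ∀ i j k l : ℕ, i < M + 2 → j < M + 2 → k < M + 2 → l < M + 2 → i ≠ j → i ≠ k → i ≠ l →
      j ≠ k → j ≠ l → k ≠ l → br (z i) (z j) (z k) (z l) ≠ 0) :
    adjVal M z (z 1) (z 3) ≠ 0 := by
  have s0 : stepBr z (z 1) (z 3) 0 = 0 := br_same₁₄ _ _ _
  have s1 : stepBr z (z 1) (z 3) 1 = 0 := br_same₁₃ _ _ _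
  have s2 : stepBr z (z 1) (z 3) 2 = 0 := br_same₂₄ _ _ _
  have s3 : stepBr z (z 1) (z 3) 3 = 0 := br_same₂₃ _ _ _
  -- The line z 1 z 3 meets the edges 0, 1, 2, 3, and only the pair (0, 2) omits all four of them.
  rw [adjVal_eq_sum {(0, 2)} (by simp; omega) (by
    intro p q hpq hq hS
    simp at hS
    by_cases h : (0 = p ∨ 0 = p + 1) ∧ (2 = q ∨ 2 = q + 1)
    · exact adjTerm_eq_zero_of_step (k := 3) (by omega) s3 (by omega)
    · exact adjTerm_eq_zero_of_steps hpq (a := 0) (b := 2) (by omega) (by omega) s0 s2 h),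
    Finset.sum_singleton, adjTerm]
  simp only [zero_add]
  refine mul_ne_zero (mul_ne_zero ?_ ?_) ?_
  · apply hz <;> omega
  · have h1 : planeBr z (z 1) 0 = 0 := br_same₁₃ _ _ _
    rw [adjNum_of_ne (by omega) h1, neg_ne_zero]
    refine mul_ne_zero ?_ ?_
    · apply hz <;> omega
    · apply hz <;> omega
  · rw [restProd, Finset.prod_ne_zero_iff]
    intro k hk
    simp at hk
    apply hz <;> omega

variable {M : ℕ} {Z : Matrix (Fin (M + 2)) (Fin 4) ℝ}

/-- The vertices indexed by natural numbers. -/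
def znat (Z : Matrix (Fin (M + 2)) (Fin 4) ℝ) (k : ℕ) : Fin 4 → ℂ :=
  if h : k < M + 2 then zc Z ⟨k, h⟩ else 0

theorem znat_of_eq {c : Fin (M + 2)} {k : ℕ} (h : (c : ℕ) = k) : znat Z k = zc Z c := by
  subst h
  rw [znat, dif_pos c.isLt]

theorem Uniform.znat_ne (hu : Uniform Z) (i j k l : ℕ) (hi : i < M + 2) (hj : j < M + 2)
    (hk : k < M + 2) (hl : l < M + 2) (h₁ : i ≠ j) (h₂ : i ≠ k) (h₃ : i ≠ l) (h₄ : j ≠ k)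
    (h₅ : j ≠ l) (h₆ : k ≠ l) : br (znat Z i) (znat Z j) (znat Z k) (znat Z l) ≠ 0 := by
  rw [znat_of_eq (c := ⟨i, hi⟩) rfl, znat_of_eq (c := ⟨j, hj⟩) rfl, znat_of_eq (c := ⟨k, hk⟩) rfl,
    znat_of_eq (c := ⟨l, hl⟩) rfl]
  apply hu.br_ne <;> simpa

theorem znat_succ {c : Fin (M + 2)} {k : ℕ} (h : (c : ℕ) = k) (hk : k ≤ M) :
    znat Z (k + 1) = zc Z (cycSucc c) :=
  znat_of_eq (by rw [cycSucc_val, if_neg (by omega), h])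

theorem znat_zero {c : Fin (M + 2)} (h : (c : ℕ) = M + 1) : znat Z 0 = zc Z (cycSucc c) :=
  znat_of_eq (by rw [cycSucc_val, if_pos (by omega)])

theorem stepBr_of_mem (hu : Uniform Z) (hM : 3 ≤ M) {V : Gr ℂ 2 4} {A B : Fin 4 → ℂ}
    (hV : V.space = Submodule.span ℂ {A, B}) {c : Fin (M + 2)} (hc : V ∈ lineCondition Z c)
    (hcM : (c : ℕ) ≤ M) : stepBr (znat Z) A B c = 0 := by
  rw [stepBr, znat_of_eq rfl, znat_succ rfl hcM]
  exact (mem_lineCondition_iff_br hu (by omega) hV c).1 hc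

theorem closingBr_of_mem (hu : Uniform Z) (hM : 3 ≤ M) {V : Gr ℂ 2 4} {A B : Fin 4 → ℂ}
    (hV : V.space = Submodule.span ℂ {A, B}) {c : Fin (M + 2)} (hc : V ∈ lineCondition Z c)
    (hcM : (c : ℕ) = M + 1) : br (znat Z (M + 1)) (znat Z 0) A B = 0 := by
  rw [br_pairs, znat_of_eq hcM, znat_zero hcM]
  exact (mem_lineCondition_iff_br hu (by omega) hV c).1 hc

/-- A line through two skew edges is spanned by a point of each. -/
theorem exists_edge_points (hu : Uniform Z) (hM : 3 ≤ M) {V : Gr ℂ 2 4} {a b : Fin (M + 2)}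
    (hab : SkewEdges a b) (ha : V ∈ lineCondition Z a) (hb : V ∈ lineCondition Z b)
    (haM : (a : ℕ) ≤ M) (hbM : (b : ℕ) ≤ M) : ∃ (s s' t t' : ℂ) (P Q : Fin 4 → ℂ),
      P = s • znat Z a + s' • znat Z (a + 1) ∧ Q = t • znat Z b + t' • znat Z (b + 1) ∧
      V.space = Submodule.span ℂ {P, Q} := by
  obtain ⟨P, hP, hP', hP0⟩ := mem_lineCondition.1 ha
  obtain ⟨Q, hQ, hQ', hQ0⟩ := mem_lineCondition.1 hb
  have hl := indep_of_lines (hu.br_ne (cycSucc_ne (by omega) a).symm hab.1 hab.2.2.symm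
    hab.2.1 (fun h => hab.1 (cycSucc_inj.1 h)) (cycSucc_ne (by omega) b).symm) hP' hQ' hP0 hQ0
  obtain ⟨s, s', e⟩ := Submodule.mem_span_pair.1 hP'
  obtain ⟨t, t', e'⟩ := Submodule.mem_span_pair.1 hQ'
  refine ⟨s, s', t, t', P, Q, ?_, ?_, V.eq_span_of_mem hP hQ hl⟩
  · rw [← e, znat_of_eq rfl, znat_succ rfl haM]
  · rw [← e', znat_of_eq rfl, znat_succ rfl hbM]

theorem exists_adjVal_eq_zero_of_conic (hu : Uniform Z) (hM : 3 ≤ M) {V : Gr ℂ 2 4}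
    {a b c : Fin (M + 2)} (hab : SkewEdges a b) (hac : SkewEdges a c) (hbc : SkewEdges b c)
    (hab' : (a : ℕ) ≤ b) (hbc' : (b : ℕ) ≤ c) (ha : V ∈ lineCondition Z a)
    (hb : V ∈ lineCondition Z b) (hc : V ∈ lineCondition Z c) :
    ∃ A B, V.space = Submodule.span ℂ {A, B} ∧ adjVal M (znat Z) A B = 0 := by
  obtain ⟨h1, -⟩ := hab.val hab'
  obtain ⟨h2, h3⟩ := hbc.val hbc'
  obtain ⟨-, h4⟩ := hac.val (hab'.trans hbc')
  have hc' := c.isLt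
  by_cases hcM : (c : ℕ) ≤ M
  · obtain ⟨A, B, -, hV⟩ := V.exists_basis
    exact ⟨A, B, hV, adjVal_eq_zero_of_steps h1 h2 hcM (stepBr_of_mem hu hM hV ha (by omega))
      (stepBr_of_mem hu hM hV hb (by omega)) (stepBr_of_mem hu hM hV hc hcM)⟩
  -- Here `c` is the closing edge. Being skew to it, the other two edges have positive indices, so
  -- they can be shifted down by one.
  · obtain ⟨s, s', t, t', P, Q, hP, hQ, hV⟩ :=
      exists_edge_points hu hM hab ha hb (by omega) (by omega)
    obtain ⟨a', ea⟩ : ∃ a', (a : ℕ) = a' + 1 := ⟨a - 1, by omega⟩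
    obtain ⟨b', eb⟩ : ∃ b', (b : ℕ) = b' + 1 := ⟨b - 1, by omega⟩
    rw [ea] at hP
    rw [eb] at hQ
    exact ⟨P, Q, hV, adjVal_eq_zero_of_edges (a := a') (b := b') (by omega) (by omega) hP hQ
      (closingBr_of_mem hu hM hV hc (by omega))⟩

theorem exists_adjVal_eq_zero_of_plane (hu : Uniform Z) (hM : 3 ≤ M) {V : Gr ℂ 2 4}
    {k j : Fin (M + 2)} (hp : V ∈ planeCondition Z (cycSucc k)) (hj : V ∈ lineCondition Z j)
    (h₁ : SkewEdges k j) (h₂ : SkewEdges (cycSucc k) j) :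
    ∃ A B, V.space = Submodule.span ℂ {A, B} ∧ adjVal M (znat Z) A B = 0 := by
  have hkv := cycSucc_val k
  have hk := k.isLt
  have hj' := j.isLt
  have hp' := hp
  rw [mem_planeCondition_succ] at hp
  rcases Nat.lt_trichotomy (k : ℕ) M with hkM | hkM | hkM
  · -- the plane of three consecutive vertices of the open polygon
    rw [if_neg (by omega)] at hkv
    obtain ⟨A, B, -, hV⟩ := V.exists_basis
    have e1 := znat_of_eq (Z := Z) (c := k) rfl
    have e2 := znat_succ (Z := Z) (c := k) rfl (by omega)
    have e3 := znat_succ (Z := Z) (c := cycSucc k) hkv (by omega)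
    rw [← e1, ← e2, ← e3] at hp
    have hA := hp (by rw [hV]; exact Submodule.subset_span (by simp) : A ∈ V.space)
    have hB := hp (by rw [hV]; exact Submodule.subset_span (by simp) : B ∈ V.space)
    obtain ⟨a, b, c, hA⟩ := Submodule.mem_span_triple.1 hA
    obtain ⟨a', b', c', hB⟩ := Submodule.mem_span_triple.1 hB
    refine ⟨A, B, hV, ?_⟩
    by_cases hjM : (j : ℕ) ≤ M
    · refine adjVal_eq_zero_of_plane (p := k) (b := j) hjM ?_ (by omega) ?_ ?_ ?_ ?_
        (stepBr_of_mem hu hM hV hj hjM)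
      · rcases le_total (k : ℕ) j with h | h
        · have := (h₂.val (by have := h₁.val h; omega)).1
          omega
        · have := (h₁.symm.val h).1
          omega
      · rw [← hA, planeBr]; simp [br_add₁, br_smul₁]
      · rw [← hB, planeBr]; simp [br_add₁, br_smul₁]
      · exact stepBr_of_mem hu hM hV (plane_succ_subset_line hu (by omega) k hp') (by omega)
      · rw [← hkv]
        exact stepBr_of_mem hu hM hV (plane_subset_line hu (by omega) _ hp') (by omega)
    · have h3 := (h₁.val (by omega)).2
      have h4 := h₂.val (by omega)
      obtain ⟨p, ep⟩ : ∃ p, (k : ℕ) = p + 1 := ⟨k - 1, by omega⟩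
      rw [ep] at hA hB
      exact adjVal_eq_zero_of_plane_of_closing (p := p) (by omega) hA.symm hB.symm
        (closingBr_of_mem hu hM hV hj (by omega))
  · -- the last vertex
    rw [if_neg (by omega)] at hkv
    have hjk : (j : ℕ) < k := by
      by_contra h
      have := (h₁.val (by omega)).1
      omega
    have h3 := (h₁.symm.val (by omega)).1
    have h4 := (h₂.symm.val (by omega)).2
    obtain ⟨s, s', t, t', P, Q, hP, hQ, hV⟩ := exists_edge_points hu hM h₁.symm hj
      (plane_succ_subset_line hu (by omega) k hp') (by omega) (by omega)
    obtain ⟨a, ea⟩ : ∃ a, (j : ℕ) = a + 1 := ⟨j - 1, by omega⟩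
    obtain ⟨q, eq⟩ : ∃ q, (k : ℕ) = q + 1 := ⟨k - 1, by omega⟩
    have e1 := znat_of_eq (Z := Z) (c := k) eq
    have e2 := znat_of_eq (Z := Z) (c := cycSucc k) (k := M + 1) (by omega)
    have e3 := znat_zero (Z := Z) (c := cycSucc k) (by omega)
    rw [← e1, ← e2, ← e3] at hp
    have hPm := hp (by rw [hV]; exact Submodule.subset_span (by simp) : P ∈ V.space)
    obtain ⟨x, y, w, e⟩ := Submodule.mem_span_triple.1 hPm
    rw [ea] at hP
    rw [eq] at hQ
    refine ⟨P, Q, hV, adjVal_eq_zero_of_last (a := a) (q := q) (by omega) (by omega) hP hQ ?_⟩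
    rw [← e]
    simp [br_add₃, br_smul₃]
  · -- the first vertex
    rw [if_pos (by omega)] at hkv
    have h3 := h₂.val (by omega)
    have h4 : (j : ℕ) + 2 ≤ k := by
      by_contra h
      have := h₁.symm.val (by omega)
      omega
    obtain ⟨s, s', t, t', P, Q, hP, hQ, hV⟩ := exists_edge_points hu hM h₂
      (plane_subset_line hu (by omega) _ hp') hj (by omega) (by omega)
    obtain ⟨b, eb⟩ : ∃ b, (j : ℕ) = b + 1 := ⟨j - 1, by omega⟩
    have e1 := znat_of_eq (Z := Z) (c := k) (k := M + 1) (by omega)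
    have e2 := znat_of_eq (Z := Z) (c := cycSucc k) hkv
    have e3 := znat_succ (Z := Z) (c := cycSucc k) hkv (by omega)
    rw [← e1, ← e2, ← e3] at hp
    have hQm := hp (by rw [hV]; exact Submodule.subset_span (by simp) : Q ∈ V.space)
    obtain ⟨x, y, w, e⟩ := Submodule.mem_span_triple.1 hQm
    rw [hkv] at hP
    rw [eb] at hQ
    refine ⟨P, Q, hV, adjVal_eq_zero_of_first (b := b) (by omega) (by omega) hP hQ ?_⟩
    rw [← e]
    simp [br_add₄, br_smul₄]

theorem exists_adjVal_eq_zero (hu : Uniform Z) (hM : 3 ≤ M) {V : Gr ℂ 2 4}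
    (hV : V ∈ residualSet Z) :
    ∃ A B, V.space = Submodule.span ℂ {A, B} ∧ adjVal M (znat Z) A B = 0 := by
  have skew : ∀ {i j : Fin (M + 2)}, Disjoint ({i, cycSucc i} : Set (Fin (M + 2))) {j, cycSucc j} →
      SkewEdges i j := fun h => by
    rw [disjoint_pair_pair] at h
    exact ⟨h.1, h.2.2.1, h.2.1.symm⟩
  obtain ⟨S, ⟨i, j, hd, rfl⟩ | ⟨i, j, k, hij, hik, hjk, rfl⟩, hV⟩ := hV
  · obtain ⟨k, rfl⟩ : ∃ k, i = cycSucc k := ⟨cycPred i, (cycSucc_cycPred i).symm⟩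
    rw [cycPred_cycSucc, disjoint_triple_pair] at hd
    exact exists_adjVal_eq_zero_of_plane hu hM hV.1 hV.2 ⟨hd.1, hd.2.2.1, hd.2.1.symm⟩
      ⟨hd.2.2.1, hd.2.2.2.2.1, hd.2.2.2.1.symm⟩
  · obtain ⟨⟨hi, hj⟩, hk⟩ := hV
    replace hij := skew hij
    replace hik := skew hik
    replace hjk := skew hjk
    rcases le_total (i : ℕ) j with h1 | h1 <;> rcases le_total (j : ℕ) k with h2 | h2
    · exact exists_adjVal_eq_zero_of_conic hu hM hij hik hjk h1 h2 hi hj hk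
    · rcases le_total (i : ℕ) k with h3 | h3
      · exact exists_adjVal_eq_zero_of_conic hu hM hik hij hjk.symm h3 h2 hi hk hj
      · exact exists_adjVal_eq_zero_of_conic hu hM hik.symm hjk.symm hij h3 h1 hk hi hj
    · rcases le_total (i : ℕ) k with h3 | h3
      · exact exists_adjVal_eq_zero_of_conic hu hM hij.symm hjk hik h1 h3 hj hi hk
      · exact exists_adjVal_eq_zero_of_conic hu hM hjk hij.symm hik.symm h2 h3 hj hk hi
    · exact exists_adjVal_eq_zero_of_conic hu hM hjk.symm hik.symm hij.symm h2 h1 hk hj hi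

/-- There is an adjoint polynomial. -/
theorem exists_adjoint {n : ℕ} {Z : Matrix (Fin n) (Fin 4) ℝ} (hu : Uniform Z) (hn : 5 ≤ n) :
    ∃ f ∈ forms (n - 4), f ≠ 0 ∧ ∀ V ∈ residualSet Z, VanishesAt f V := by
  obtain ⟨M, rfl⟩ : ∃ M, n = M + 2 := ⟨n - 2, by omega⟩
  have hM : 3 ≤ M := by omega
  have hf : Ideal.Quotient.mk pluckerIdeal (adjForm M (znat Z)) ∈ forms (M + 2 - 4) :=
    mem_forms.2 ⟨_, adjForm_isHomogeneous M _, rfl⟩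
  refine ⟨_, hf, ?_, fun V hV => ?_⟩
  · intro h
    have := evalAt_mk (znat Z 1) (znat Z 3) (adjForm M (znat Z))
    rw [h, map_zero, eval_adjForm] at this
    exact adjVal_ne_zero hM hu.znat_ne this.symm
  · obtain ⟨A, B, hAB, h⟩ := exists_adjVal_eq_zero hu hM hV
    rw [vanishesAt_iff hf V hAB, evalAt_mk, eval_adjForm, h]

/-- Forms of degree zero are constants. -/
theorem exists_smul_one_of_mem_forms_zero {f : CoordRing} (hf : f ∈ forms 0) :
    ∃ c : ℂ, f = c • (1 : CoordRing) := by
  obtain ⟨F, hF, rfl⟩ := mem_forms.1 hf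
  refine ⟨MvPolynomial.coeff 0 F, ?_⟩
  have hF' : F = MvPolynomial.C (MvPolynomial.coeff 0 F) :=
    MvPolynomial.totalDegree_eq_zero_iff_eq_C.1 (Nat.le_zero.1 (MvPolynomial.IsHomogeneous.totalDegree_le hF))
  conv_lhs => rw [hF']
  exact Algebra.algebraMap_eq_smul_one (R := ℂ) (A := CoordRing) _

/-- Four vertices leave no room for the required disjoint index sets. -/
theorem residualSet_eq_empty {Z : Matrix (Fin 4) (Fin 4) ℝ} : residualSet Z = ∅ := by
  rw [Set.eq_empty_iff_forall_notMem]
  have key : (∀ i j : Fin 4, ¬ (cycPred i ≠ j ∧ cycPred i ≠ cycSucc j ∧ i ≠ j ∧ i ≠ cycSucc j ∧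
      cycSucc i ≠ j ∧ cycSucc i ≠ cycSucc j)) ∧ ∀ i j k : Fin 4,
      ¬ ((i ≠ j ∧ i ≠ cycSucc j ∧ cycSucc i ≠ j ∧ cycSucc i ≠ cycSucc j) ∧
        (i ≠ k ∧ i ≠ cycSucc k ∧ cycSucc i ≠ k ∧ cycSucc i ≠ cycSucc k) ∧
        (j ≠ k ∧ j ≠ cycSucc k ∧ cycSucc j ≠ k ∧ cycSucc j ≠ cycSucc k)) := by decide
  rintro V ⟨S, ⟨i, j, hd, rfl⟩ | ⟨i, j, k, hij, hik, hjk, rfl⟩, -⟩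
  · exact key.1 i j (disjoint_triple_pair.1 hd)
  · exact key.2 i j k ⟨disjoint_pair_pair.1 hij, disjoint_pair_pair.1 hik, disjoint_pair_pair.1 hjk⟩

end Existence

end TreeAmplituhedron

end

open TreeAmplituhedron in
theorem theorem5p2 (n : ℕ) (hn : 4 ≤ n) (Z : Matrix (Fin n) (Fin 4) ℝ)
    (hZ : IsTotallyPositive Z) (hgen : IsGeneral Z) :
    residualArrangement Z = ⋃₀ {S | IsResidualLine Z S ∨ IsResidualConic Z S} ∧
    ∃ α : CoordRing, α ≠ 0 ∧ IsAdjointPolynomial Z α ∧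
      ∀ β : CoordRing, IsAdjointPolynomial Z β → ∃ c : ℂ, β = c • α := by
  obtain ⟨ε, hε⟩ := hZ.exists_orderedSign hn
  have hu := hZ.uniform
  have hR := residualArrangement_eq hu hn hε
  refine ⟨hR, ?_⟩
  simp only [IsAdjointPolynomial, hR]
  -- For n = 4 adjoints have degree zero and no vanishing is required, so the constant 1 serves as
  -- `α`.
  rcases hn.eq_or_lt with rfl | hn5
  · refine ⟨1, fun h => ?_, ⟨one_mem_forms, ?_⟩, fun β hβ => exists_smul_one_of_mem_forms_zero hβ.1⟩
    · have := congrArg (evalAt 0 0) h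
      simp at this
    · rw [residualSet_eq_empty]
      exact fun Y hY => hY.elim
  · obtain ⟨α, hα, hα0, hv⟩ := exists_adjoint hu hn5
    exact ⟨α, hα0, ⟨hα, hv⟩, fun β hβ => adjoint_unique hu hn5 hgen hα hv hα0 hβ.1 hβ.2⟩
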